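/- Let $(M,g)$ be a type D vacuum solution: a smooth four-dimensional space-time of signature $(-,+,+,+)$ with $Ric=0$ whose Weyl tensor $W$ is everywhere of Petrov--Bel type D. On a positively oriented chart let $\eta$ be the volume element, $*$ the Hodge dual, $G_{\alpha\beta\gamma\delta}=g_{\alpha\gamma}g_{\beta\delta}-g_{\alpha\delta}g_{\beta\gamma}$, $\mathcal G=\tfrac12(G-\mathrm i\,\eta)$ and $\mathcal W=\tfrac12(W-\mathrm i*W)$. Type D means that $\mathcal W$, acting on the self-dual bivectors ($*\mathcal F=\mathrm i\mathcal F$) by $\mathcal W(\mathcal F)_{\alpha\beta}=\tfrac12\mathcal W_{\alpha\beta}{}^{\gamma\delta}\mathcal F_{\gamma\delta}$, is diagonalizable with a double eigenvalue $w\neq0$ and a simple eigenvalue $-2w$. Let $\mathcal U$ be the canonical bivector, i.e. a self-dual eigenbivector for $-2w$ with $\tfrac12\,\mathcal U_{\alpha\beta}\mathcal U^{\alpha\beta}=-1$; let $\mathcal U$ and a cube root $w^{1/3}$ be chosen smoothly on the chart domain, and let $Z=w^{-1/3}\,\delta\mathcal U$, where $(\delta\mathcal U)_\beta=-\nabla_\alpha\mathcal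 U^{\alpha}{}_{\beta}$. Then: (1) $\nabla_\alpha\nabla_\beta Z_\gamma = Z^\delta\big[\,w\,(3\,\mathcal U\otimes\mathcal U+\mathcal G)+\bar w\,(3\,\bar{\mathcal U}\otimes\bar{\mathcal U}+\bar{\mathcal G})\big]_{\delta\alpha\beta\gamma}$. (2) All covariant derivatives of the Riemann tensor depend at most on the second-order quantities $(w,\mathcal U,Z,\nabla Z)$: for every $n\ge0$, each component of $\nabla^n Riem$ in a chart is a polynomial in the components of $g$, $g^{-1}$, $\eta$, in $w^{1/3}$ and the components of $\mathcal U$, $Z$, $\nabla Z$, and in the complex conjugates of these, and this polynomial is the same for all type D vacuum solutions, charts and points. (3) All covariant derivatives of the Riemann tensor depend at most on those of order at most two: if, at a point of a type D vacuum solution and at a point of another (or the same) one, the components of $g$, $Riem$, $\nabla Riem$ and $\nabla\nabla Riem$ in some charts coincide, then so do the components of $\nabla^n Riem$ for every $n\ge0$. -/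

import Mathlib

open scoped ContDiff Manifold

noncomputable section

namespace TypeD

/-- The coordinate space. -/
abbrev Coord : Type := EuclideanSpace ℝ (Fin 4)

/-- The `a`-th coordinate vector. -/
abbrev coordVec (a : Fin 4) : Coord := EuclideanSpace.single a (1 : ℝ)

/-- Components (in a coordinate domain) of a covariant tensor field of rank `k`, with complex
values. -/
abbrev TField (k : ℕ) : Type := Coord → (Fin k → Fin 4) → ℂ

/-- Components of a covariant 2-tensor at a point. -/
abbrev Bitensor : Type := Fin 4 → Fin 4 → ℂ

/-- Components of a covariant 4-tensor at a point. -/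
abbrev Quadtensor : Type := Fin 4 → Fin 4 → Fin 4 → Fin 4 → ℂ

/-! ### Levi-Civita connection and curvature of a metric given by its components -/

section Coordinates

variable (g : Coord → Matrix (Fin 4) (Fin 4) ℝ)

/-- Contravariant components `g^{ab}` of the metric. -/
def ginv (y : Coord) (a b : Fin 4) : ℝ := (g y)⁻¹ a b

/-- The partial derivative `∂_c g_{ab}`. -/
def dg (y : Coord) (c a b : Fin 4) : ℝ := fderiv ℝ (fun z => g z a b) y (coordVec c)

/-- Christoffel symbols `Γ^m_{ab}`. -/
def christoffel (y : Coord) (m a b : Fin 4) : ℝ :=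
  (1 / 2) * ∑ l, ginv g y m l * (dg g y a b l + dg g y b a l - dg g y l a b)

/-- `R^a_{bcd} = ∂_c Γ^a_{bd} - ∂_d Γ^a_{bc} + Γ^e_{bd} Γ^a_{ec} - Γ^e_{bc} Γ^a_{ed}`. -/
def riemannUp (y : Coord) (a b c d : Fin 4) : ℝ :=
  fderiv ℝ (fun z => christoffel g z a b d) y (coordVec c)
    - fderiv ℝ (fun z => christoffel g z a b c) y (coordVec d)
    + ∑ e, (christoffel g y e b d * christoffel g y a e c
      - christoffel g y e b c * christoffel g y a e d)

/-- The Riemann tensor `R_{abcd} = g_{ae} R^e_{bcd}`. -/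
def riemann (y : Coord) (a b c d : Fin 4) : ℝ := ∑ e, g y a e * riemannUp g y e b c d

/-- The Ricci tensor `R_{bd} = R^a_{bad}`. -/
def ricci (y : Coord) (b d : Fin 4) : ℝ := ∑ a, riemannUp g y a b a d

/-- The scalar curvature. -/
def scalarCurv (y : Coord) : ℝ := ∑ a, ∑ b, ginv g y a b * ricci g y a b

/-- The metric on the space of 2-forms, `G_{abcd} = g_{ac} g_{bd} - g_{ad} g_{bc}`. -/
def bigG (y : Coord) (a b c d : Fin 4) : ℝ := g y a c * g y b d - g y a d * g y b c

/-- The Weyl tensor (in dimension four). -/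
def weyl (y : Coord) (a b c d : Fin 4) : ℝ :=
  riemann g y a b c d
    - (1 / 2) * (g y a c * ricci g y b d - g y a d * ricci g y b c
        + g y b d * ricci g y a c - g y b c * ricci g y a d)
    + (scalarCurv g y / 6) * bigG g y a b c d

/-- The Riemann tensor as a rank 4 tensor field. -/
def riemannField : TField 4 := fun y i => (riemann g y (i 0) (i 1) (i 2) (i 3) : ℂ)

/-- The covariant derivative
`(∇T)_{a i₁ … i_k} = ∂_a T_{i₁ … i_k} - ∑_r Γ^m_{a i_r} T_{i₁ … m … i_k}`;
the index of differentiation comes first. -/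
def nabla {k : ℕ} (T : TField k) : TField (k + 1) := fun y i =>
  fderiv ℝ (fun z => T z (Fin.tail i)) y (coordVec (i 0))
    - ∑ r : Fin k, ∑ m : Fin 4,
        (christoffel g y m (i 0) (Fin.tail i r) : ℂ) * T y (Function.update (Fin.tail i) r m)

/-- The `n`-th covariant derivative `∇ⁿT`. -/
def nablaIter {k : ℕ} (T : TField k) : (n : ℕ) → TField (k + n)
  | 0 => T
  | n + 1 => nabla g (nablaIter T n)

/-! ### Self-dual bivectors and the algebraic Weyl variables -/

/-- The permutation symbol, `ε_{0123} = 1`. -/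
def permSymbol (i : Fin 4 → Fin 4) : ℝ :=
  Matrix.det (Matrix.of fun r c : Fin 4 => if i r = c then (1 : ℝ) else 0)

/-- The metric volume element `η_{abcd}`, for the orientation given by the coordinates. -/
def eta (y : Coord) (a b c d : Fin 4) : ℝ := √(-(g y).det) * permSymbol ![a, b, c, d]

/-- Raising both indices of a 2-tensor. -/
def raise (y : Coord) (F : Bitensor) (a b : Fin 4) : ℂ :=
  ∑ c, ∑ d, (ginv g y a c : ℂ) * (ginv g y b d : ℂ) * F c d

/-- The product `(A, B) = ½ A_{ab} B^{ab}`. -/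
def pairing (y : Coord) (A B : Bitensor) : ℂ := (1 / 2) * ∑ a, ∑ b, A a b * raise g y B a b

/-- The action of a double 2-form on a 2-form, `V(F)_{ab} = ½ V_{ab}^{cd} F_{cd}`. -/
def act (y : Coord) (V : Quadtensor) (F : Bitensor) : Bitensor := fun a b =>
  (1 / 2) * ∑ c, ∑ d, V a b c d * raise g y F c d

/-- The Hodge dual `*F` of a 2-form. -/
def hodge (y : Coord) (F : Bitensor) : Bitensor :=
  act g y (fun a b c d => (eta g y a b c d : ℂ)) F

/-- The self-dual Weyl tensor `𝒲 = ½ (W - i *W)`. -/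
def sdWeyl (y : Coord) : Quadtensor := fun a b c d =>
  (1 / 2) * ((weyl g y a b c d : ℂ)
    - Complex.I * hodge g y (fun e f => (weyl g y e f c d : ℂ)) a b)

/-- The metric on the self-dual bivectors, `𝒢 = ½ (G - i η)`. -/
def sdG (y : Coord) : Quadtensor := fun a b c d =>
  (1 / 2) * ((bigG g y a b c d : ℂ) - Complex.I * (eta g y a b c d : ℂ))

/-- Self-dual bivectors: complex 2-forms with `*F = i F`. -/
def IsSelfDual (y : Coord) (F : Bitensor) : Prop :=
  (∀ a b, F a b = -F b a) ∧ ∀ a b, hodge g y F a b = Complex.I * F a b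

/-- The Weyl tensor at `y` is of Petrov-Bel type D, with eigenvalue `w` and canonical bivector `U`:
on the self-dual bivectors, `𝒲` is diagonalizable with a simple eigenvalue `-2w` and a double
eigenvalue `w ≠ 0`, and `U` is a normalized eigenbivector for `-2w`. -/
structure IsTypeDAt (y : Coord) (w : ℂ) (U : Bitensor) : Prop where
  ne_zero : w ≠ 0
  selfDual : IsSelfDual g y U
  normalized : pairing g y U U = -1
  simple : ∀ a b, act g y (sdWeyl g y) U a b = -2 * w * U a b
  double : ∀ X : Bitensor, IsSelfDual g y X → pairing g y U X = 0 →
    ∀ a b, act g y (sdWeyl g y) X a b = w * X a b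

/-- Smooth choices, on a coordinate domain `Ω`, of the canonical bivector `U` and of a cube root
`s = w^{1/3}` of the Weyl eigenvalue `w`. -/
structure IsCanonical (Ω : Set Coord) (w s : Coord → ℂ) (U : Coord → Bitensor) : Prop where
  typeD : ∀ y ∈ Ω, IsTypeDAt g y (w y) (U y)
  cube : ∀ y ∈ Ω, s y ^ 3 = w y
  smooth_s : ContDiffOn ℝ ∞ s Ω
  smooth_U : ∀ a b, ContDiffOn ℝ ∞ (fun y => U y a b) Ω

/-- The canonical bivector as a rank 2 tensor field. -/
def bivectorField (U : Coord → Bitensor) : TField 2 := fun y i => U y (i 0) (i 1)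

/-- The divergence `ξ = δU`, `ξ_b = -∇_a U^a_b`. -/
def deltaU (U : Coord → Bitensor) (y : Coord) (b : Fin 4) : ℂ :=
  -∑ a, ∑ c, (ginv g y a c : ℂ) * nabla g (bivectorField U) y ![a, c, b]

/-- The invariant vector `Z = w^{-1/3} δU` (covariant components), with `s = w^{1/3}`. -/
def fieldZ (s : Coord → ℂ) (U : Coord → Bitensor) : TField 1 := fun y i =>
  (s y)⁻¹ * deltaU g U y (i 0)

/-- `[i(Z) V]_{abc} = Z^d V_{dabc}`, where `Z` is given by its covariant components. -/
def interiorProd (y : Coord) (Z : (Fin 1 → Fin 4) → ℂ) (V : Quadtensor) (a b c : Fin 4) : ℂ :=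
  ∑ d, ∑ e, (ginv g y d e : ℂ) * Z ![e] * V d a b c

/-- The variables on which the derivatives of the curvature may depend: the components of the
metric, its inverse and its volume element, and those of `w^{1/3}`, `U`, `Z`, `∇Z` and of their
complex conjugates. -/
inductive Var : Type
  | metric (a b : Fin 4)
  | invMetric (a b : Fin 4)
  | volume (a b c d : Fin 4)
  | cubeRoot
  | bivector (a b : Fin 4)
  | killing (a : Fin 4)
  | dKilling (a b : Fin 4)
  | cubeRootConj
  | bivectorConj (a b : Fin 4)
  | killingConj (a : Fin 4)
  | dKillingConj (a b : Fin 4)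

/-- The values of the variables at the point `y`. -/
def varValue (s : Coord → ℂ) (U : Coord → Bitensor) (y : Coord) : Var → ℂ
  | .metric a b => (g y a b : ℂ)
  | .invMetric a b => (ginv g y a b : ℂ)
  | .volume a b c d => (eta g y a b c d : ℂ)
  | .cubeRoot => s y
  | .bivector a b => U y a b
  | .killing a => fieldZ g s U y ![a]
  | .dKilling a b => nabla g (fieldZ g s U) y ![a, b]
  | .cubeRootConj => star (s y)
  | .bivectorConj a b => star (U y a b)
  | .killingConj a => star (fieldZ g s U y ![a])
  | .dKillingConj a b => star (nabla g (fieldZ g s U) y ![a, b])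

end Coordinates

/-! ### Space-times -/

section Manifold

universe u

variable {M : Type u} [TopologicalSpace M] [ChartedSpace (EuclideanSpace ℝ (Fin 4)) M]

/-- Components of a field of bilinear forms in the chart `e`, as functions of the coordinates
`y ∈ e.target`. -/
def chartComponents
    (B : ∀ x : M, TangentSpace (𝓡 4) x →ₗ[ℝ] TangentSpace (𝓡 4) x →ₗ[ℝ] ℝ)
    (e : OpenPartialHomeomorph M (EuclideanSpace ℝ (Fin 4))) (y : Coord) :
    Matrix (Fin 4) (Fin 4) ℝ :=
  Matrix.of fun a b => B (e.symm y)
    (mfderiv (𝓡 4) (𝓡 4) e.symm y (coordVec a)) (mfderiv (𝓡 4) (𝓡 4) e.symm y (coordVec b))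

variable (M) in
/-- A smooth Lorentzian metric, of signature `(-,+,+,+)`, on a four-dimensional manifold. -/
structure LorentzMetric where
  /-- the scalar product on each tangent space -/
  val : ∀ x : M, TangentSpace (𝓡 4) x →ₗ[ℝ] TangentSpace (𝓡 4) x →ₗ[ℝ] ℝ
  symm : ∀ x v v', val x v v' = val x v' v
  signature : ∀ x, ∃ b : Module.Basis (Fin 4) ℝ (TangentSpace (𝓡 4) x),
    ∀ i j, val x (b i) (b j) = if i = j then (if i = 0 then -1 else 1) else 0
  smooth : ∀ e ∈ IsManifold.maximalAtlas (𝓡 4) ∞ M, ∀ a b,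
    ContDiffOn ℝ ∞ (fun y => chartComponents val e y a b) e.target

/-- The components `g_{ab}` of the metric in the chart `e`. -/
def LorentzMetric.comp (γ : LorentzMetric M)
    (e : OpenPartialHomeomorph M (EuclideanSpace ℝ (Fin 4))) :
    Coord → Matrix (Fin 4) (Fin 4) ℝ :=
  chartComponents γ.val e

/-- Type D vacuum solutions: `Ric = 0`, and the Weyl tensor is of type D at every point. -/
structure LorentzMetric.IsTypeDVacuum (γ : LorentzMetric M) : Prop where
  vacuum : ∀ e ∈ IsManifold.maximalAtlas (𝓡 4) ∞ M, ∀ y ∈ e.target, ∀ a b,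
    ricci (γ.comp e) y a b = 0
  typeD : ∀ e ∈ IsManifold.maximalAtlas (𝓡 4) ∞ M, ∀ y ∈ e.target,
    ∃ (w : ℂ) (U : Bitensor), IsTypeDAt (γ.comp e) y w U

end Manifold

end TypeD

end

noncomputable section

open scoped Matrix

namespace TypeD

/-! ### The permutation symbol and the dual of an antisymmetric matrix -/

/-! The argument is differential algebra. Over a commutative ℂ-algebra carrying four commuting
derivations, a metric and its Levi-Civita connection (`Geometry`), every tensor identity needed is
algebraic. The geometric case is the algebra of smooth complex functions on a chart domain, followed
by evaluation at a point.

Bivectors of the same duality satisfy a Clifford relation FH + HF = -(F,H) g (`IsDual.clifford`), so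
U is invertible with U² = g/2. Type D means 𝒲 = w(3 U⊗U + 𝒢) (`sdPart_eq_of_typeD`), and in vacuum
the Bianchi identity makes 𝒲 divergence-free (`divergence_sdPart`). Contracting this equation with U
expresses dw through δU; multiplying it by U then isolates ∇U. With s = w^{1/3} the outcome is ds =
s² i(Z)U and ∇U = s i(Z)(U⊗U + 𝒢) (`der_eq`, `nab2_eq`). Hence ∇(s⁻¹U) = i(Z)𝒢, and the contracted
Ricci identity for s⁻¹U forces ∇Z to be antisymmetric (`nab1_antisymm`). The usual identity for
Killing fields gives ∇∇Z = i(Z)Riem (`nab_nab1`), and Riem = 𝒲 + conj 𝒲 turns it into (1).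

Thus s, U, Z, ∇Z and their conjugates have covariant derivatives polynomial in themselves and the
metric variables. For (2) these rules define derivations `covDer` of a polynomial ring, next to the
derivations `frameDer` of the infinitesimal linear changes of frame. A coordinate derivative of an
evaluated polynomial is the value of its `covDer` plus Christoffel symbols times values of its
`frameDer` (`der_ev`). Since `covDer` is equivariant, the second part is exactly what the
Christoffel terms of ∇ remove, so ∇ⁿRiem is the value of a polynomial built once and for all
(`ev_nablaRiem`).

For (3) it suffices that the variables of (2) can be made to agree at the two points. The Weyl
tensor fixes w, and U up to sign. Since (U, Riem(U)) = 2w, a first derivative yields dw and hence Z,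
and a second one yields ∇dw and hence ∇Z (`killing_determined`). Smooth fields s and U with
prescribed values at a point exist locally, because w and U⊗U are rational in the curvature and only
a cube root and a square root must be chosen (`exists_isCanonical`). -/

/-- The permutation symbol with integer values. -/
def eps (a b c d : Fin 4) : ℤ :=
  Matrix.det (Matrix.of fun r j : Fin 4 => if ![a, b, c, d] r = j then (1 : ℤ) else 0)

theorem permSymbol_eq (a b c d : Fin 4) : permSymbol ![a, b, c, d] = (eps a b c d : ℝ) := by
  unfold permSymbol eps
  rw [← eq_intCast (Int.castRingHom ℝ), RingHom.map_det]
  congr 1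
  ext r j
  simp [Matrix.map_apply, apply_ite]

/-- Product formula for the permutation symbol. -/
theorem eps_eq (a b c d : Fin 4) : eps a b c d =
    ((b : ℤ) - a) * ((c : ℤ) - a) * ((d : ℤ) - a) * ((c : ℤ) - b) * ((d : ℤ) - b)
      * ((d : ℤ) - c) / 12 := by
  -- The product is the Vandermonde determinant of the four indices: zero on a repetition and ±12 =
  -- ±(1·2·3·1·2·1) on a permutation, so the integer division is exact.
  revert a b c d
  unfold eps
  simp only [Matrix.det_succ_row_zero, Fin.sum_univ_four]
  decide +kernel

theorem eps_swap (a b c d : Fin 4) : eps a b c d = -eps b a c d := by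
  simp only [eps_eq]; revert a b c d; decide +kernel

theorem eps_swap_last (a b c d : Fin 4) : eps a b c d = -eps a b d c := by
  simp only [eps_eq]; revert a b c d; decide +kernel

theorem eps_pair (a b c d : Fin 4) : eps a b c d = eps c d a b := by
  simp only [eps_eq]; revert a b c d; decide +kernel

theorem eps_swap_mid (a b c d : Fin 4) : eps a b c d = -eps a c b d := by
  simp only [eps_eq]; revert a b c d; decide +kernel

section
set_option linter.unusedSectionVars false
set_option linter.unusedSimpArgs false

variable {A : Type*} [CommRing A] [Algebra ℂ A]

/-- `A` need not be a field, so halves are complex multiples. The same identity serves to pass from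
x = -x to x = 0. -/
theorem half_add_half (x : A) : (1 / 2 : ℂ) • x + (1 / 2 : ℂ) • x = x := by
  rw [← add_smul]; norm_num

/-- The dual `½ ε_{abcd} X_{cd}` of a matrix. -/
def dual (X : Matrix (Fin 4) (Fin 4) A) : Matrix (Fin 4) (Fin 4) A :=
  Matrix.of fun a b => (1 / 2 : ℂ) • ∑ c, ∑ d, (eps a b c d : A) * X c d

/-- The antisymmetric matrix with given entries above the diagonal. -/
def asm (x₀₁ x₀₂ x₀₃ x₁₂ x₁₃ x₂₃ : A) : Matrix (Fin 4) (Fin 4) A :=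
  !![0, x₀₁, x₀₂, x₀₃; -x₀₁, 0, x₁₂, x₁₃; -x₀₂, -x₁₂, 0, x₂₃; -x₀₃, -x₁₃, -x₂₃, 0]

theorem eps_eq_zero (a b c : Fin 4) : eps a a b c = 0 ∧ eps a b a c = 0 ∧ eps a b c a = 0 ∧
    eps b a a c = 0 ∧ eps b a c a = 0 ∧ eps b c a a = 0 := by
  simp only [eps_eq]; revert a b c; decide +kernel

theorem eps_values : eps 0 1 2 3 = 1 ∧ eps 0 1 3 2 = -1 ∧ eps 0 2 1 3 = -1 ∧ eps 0 2 3 1 = 1 ∧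
    eps 0 3 1 2 = 1 ∧ eps 0 3 2 1 = -1 ∧ eps 1 0 2 3 = -1 ∧ eps 1 0 3 2 = 1 ∧
    eps 1 2 0 3 = 1 ∧ eps 1 2 3 0 = -1 ∧ eps 1 3 0 2 = -1 ∧ eps 1 3 2 0 = 1 ∧
    eps 2 0 1 3 = 1 ∧ eps 2 0 3 1 = -1 ∧ eps 2 1 0 3 = -1 ∧ eps 2 1 3 0 = 1 ∧
    eps 2 3 0 1 = 1 ∧ eps 2 3 1 0 = -1 ∧ eps 3 0 1 2 = -1 ∧ eps 3 0 2 1 = 1 ∧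
    eps 3 1 0 2 = 1 ∧ eps 3 1 2 0 = -1 ∧ eps 3 2 0 1 = -1 ∧ eps 3 2 1 0 = 1 := by
  simp only [eps_eq]; decide +kernel

/-- In the six entries above the diagonal, the dual exchanges complementary index pairs up to sign.
This reduces the identities on antisymmetric matrices below to polynomial identities in these
entries. -/
theorem dual_asm (p q r s t u : A) : dual (asm p q r s t u) = asm u (-t) s r (-q) p := by
  ext a b
  fin_cases a <;> fin_cases b <;>
  simp [dual, asm, Fin.sum_univ_four, eps_eq_zero, eps_values, ← two_smul ℂ, smul_smul]

theorem exists_asm {X : Matrix (Fin 4) (Fin 4) A} (hX : Xᵀ = -X) :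
    ∃ p q r s t u, X = asm p q r s t u := by
  have h : ∀ a b, X b a = - X a b := fun a b => congrFun (congrFun hX a) b
  have h0 : ∀ a, X a a = 0 := fun a => by
    have := h a a
    rw [← half_add_half (X a a)]
    nth_rw 1 [this]
    simp
  refine ⟨X 0 1, X 0 2, X 0 3, X 1 2, X 1 3, X 2 3, ?_⟩
  ext a b
  fin_cases a <;> fin_cases b <;> simp [asm, h0] <;> apply h

theorem asm_entries (p q r s t u : A) : asm p q r s t u 0 0 = 0 ∧ asm p q r s t u 0 1 = p ∧ asm p q r s t u 0 2 = q ∧ asm p q r s t u 0 3 = r ∧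
    asm p q r s t u 1 0 = -p ∧ asm p q r s t u 1 1 = 0 ∧ asm p q r s t u 1 2 = s ∧ asm p q r s t u 1 3 = t ∧
    asm p q r s t u 2 0 = -q ∧ asm p q r s t u 2 1 = -s ∧ asm p q r s t u 2 2 = 0 ∧ asm p q r s t u 2 3 = u ∧
    asm p q r s t u 3 0 = -r ∧ asm p q r s t u 3 1 = -t ∧ asm p q r s t u 3 2 = -u ∧ asm p q r s t u 3 3 = 0 := by
  simp [asm]

theorem antisymm_ext {X Y : Matrix (Fin 4) (Fin 4) A} (hX : Xᵀ = -X) (hY : Yᵀ = -Y)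
    (h : X 0 1 = Y 0 1 ∧ X 0 2 = Y 0 2 ∧ X 0 3 = Y 0 3 ∧ X 1 2 = Y 1 2 ∧ X 1 3 = Y 1 3 ∧
      X 2 3 = Y 2 3) : X = Y := by
  obtain ⟨p, q, r, s, t, u, rfl⟩ := exists_asm hX
  obtain ⟨p', q', r', s', t', u', rfl⟩ := exists_asm hY
  simp only [asm_entries] at h
  obtain ⟨rfl, rfl, rfl, rfl, rfl, rfl⟩ := h
  rfl

theorem asm_transpose (p q r s t u : A) : (asm p q r s t u)ᵀ = -asm p q r s t u := by
  ext a b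
  fin_cases a <;> fin_cases b <;> simp [asm]

theorem dual_transpose (X : Matrix (Fin 4) (Fin 4) A) : (dual X)ᵀ = -dual X := by
  ext a b
  simp only [dual, Matrix.transpose_apply, Matrix.of_apply, Matrix.neg_apply, ← smul_neg]
  congr 1
  rw [← Finset.sum_neg_distrib]
  refine Finset.sum_congr rfl fun c _ => ?_
  rw [← Finset.sum_neg_distrib]
  refine Finset.sum_congr rfl fun d _ => ?_
  rw [eps_swap]; push_cast; ring

theorem dual_dual {X : Matrix (Fin 4) (Fin 4) A} (hX : Xᵀ = -X) : dual (dual X) = X := by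
  obtain ⟨p, q, r, s, t, u, rfl⟩ := exists_asm hX
  simp [dual_asm]

/-- Polarization of the fact that X · dual X is minus the Pfaffian times the identity. It is the
metric-free source of the Clifford relation. -/
theorem mul_dual_add {X Y : Matrix (Fin 4) (Fin 4) A} (hX : Xᵀ = -X) (hY : Yᵀ = -Y) :
    X * dual Y + Y * dual X = (1 / 2 : ℂ) • (X * dual Y).trace • (1 : Matrix _ _ A) := by
  obtain ⟨p, q, r, s, t, u, rfl⟩ := exists_asm hX
  obtain ⟨p', q', r', s', t', u', rfl⟩ := exists_asm hY
  simp only [dual_asm]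
  have : (asm p q r s t u * asm u' (-t') s' r' (-q') p').trace = 
    (2 : ℂ) • (- p * u' + q * t' - r * s' - s * r' + t * q' - u * p') := by
    simp [Matrix.trace, asm, Fin.sum_univ_four, Matrix.mul_apply]
    rw [two_smul]; ring
  rw [this, smul_assoc, smul_smul]
  norm_num
  ext a b
  fin_cases a <;> fin_cases b <;> simp [asm, Matrix.mul_apply, Fin.sum_univ_four] <;> ring

theorem congruence_transpose (P : Matrix (Fin 4) (Fin 4) A) {X : Matrix (Fin 4) (Fin 4) A}
    (hX : Xᵀ = -X) : (P * X * Pᵀ)ᵀ = -(P * X * Pᵀ) := by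
  simp [hX, Matrix.mul_assoc]

theorem det_four (P : Matrix (Fin 4) (Fin 4) A) : P.det =
    P 0 0 * (P 1 1 * (P 2 2 * P 3 3 - P 2 3 * P 3 2) - P 1 2 * (P 2 1 * P 3 3 - P 2 3 * P 3 1)
      + P 1 3 * (P 2 1 * P 3 2 - P 2 2 * P 3 1))
    - P 0 1 * (P 1 0 * (P 2 2 * P 3 3 - P 2 3 * P 3 2) - P 1 2 * (P 2 0 * P 3 3 - P 2 3 * P 3 0)
      + P 1 3 * (P 2 0 * P 3 2 - P 2 2 * P 3 0))
    + P 0 2 * (P 1 0 * (P 2 1 * P 3 3 - P 2 3 * P 3 1) - P 1 1 * (P 2 0 * P 3 3 - P 2 3 * P 3 0)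
      + P 1 3 * (P 2 0 * P 3 1 - P 2 1 * P 3 0))
    - P 0 3 * (P 1 0 * (P 2 1 * P 3 2 - P 2 2 * P 3 1) - P 1 1 * (P 2 0 * P 3 2 - P 2 2 * P 3 0)
      + P 1 2 * (P 2 0 * P 3 1 - P 2 1 * P 3 0)) := by
  simp [Matrix.det_succ_row_zero, Fin.sum_univ_succ, Fin.succAbove]
  ring

set_option maxHeartbeats 1000000 in
-- The permutation symbol is multiplied by det P when all its indices are transformed by P. Written
-- without inverses, this holds for every P.
theorem dual_congruence (P : Matrix (Fin 4) (Fin 4) A) {X : Matrix (Fin 4) (Fin 4) A}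
    (hX : Xᵀ = -X) : Pᵀ * dual (P * X * Pᵀ) * P = P.det • dual X := by
  obtain ⟨p', q', r', s', t', u', h⟩ := exists_asm (congruence_transpose P hX)
  obtain ⟨p, q, r, s, t, u, rfl⟩ := exists_asm hX
  have h' : ∀ a b, asm p' q' r' s' t' u' a b = (P * asm p q r s t u * Pᵀ) a b := by
    intro a b; rw [h]
  have h1 := h' 0 1
  have h2 := h' 0 2
  have h3 := h' 0 3
  have h4 := h' 1 2
  have h5 := h' 1 3
  have h6 := h' 2 3
  simp only [asm_entries, Matrix.mul_apply, Fin.sum_univ_four, Matrix.transpose_apply]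
    at h1 h2 h3 h4 h5 h6
  rw [h, dual_asm, dual_asm, det_four]
  refine antisymm_ext ?_ ?_ ?_
  · simpa using congruence_transpose Pᵀ (asm_transpose u' (-t') s' r' (-q') p')
  · rw [Matrix.transpose_smul, asm_transpose, smul_neg]
  simp only [asm_entries, Matrix.mul_apply, Fin.sum_univ_four, Matrix.transpose_apply,
    Matrix.smul_apply, smul_eq_mul, h1, h2, h3, h4, h5, h6]
  refine ⟨?_, ?_, ?_, ?_, ?_, ?_⟩ <;> ring

/-- First-order part of `dual_congruence` at P = 1 + tN. The trace term is later compensated by the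
derivative of the volume density. -/
theorem dual_infinitesimal (N : Matrix (Fin 4) (Fin 4) A) {X : Matrix (Fin 4) (Fin 4) A}
    (hX : Xᵀ = -X) :
    dual (N * X + X * Nᵀ) = N.trace • dual X - Nᵀ * dual X - dual X * N := by
  have hY : (N * X + X * Nᵀ)ᵀ = -(N * X + X * Nᵀ) := by
    simp [hX, add_comm]
  obtain ⟨p', q', r', s', t', u', h⟩ := exists_asm hY
  obtain ⟨p, q, r, s, t, u, rfl⟩ := exists_asm hX
  have h' : ∀ a b, asm p' q' r' s' t' u' a b = (N * asm p q r s t u + asm p q r s t u * Nᵀ) a b := by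
    intro a b; rw [h]
  have h1 := h' 0 1
  have h2 := h' 0 2
  have h3 := h' 0 3
  have h4 := h' 1 2
  have h5 := h' 1 3
  have h6 := h' 2 3
  simp only [asm_entries, Matrix.mul_apply, Fin.sum_univ_four, Matrix.transpose_apply,
    Matrix.add_apply] at h1 h2 h3 h4 h5 h6
  rw [h, dual_asm, dual_asm]
  refine antisymm_ext (asm_transpose ..) ?_ ?_
  · simp only [Matrix.transpose_sub, Matrix.transpose_smul, Matrix.transpose_mul, asm_transpose,
      Matrix.transpose_transpose, smul_neg, Matrix.mul_neg, Matrix.neg_mul]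
    abel
  simp only [asm_entries, Matrix.mul_apply, Fin.sum_univ_four, Matrix.transpose_apply,
    Matrix.smul_apply, Matrix.sub_apply, smul_eq_mul, Matrix.trace, Matrix.diag, h1, h2, h3, h4, h5, h6]
  refine ⟨?_, ?_, ?_, ?_, ?_, ?_⟩ <;> ring

end

/-! ### Duals of trace-free double 2-forms, and the Hodge dual of a metric -/

section
set_option linter.unusedSectionVars false
set_option linter.unusedSimpArgs false

variable {A : Type*} [CommRing A] [Algebra ℂ A]

theorem half_smul_two_mul (x : A) : (1 / 2 : ℂ) • (2 * x) = x := by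
  rw [two_mul, smul_add, half_add_half]

theorem sum_eps (X : Matrix (Fin 4) (Fin 4) A) (a b : Fin 4) :
    ∑ e, ∑ f, (eps a b e f : A) * X e f = 2 * dual X a b := by
  simp only [dual, Matrix.of_apply]
  rw [two_mul, half_add_half]

/-- With the first pair of N upper and the second lower, the claim is that ε_{abef} N^{ef}_{cd} is
symmetric under exchange of pairs. The part antisymmetric under the exchange has 15 components,
which correspond to the trace-free part of the contraction N^{a}_{b a d}; so it vanishes with the
contraction. Neither a metric nor pair symmetry of N enters. -/
theorem eps_mul_traceless {N : Fin 4 → Fin 4 → Fin 4 → Fin 4 → A}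
    (h₁ : ∀ a b c d, N a b c d = -N b a c d) (h₂ : ∀ a b c d, N a b c d = -N a b d c)
    (h₃ : ∀ b d, ∑ a, N a b a d = 0) (a b c d : Fin 4) :
    ∑ e, ∑ f, (eps a b e f : A) * N e f c d = ∑ e, ∑ f, N e f a b * (eps e f c d : A) := by
  have hz : ∀ e c d, N e e c d = 0 := fun e c d => by
    rw [← half_add_half (N e e c d)]
    nth_rw 1 [h₁]
    simp
  have hz' : ∀ e c d, N c d e e = 0 := fun e c d => by
    rw [← half_add_half (N c d e e)]
    nth_rw 1 [h₂]
    simp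
  -- Antisymmetry leaves 36 components, each settled by the sixteen trace equations.
  have key : ∀ a b c d : Fin 4, a < b → c < d → 
    ∑ e, ∑ f, (eps a b e f : A) * N e f c d = ∑ e, ∑ f, N e f a b * (eps e f c d : A) := by
    have t := h₃
    simp only [Fin.sum_univ_four] at t ⊢
    intro a b c d hab hcd
    have t00 := t 0 0
    have t01 := t 0 1
    have t02 := t 0 2
    have t03 := t 0 3
    have t10 := t 1 0
    have t11 := t 1 1
    have t12 := t 1 2
    have t13 := t 1 3
    have t20 := t 2 0
    have t21 := t 2 1
    have t22 := t 2 2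
    have t23 := t 2 3
    have t30 := t 3 0
    have t31 := t 3 1
    have t32 := t 3 2
    have t33 := t 3 3
    have e10 := fun c d => h₁ 1 0 c d
    have e20 := fun c d => h₁ 2 0 c d
    have e30 := fun c d => h₁ 3 0 c d
    have e21 := fun c d => h₁ 2 1 c d
    have e31 := fun c d => h₁ 3 1 c d
    have e32 := fun c d => h₁ 3 2 c d
    have f10 := fun c d => h₂ c d 1 0
    have f20 := fun c d => h₂ c d 2 0
    have f30 := fun c d => h₂ c d 3 0
    have f21 := fun c d => h₂ c d 2 1
    have f31 := fun c d => h₂ c d 3 1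
    have f32 := fun c d => h₂ c d 3 2
    clear t h₁ h₂ h₃
    simp only [e10, e20, e30, e21, e31, e32, f10, f20, f30, f21, f31, f32, hz, hz'] at t00 t01 t02 t03 t10 t11 t12 t13 t20 t21 t22 t23 t30 t31 t32 t33
    fin_cases a <;> fin_cases b <;> first | (exfalso; revert hab; decide) | skip
    all_goals fin_cases c <;> fin_cases d <;> first | (exfalso; revert hcd; decide) | skip
    all_goals simp only [Fin.zero_eta, Fin.mk_one, Fin.reduceFinMk, eps_eq_zero, eps_values, e10, e20, e30, e21, e31, e32, f10, f20, f30, f21, f31, f32, hz, hz', Int.cast_zero, Int.cast_one, Int.cast_neg]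
    all_goals clear e10 e20 e30 e21 e31 e32 f10 f20 f30 f21 f31 f32 hz hz' hab hcd
    all_goals grind
  have ksym : ∀ a b c d : Fin 4, c < d → 
    ∑ e, ∑ f, (eps a b e f : A) * N e f c d = ∑ e, ∑ f, N e f a b * (eps e f c d : A) := by
    intro a b c d hcd
    rcases lt_trichotomy a b with h | rfl | h
    · exact key a b c d h hcd
    · simp [eps_eq_zero, hz']
    · have := key b a c d h hcd
      simp only [eps_swap a b, h₂ _ _ a b]
      simpa using this
  rcases lt_trichotomy c d with h | rfl | h
  · exact ksym a b c d h
  · simp [eps_eq_zero, hz']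
  · have := ksym a b d c h
    simp only [eps_swap_last _ _ c d, h₂ _ _ c d]
    simpa using this

/-! ### Bivectors over a commutative ring -/

/-- 2-tensors with components in `A`. -/
abbrev M4 (A : Type*) := Matrix (Fin 4) (Fin 4) A

/-- 4-tensors with components in `A`. -/
abbrev Quad (A : Type*) := Fin 4 → Fin 4 → Fin 4 → Fin 4 → A

/-- The 2-tensor `V_{··cd}`. -/
def slice (V : Quad A) (c d : Fin 4) : M4 A := Matrix.of fun a b => V a b c d

@[simp] theorem slice_apply (V : Quad A) (a b c d : Fin 4) : slice V c d a b = V a b c d := rfl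

/-- Components of a metric, of its inverse, and of its volume element. -/
structure MetricData (A : Type*) where
  /-- the metric -/
  g : M4 A
  /-- the inverse metric -/
  gi : M4 A
  /-- the density of the volume element -/
  vol : A

namespace MetricData

variable (m : MetricData A)

/-- Raising both indices of a 2-tensor. -/
def up (F : M4 A) : M4 A := m.gi * F * m.giᵀ

/-- The product `½ F_{ab} H^{ab}`. -/
def pair (F H : M4 A) : A := (1 / 2 : ℂ) • ∑ a, ∑ b, F a b * m.up H a b

/-- The action `½ V_{ab}^{cd} F_{cd}`. -/
def act (V : Quad A) (F : M4 A) : M4 A :=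
  Matrix.of fun a b => (1 / 2 : ℂ) • ∑ c, ∑ d, V a b c d * m.up F c d

/-- The volume element. -/
def eta : Quad A := fun a b c d => m.vol * (eps a b c d : A)

/-- The Hodge dual. -/
def hodge (F : M4 A) : M4 A := m.vol • dual (m.up F)

/-- `g_{ac} g_{bd} - g_{ad} g_{bc}`. -/
def bigG : Quad A := fun a b c d => m.g a c * m.g b d - m.g a d * m.g b c

/-- The metric on self-dual bivectors. -/
def sdG : Quad A := fun a b c d =>
  (1 / 2 : ℂ) • (m.bigG a b c d - Complex.I • m.eta a b c d)

/-- Bivectors with `*F = c F`. -/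
structure IsDual (c : ℂ) (F : M4 A) : Prop where
  antisymm : Fᵀ = -F
  hodge_eq : m.hodge F = c • F

/-- The laws of a metric. -/
structure IsMetric : Prop where
  symm : m.gᵀ = m.g
  mul_inv : m.g * m.gi = 1
  vol_sq : m.vol ^ 2 = -m.g.det

variable {m}

theorem act_eta (F : M4 A) : m.act m.eta F = m.hodge F := by
  ext a b
  simp only [act, eta, hodge, Matrix.of_apply, Matrix.smul_apply, smul_eq_mul, mul_assoc,
    ← Finset.mul_sum, sum_eps]
  rw [← mul_smul_comm, half_smul_two_mul]

namespace IsMetric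

theorem inv_mul (h : m.IsMetric) : m.gi * m.g = 1 := mul_eq_one_comm.mp h.mul_inv

theorem inv_symm (h : m.IsMetric) : m.giᵀ = m.gi := by
  have h1 : m.giᵀ * m.g = 1 := by
    have := congrArg Matrix.transpose h.mul_inv
    rwa [Matrix.transpose_mul, h.symm, Matrix.transpose_one] at this
  calc m.giᵀ = m.giᵀ * (m.g * m.gi) := by rw [h.mul_inv, mul_one]
    _ = m.gi := by rw [← mul_assoc, h1, one_mul]

theorem symm_apply (h : m.IsMetric) (a b : Fin 4) : m.g a b = m.g b a :=
  congrFun (congrFun h.symm b) a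

theorem inv_symm_apply (h : m.IsMetric) (a b : Fin 4) : m.gi a b = m.gi b a :=
  congrFun (congrFun h.inv_symm b) a

theorem up_eq (h : m.IsMetric) (F : M4 A) : m.up F = m.gi * F * m.gi := by
  rw [up, h.inv_symm]

theorem vol_sq_mul_det (h : m.IsMetric) : m.vol ^ 2 * m.gi.det = -1 := by
  rw [h.vol_sq, neg_mul, ← Matrix.det_mul, h.mul_inv, Matrix.det_one]

end IsMetric

theorem up_transpose {F : M4 A} (hF : Fᵀ = -F) : (m.up F)ᵀ = -m.up F :=
  congruence_transpose _ hF

theorem hodge_transpose (F : M4 A) : (m.hodge F)ᵀ = -m.hodge F := by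
  rw [hodge, Matrix.transpose_smul, dual_transpose, smul_neg]

theorem hodge_add (F H : M4 A) : m.hodge (F + H) = m.hodge F + m.hodge H := by
  simp only [← act_eta]
  ext a b
  simp [act, up, mul_add, add_mul, Finset.sum_add_distrib]

theorem hodge_smul (c : ℂ) (F : M4 A) : m.hodge (c • F) = c • m.hodge F := by
  simp only [← act_eta]
  ext a b
  simp [act, up, Finset.smul_sum, smul_comm c]

/-- By `dual_congruence` for the inverse metric, the square of the Hodge dual is vol² · det g⁻¹. The
value -1 is where the Lorentzian law vol² = -det g is felt, and it gives the dual the eigenvalues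
±i. -/
theorem hodge_hodge (h : m.IsMetric) {F : M4 A} (hF : Fᵀ = -F) : m.hodge (m.hodge F) = -F := by
  have h1 := dual_congruence m.gi (dual_transpose (m.up F))
  rw [h.inv_symm, dual_dual (up_transpose hF), h.up_eq] at h1
  have h2 : dual (m.gi * dual (m.gi * F * m.gi) * m.gi) = m.gi.det • F := by
    calc _ = (m.g * m.gi) * dual (m.gi * dual (m.gi * F * m.gi) * m.gi) * (m.gi * m.g) := by
          rw [h.mul_inv, h.inv_mul, one_mul, mul_one]
      _ = m.g * (m.gi * dual (m.gi * dual (m.gi * F * m.gi) * m.gi) * m.gi) * m.g := by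
          simp only [mul_assoc]
      _ = m.gi.det • ((m.g * m.gi) * F * (m.gi * m.g)) := by
          rw [h1]; simp only [mul_assoc, Matrix.mul_smul, Matrix.smul_mul]
      _ = _ := by rw [h.mul_inv, h.inv_mul, one_mul, mul_one]
  rw [hodge, hodge, h.up_eq, h.up_eq, Matrix.mul_smul, Matrix.smul_mul]
  have h3 : ∀ (x : A) (Y : M4 A), dual (x • Y) = x • dual Y := by
    intro x Y
    ext a b
    simp [dual, Finset.mul_sum, mul_left_comm, mul_smul_comm]
  rw [h3, h2, smul_smul, smul_smul, ← pow_two, h.vol_sq_mul_det, neg_smul, one_smul]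

theorem pair_eq_trace (h : m.IsMetric) {F H : M4 A} (hF : Fᵀ = -F) :
    m.pair F H = -((1 / 2 : ℂ) • (F * m.gi * H * m.gi).trace) := by
  have : ∑ a, ∑ b, F a b * m.up H a b = (Fᵀ * m.up H).trace := by
    simp only [Matrix.trace, Matrix.diag, Matrix.mul_apply, Matrix.transpose_apply]
    exact Finset.sum_comm
  rw [pair, this, hF, h.up_eq, ← smul_neg]
  simp [mul_assoc]

theorem pair_comm (h : m.IsMetric) {F H : M4 A} (hF : Fᵀ = -F) (hH : Hᵀ = -H) :
    m.pair F H = m.pair H F := by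
  rw [pair_eq_trace h hF, pair_eq_trace h hH, mul_assoc _ H, Matrix.trace_mul_comm, ← mul_assoc]

/-- The Clifford relation for bivectors of the same duality. -/
theorem IsDual.clifford (h : m.IsMetric) {c : ℂ} (hc : c ≠ 0) {F H : M4 A} (hF : m.IsDual c F)
    (hH : m.IsDual c H) : F * m.gi * H + H * m.gi * F = -(m.pair F H • m.g) := by
  have hF' := hF.hodge_eq
  have hH' := hH.hodge_eq
  rw [hodge] at hF' hH'
  -- In `mul_dual_add` for the raised bivectors each product contains one dual, which duality
  -- replaces by c times the lowered bivector. Lowering the remaining factor and dividing by c gives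
  -- the relation.
  have k := mul_dual_add (up_transpose hF.antisymm (m := m)) (up_transpose hH.antisymm (m := m))
  have k2 := congrArg (fun X => m.g * (m.vol • X)) k
  simp only [smul_add, ← Matrix.mul_smul, hF', hH', mul_add] at k2
  have e : ∀ X : M4 A, m.g * m.up X = X * m.gi := by
    intro X
    rw [h.up_eq, ← mul_assoc, ← mul_assoc, h.mul_inv, one_mul]
  rw [← mul_assoc, ← mul_assoc, e, e] at k2
  have tr : m.vol • (m.up F * dual (m.up H)).trace = c • (F * m.gi * H * m.gi).trace := by
    rw [← Matrix.trace_smul, ← Matrix.mul_smul, hH', Matrix.mul_smul, Matrix.trace_smul, h.up_eq,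
      mul_assoc, mul_assoc, Matrix.trace_mul_comm]
    simp only [mul_assoc]
  have k3 : c • (F * m.gi * H + H * m.gi * F) = c • -(m.pair F H • m.g) := by
    simp only [Matrix.mul_smul] at k2
    rw [smul_add, k2, pair_eq_trace h hF.antisymm, Matrix.mul_one,
      smul_comm m.vol (1 / 2 : ℂ), ← smul_assoc m.vol, tr, neg_smul, neg_neg, smul_assoc, smul_assoc,
      smul_comm (1 / 2 : ℂ) c]
  have := congrArg (fun X => c⁻¹ • X) k3
  simpa only [smul_smul, inv_mul_cancel₀ hc, one_smul] using this

end MetricData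
end

/-! ### Double 2-forms acting on bivectors, the self-dual projector, and unit bivectors -/

section
set_option linter.unusedSectionVars false
set_option linter.unusedSimpArgs false

variable {A : Type*} [CommRing A] [Algebra ℂ A]

namespace MetricData

variable {m : MetricData A}

theorem act_add (V : Quad A) (F H : M4 A) : m.act V (F + H) = m.act V F + m.act V H := by
  ext a b
  simp [act, up, mul_add, add_mul, Finset.sum_add_distrib]

theorem act_smul (V : Quad A) (c : ℂ) (F : M4 A) : m.act V (c • F) = c • m.act V F := by
  ext a b
  simp [act, up, Finset.smul_sum, smul_comm c]

theorem act_smul' (V : Quad A) (c : A) (F : M4 A) : m.act V (c • F) = c • m.act V F := by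
  ext a b
  simp only [act, up, Matrix.mul_smul, Matrix.smul_mul, Matrix.smul_apply, smul_eq_mul,
    mul_left_comm _ c, ← Finset.mul_sum, mul_smul_comm, Matrix.of_apply]

/-- The bivector whose contravariant components are those of the coordinate bivector. -/
def coordBivector (m : MetricData A) (c d : Fin 4) : M4 A :=
  m.g * (Matrix.single c d 1 - Matrix.single d c 1) * m.gᵀ

theorem coordBivector_transpose (c d : Fin 4) :
    (m.coordBivector c d)ᵀ = -m.coordBivector c d :=
  congruence_transpose _ (by simp [Matrix.transpose_single])

theorem up_coordBivector (h : m.IsMetric) (c d : Fin 4) :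
    m.up (m.coordBivector c d) = Matrix.single c d 1 - Matrix.single d c 1 := by
  rw [h.up_eq, coordBivector, h.symm, ← mul_assoc, ← mul_assoc, h.inv_mul, one_mul, mul_assoc,
    h.mul_inv, mul_one]

/-- A double 2-form can be read off from its action on 2-forms; this is how equality of actions
becomes equality of components. -/
theorem act_coordBivector (h : m.IsMetric) {V : Quad A} (hV : ∀ a b c d, V a b c d = -V a b d c)
    (c d : Fin 4) : m.act V (m.coordBivector c d) = slice V c d := by
  ext a b
  simp only [act, up_coordBivector h, Matrix.of_apply, Matrix.sub_apply, mul_sub,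
    Finset.sum_sub_distrib, Matrix.single_apply, slice_apply]
  have : ∀ c d : Fin 4, ∑ x, ∑ y, V a b x y * (if c = x ∧ d = y then 1 else 0) = V a b c d := by
    intro c d
    simp [ite_and]
  rw [this, this, hV a b d c, sub_neg_eq_add, smul_add, half_add_half]

theorem up_neg (F : M4 A) : m.up (-F) = -m.up F := by simp [up]

theorem act_bigG (h : m.IsMetric) {F : M4 A} (hF : Fᵀ = -F) : m.act m.bigG F = F := by
  ext a b
  have h1 : ∀ a b, ∑ c, ∑ d, m.g a c * m.g b d * m.up F c d = F a b := by
    intro a b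
    have : m.g * m.up F * m.gᵀ = F := by
      rw [h.up_eq, h.symm, ← mul_assoc, ← mul_assoc, h.mul_inv, one_mul, mul_assoc,
        h.inv_mul, mul_one]
    conv_rhs => rw [← this]
    simp only [Matrix.mul_apply, Matrix.transpose_apply, Finset.sum_mul]
    rw [Finset.sum_comm]
    exact Finset.sum_congr rfl fun _ _ => Finset.sum_congr rfl fun _ _ => by ring
  simp only [act, bigG, sub_mul, Finset.sum_sub_distrib, Matrix.of_apply, h1]
  have h2 : ∑ c, ∑ d, m.g a d * m.g b c * m.up F c d = F b a := by
    rw [← h1]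
    exact Finset.sum_congr rfl fun _ _ => Finset.sum_congr rfl fun _ _ => by ring
  have h3 : F b a = -F a b := congrFun (congrFun hF a) b
  rw [h2, h3, sub_neg_eq_add, smul_add, half_add_half]

/-- 𝒢 acts as the projector onto self-dual bivectors, because G acts as the identity and η as the
Hodge dual. -/
theorem act_sdG (h : m.IsMetric) {F : M4 A} (hF : Fᵀ = -F) :
    m.act m.sdG F = (1 / 2 : ℂ) • (F - Complex.I • m.hodge F) := by
  rw [← act_eta, show (1 / 2 : ℂ) • (F - Complex.I • m.act m.eta F)
    = (1 / 2 : ℂ) • (m.act m.bigG F - Complex.I • m.act m.eta F) by rw [act_bigG h hF]]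
  ext a b
  simp only [act, sdG, Matrix.smul_apply, Matrix.sub_apply, Matrix.of_apply, smul_mul_assoc,
    sub_mul, Finset.sum_sub_distrib, ← Finset.smul_sum]
  rw [smul_comm Complex.I (1 / 2 : ℂ), ← smul_sub]

theorem IsDual.act_sdG (h : m.IsMetric) {F : M4 A} (hF : m.IsDual Complex.I F) :
    m.act m.sdG F = F := by
  rw [MetricData.act_sdG h hF.antisymm, hF.hodge_eq, smul_smul, Complex.I_mul_I, neg_smul, one_smul,
    sub_neg_eq_add, smul_add]
  ext a b
  exact half_add_half _

theorem IsDual.act_sdG_eq_zero (h : m.IsMetric) {F : M4 A} (hF : m.IsDual (-Complex.I) F) :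
    m.act m.sdG F = 0 := by
  rw [MetricData.act_sdG h hF.antisymm, hF.hodge_eq, smul_smul, mul_neg, Complex.I_mul_I, neg_neg,
    one_smul, sub_self, smul_zero]

/-- From ** = -1, the dual of F - c*F is *F + cF = c(F - c*F). The cases c = ±i split every 2-form
into a self-dual and an anti-self-dual part. -/
theorem isDual_add (h : m.IsMetric) {c : ℂ} (hc : c * c = -1) {F : M4 A} (hF : Fᵀ = -F) :
    m.IsDual c ((1 / 2 : ℂ) • (F - c • m.hodge F)) := by
  refine ⟨?_, ?_⟩
  · rw [Matrix.transpose_smul, Matrix.transpose_sub, Matrix.transpose_smul, hodge_transpose, hF]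
    module
  · rw [hodge_smul, sub_eq_add_neg, ← neg_smul, hodge_add, hodge_smul, hodge_hodge h hF, smul_comm c]
    rw [smul_add c, smul_smul, mul_neg, hc]
    module

theorem bigG_antisymm (a b c d : Fin 4) : m.bigG a b c d = -m.bigG a b d c := by
  simp [bigG]

theorem eta_antisymm (a b c d : Fin 4) : m.eta a b c d = -m.eta a b d c := by
  simp [eta, eps_swap_last a b c d]

theorem sdG_antisymm (a b c d : Fin 4) : m.sdG a b c d = -m.sdG a b d c := by
  simp only [sdG, bigG_antisymm a b c d, eta_antisymm a b c d]; module

theorem sdG_pair (h : m.IsMetric) (a b c d : Fin 4) : m.sdG a b c d = m.sdG c d a b := by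
  simp only [sdG, bigG, eta, eps_pair a b c d, h.symm_apply c, h.symm_apply d]
  congr 2; ring

theorem isDual_slice_sdG (h : m.IsMetric) (c d : Fin 4) :
    m.IsDual Complex.I (slice m.sdG c d) := by
  rw [← act_coordBivector h sdG_antisymm, MetricData.act_sdG h (coordBivector_transpose c d)]
  exact isDual_add h Complex.I_mul_I (coordBivector_transpose c d)

/-- Reproducing property: 𝒢 is the identity on self-dual bivectors. -/
theorem pair_slice_sdG (h : m.IsMetric) {U : M4 A} (hU : m.IsDual Complex.I U) (c d : Fin 4) :
    m.pair U (slice m.sdG c d) = U c d := by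
  rw [pair_comm h hU.antisymm (isDual_slice_sdG h c d).antisymm]
  conv_rhs => rw [← hU.act_sdG h]
  simp only [pair, act, slice_apply, sdG_pair h _ _ c d, Matrix.of_apply]

/-- The trace `g^{bc} 𝒢_{fbcd}`. -/
theorem trace_sdG (h : m.IsMetric) (f d : Fin 4) :
    ∑ b, ∑ c, m.gi b c * m.sdG f b c d = -(3 / 2 : ℂ) • m.g f d := by
  -- The volume part drops out, being antisymmetric in the two indices contracted with the symmetric
  -- inverse metric.
  have h1 : ∑ b, ∑ c, m.gi b c * m.eta f b c d = 0 := by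
    have : ∑ b, ∑ c, m.gi b c * m.eta f b c d = -∑ b, ∑ c, m.gi b c * m.eta f b c d := by
      conv_lhs => rw [Finset.sum_comm]
      rw [← Finset.sum_neg_distrib]
      refine Finset.sum_congr rfl fun b _ => ?_
      rw [← Finset.sum_neg_distrib]
      refine Finset.sum_congr rfl fun c _ => ?_
      rw [h.inv_symm_apply c b]
      simp only [eta, eps_swap_mid f c b d]
      push_cast; ring
    rw [← half_add_half (∑ b, ∑ c, m.gi b c * m.eta f b c d)]
    nth_rw 1 [this]
    simp
  have hm : ∀ a b, ∑ c, m.gi a c * m.g c b = if a = b then 1 else 0 := fun a b => by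
    have := congrFun (congrFun h.inv_mul a) b
    rwa [Matrix.mul_apply, Matrix.one_apply] at this
  -- The two products in G contribute 1 and -4 (the dimension); the factor ½ of 𝒢 then gives -3/2.
  have h2 : ∑ b, ∑ c, m.gi b c * m.bigG f b c d = (-3 : ℂ) • m.g f d := by
    simp only [bigG, mul_sub, Finset.sum_sub_distrib]
    have e1 : ∑ b, ∑ c, m.gi b c * (m.g f c * m.g b d) = m.g f d := by
      calc _ = ∑ b, (∑ c, m.gi b c * m.g c f) * m.g b d := by
            simp only [Finset.sum_mul, h.symm_apply f]
            exact Finset.sum_congr rfl fun _ _ => Finset.sum_congr rfl fun _ _ => by ring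
        _ = _ := by simp [hm]
    have e2 : ∑ b, ∑ c, m.gi b c * (m.g f d * m.g b c) = 4 * m.g f d := by
      calc _ = (∑ b, ∑ c, m.gi b c * m.g c b) * m.g f d := by
            simp only [Finset.sum_mul]
            exact Finset.sum_congr rfl fun b _ => Finset.sum_congr rfl fun c _ => by
              rw [h.symm_apply b c]; ring
        _ = _ := by simp [hm]
    rw [e1, e2, Algebra.smul_def]
    simp only [map_neg, map_ofNat]
    ring
  simp only [sdG, mul_smul_comm, mul_sub, ← Finset.smul_sum, Finset.sum_sub_distrib, h1, h2]
  module

/-- Normalized self-dual bivectors. -/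
structure IsUnitBivector (m : MetricData A) (U : M4 A) : Prop where
  isDual : m.IsDual Complex.I U
  pair_self : m.pair U U = -1

namespace IsUnitBivector

variable {U : M4 A}

theorem sq (hU : m.IsUnitBivector U) (h : m.IsMetric) :
    U * m.gi * U = (1 / 2 : ℂ) • m.g := by
  have k := hU.isDual.clifford h Complex.I_ne_zero hU.isDual
  rw [hU.pair_self, neg_smul, one_smul, neg_neg, ← two_smul ℂ] at k
  rw [← k, smul_smul]
  norm_num

theorem inv_sq (hU : m.IsUnitBivector U) (h : m.IsMetric) :
    m.gi * U * m.gi * U = (1 / 2 : ℂ) • 1 := by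
  rw [mul_assoc, mul_assoc, ← mul_assoc U, hU.sq h, Matrix.mul_smul, h.inv_mul]

/-- Move U past X by the Clifford relation, then use U g⁻¹ U = g/2. Applied to the slices of 𝒢, it
solves the Bianchi equation for ∇U. -/
theorem conj_eq (hU : m.IsUnitBivector U) (h : m.IsMetric) {X : M4 A}
    (hX : m.IsDual Complex.I X) :
    U * m.gi * X * m.gi * U = -((1 / 2 : ℂ) • X) - m.pair U X • U := by
  have k := hU.isDual.clifford h Complex.I_ne_zero hX
  rw [eq_sub_of_add_eq k, sub_mul, sub_mul, mul_assoc (X * m.gi), mul_assoc (X * m.gi),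
    hU.sq h, Matrix.mul_smul, mul_assoc X, h.inv_mul, mul_one, neg_mul, neg_mul,
    Matrix.smul_mul, Matrix.smul_mul, h.mul_inv, one_mul]
  abel

end IsUnitBivector

/-! ### Decomposition of the self-dual Weyl tensor of type D -/

/-- `½ (W - i *W)`. -/
def sdPart (m : MetricData A) (W : Quad A) : Quad A := fun a b c d =>
  (1 / 2 : ℂ) • (W a b c d - Complex.I • m.hodge (slice W c d) a b)

/-- Algebraic symmetries of a trace-free curvature tensor. -/
structure IsWeylLike (m : MetricData A) (W : Quad A) : Prop where
  antisymm : ∀ a b c d, W a b c d = -W b a c d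
  antisymm' : ∀ a b c d, W a b c d = -W a b d c
  pair_symm : ∀ a b c d, W a b c d = W c d a b
  traceless : ∀ b d, ∑ a, ∑ c, m.gi a c * W a b c d = 0

theorem act_eq_sum (V : Quad A) (F : M4 A) :
    m.act V F = ∑ c, ∑ d, ((1 / 2 : ℂ) • m.up F c d) • slice V c d := by
  ext a b
  simp only [act, Matrix.of_apply, Matrix.sum_apply, Matrix.smul_apply, slice_apply, smul_eq_mul,
    smul_mul_assoc, ← Finset.smul_sum, mul_comm (V _ _ _ _)]

theorem sum_comm_pairs (f : Fin 4 → Fin 4 → Fin 4 → Fin 4 → A) :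
    ∑ a, ∑ b, ∑ c, ∑ d, f a b c d = ∑ c, ∑ d, ∑ a, ∑ b, f a b c d := by
  have := Finset.sum_comm (s := (Finset.univ : Finset (Fin 4 × Fin 4)))
    (t := (Finset.univ : Finset (Fin 4 × Fin 4))) (f := fun p q => f p.1 p.2 q.1 q.2)
  simpa only [Fintype.sum_prod_type] using this

theorem sum_mul_up (h : m.IsMetric) (X H : M4 A) :
    ∑ a, ∑ b, X a b * m.up H a b = ∑ a, ∑ b, m.up X a b * H a b := by
  have : ∀ X Y : M4 A, ∑ a, ∑ b, X a b * Y a b = (Xᵀ * Y).trace := by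
    intro X Y
    simp only [Matrix.trace, Matrix.diag, Matrix.mul_apply, Matrix.transpose_apply]
    exact Finset.sum_comm
  rw [this, this, h.up_eq, h.up_eq, Matrix.transpose_mul, Matrix.transpose_mul, h.inv_symm,
    ← mul_assoc, Matrix.trace_mul_comm]
  simp only [mul_assoc]

theorem pair_act (h : m.IsMetric) {V : Quad A} (hV : ∀ a b c d, V a b c d = V c d a b)
    (F H : M4 A) : m.pair (m.act V F) H = m.pair F (m.act V H) := by
  rw [pair, pair, sum_mul_up h F]
  simp only [act, Matrix.of_apply, smul_mul_assoc, mul_smul_comm, ← Finset.smul_sum,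
    Finset.mul_sum, Finset.sum_mul]
  rw [sum_comm_pairs]
  congr 2
  exact Finset.sum_congr rfl fun a _ => Finset.sum_congr rfl fun b _ =>
    Finset.sum_congr rfl fun c _ => Finset.sum_congr rfl fun d _ => by rw [hV c d a b]; ring

/-- Left and right duals of a trace-free curvature tensor agree: this is `eps_mul_traceless` for W
with its first pair raised. Consequently W preserves duality, and its self-dual part kills the
anti-self-dual bivectors. -/
theorem hodge_act {W : Quad A} (h : m.IsMetric) (hW : m.IsWeylLike W) (F : M4 A) :
    m.hodge (m.act W F) = m.act W (m.hodge F) := by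
  let N : Quad A := fun e f c d => m.up (slice W c d) e f
  have hN₁ : ∀ a b c d, N a b c d = -N b a c d := fun a b c d => by
    have : (slice W c d)ᵀ = -slice W c d := by ext a b; exact hW.antisymm b a c d
    exact congrFun (congrFun (up_transpose (m := m) this) b) a
  have hN₂ : ∀ a b c d, N a b c d = -N a b d c := fun a b c d => by
    have : slice W c d = -slice W d c := by ext a b; exact hW.antisymm' a b c d
    simp only [N]
    rw [this, up_neg]; rfl
  have hm : ∀ a b, ∑ c, m.gi a c * m.g c b = if a = b then 1 else 0 := fun a b => by
    have := congrFun (congrFun h.inv_mul a) b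
    rwa [Matrix.mul_apply, Matrix.one_apply] at this
  have hN₃ : ∀ b d, ∑ a, N a b a d = 0 := fun b d => by
    calc ∑ a, N a b a d = ∑ a, ∑ f, (∑ e, m.gi a e * W e f a d) * m.gi b f := by
          simp only [N, up, Matrix.mul_apply, Matrix.transpose_apply, slice_apply]
      _ = ∑ f, (∑ a, ∑ e, m.gi e a * W e f a d) * m.gi b f := by
          rw [Finset.sum_comm]
          simp only [Finset.sum_mul]
          refine Finset.sum_congr rfl fun f _ => Finset.sum_congr rfl fun a _ =>
            Finset.sum_congr rfl fun e _ => ?_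
          rw [h.inv_symm_apply a e]
      _ = 0 := by
          refine Finset.sum_eq_zero fun f _ => ?_
          rw [Finset.sum_comm, hW.traceless, zero_mul]
  have key := eps_mul_traceless hN₁ hN₂ hN₃
  have hact : m.up (m.act W F) = ∑ c, ∑ d, ((1 / 2 : ℂ) • m.up F c d) • m.up (slice W c d) := by
    rw [act_eq_sum]
    simp only [up, Finset.mul_sum, Finset.sum_mul, Matrix.mul_smul, Matrix.smul_mul]
  ext a b
  have hl : m.hodge (m.act W F) a b = (1 / 2 : ℂ) • (1 / 2 : ℂ) • ∑ c, ∑ d,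
      m.vol * m.up F c d * ∑ e, ∑ f, (eps a b e f : A) * N e f c d := by
    simp only [hodge, hact, dual, Matrix.smul_apply, Matrix.of_apply, Matrix.sum_apply, smul_eq_mul,
      smul_mul_assoc, mul_smul_comm, ← Finset.smul_sum]
    congr 2
    simp only [Finset.mul_sum]
    rw [sum_comm_pairs]
    exact Finset.sum_congr rfl fun _ _ => Finset.sum_congr rfl fun _ _ =>
      Finset.sum_congr rfl fun _ _ => Finset.sum_congr rfl fun _ _ => by simp only [N]; ring
  have hr : m.act W (m.hodge F) a b = (1 / 2 : ℂ) • (1 / 2 : ℂ) • ∑ c, ∑ d,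
      m.vol * m.up F c d * ∑ e, ∑ f, N e f a b * (eps e f c d : A) := by
    have : m.act W (m.hodge F) a b
        = (1 / 2 : ℂ) • ∑ c, ∑ d, slice W a b c d * m.up (m.hodge F) c d := by
      simp only [act, Matrix.of_apply, slice_apply, hW.pair_symm a b]
    rw [this, sum_mul_up h]
    simp only [hodge, dual, Matrix.smul_apply, Matrix.of_apply, smul_eq_mul,
      smul_mul_assoc, mul_smul_comm, ← Finset.smul_sum]
    congr 2
    simp only [Finset.mul_sum]
    rw [sum_comm_pairs]
    exact Finset.sum_congr rfl fun _ _ => Finset.sum_congr rfl fun _ _ =>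
      Finset.sum_congr rfl fun _ _ => Finset.sum_congr rfl fun _ _ => by simp only [N]; ring
  rw [hl, hr]
  simp only [key]

theorem sdPart_antisymm' {W : Quad A} (hW : m.IsWeylLike W) (a b c d : Fin 4) :
    m.sdPart W a b c d = -m.sdPart W a b d c := by
  have : slice W c d = (-1 : ℂ) • slice W d c := by
    ext a b; simpa using hW.antisymm' a b c d
  simp only [sdPart, this, hW.antisymm' a b c d, hodge_smul, Matrix.smul_apply]
  module

theorem act_sdPart (W : Quad A) (F : M4 A) :
    m.act (m.sdPart W) F = (1 / 2 : ℂ) • (m.act W F - Complex.I • m.hodge (m.act W F)) := by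
  have hact : m.hodge (m.act W F)
      = ∑ c, ∑ d, ((1 / 2 : ℂ) • m.up F c d) • m.hodge (slice W c d) := by
    rw [act_eq_sum]
    simp only [← act_eta]
    ext a b
    simp only [act, up, Finset.mul_sum, Finset.sum_mul, Matrix.mul_smul, Matrix.smul_mul,
      Matrix.sum_apply, Matrix.smul_apply, Matrix.of_apply, smul_eq_mul, Finset.smul_sum,
      smul_mul_assoc, mul_smul_comm]
    rw [sum_comm_pairs]
    exact Finset.sum_congr rfl fun _ _ => Finset.sum_congr rfl fun _ _ =>
      Finset.sum_congr rfl fun _ _ => Finset.sum_congr rfl fun _ _ => by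
        simp only [mul_left_comm]
  rw [hact, act_eq_sum, act_eq_sum]
  ext a b
  simp only [Matrix.sum_apply, Matrix.smul_apply, Matrix.sub_apply, Finset.smul_sum,
    ← Finset.sum_sub_distrib, slice_apply, sdPart, smul_eq_mul]
  exact Finset.sum_congr rfl fun _ _ => Finset.sum_congr rfl fun _ _ => by
    simp only [smul_mul_assoc, mul_smul_comm, mul_sub, smul_sub, smul_comm Complex.I]

theorem act_outer (U F : M4 A) :
    m.act (fun a b c d => U a b * U c d) F = m.pair U F • U := by
  ext a b
  simp only [act, pair, Matrix.of_apply, Matrix.smul_apply, smul_eq_mul, mul_assoc,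
    ← Finset.mul_sum, smul_mul_assoc, mul_smul_comm]
  rw [mul_comm]

/-- The self-dual Weyl tensor of type D is determined by the eigenvalue and the canonical
bivector. -/
theorem sdPart_eq_of_typeD {W : Quad A} (h : m.IsMetric) (hW : m.IsWeylLike W) {w : A} {U : M4 A}
    (hU : m.IsUnitBivector U) (simple : m.act (m.sdPart W) U = (-2 * w) • U)
    (double : ∀ X, m.IsDual Complex.I X → m.pair U X = 0 → m.act (m.sdPart W) X = w • X)
    (a b c d : Fin 4) :
    m.sdPart W a b c d = w * (3 * U a b * U c d + m.sdG a b c d) := by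
  let V : Quad A := fun a b c d => w * (3 * U a b * U c d + m.sdG a b c d)
  have hV : ∀ F, m.act V F = w • ((3 * m.pair U F) • U + m.act m.sdG F) := by
    intro F
    rw [mul_smul, ← act_outer]
    ext a b
    simp only [act, V, Matrix.of_apply, Matrix.smul_apply, Matrix.add_apply, smul_eq_mul,
      mul_smul_comm, ← smul_add, Finset.mul_sum, ← Finset.sum_add_distrib]
    congr 1
    exact Finset.sum_congr rfl fun _ _ => Finset.sum_congr rfl fun _ _ => by ring
  have hsd : ∀ F, m.IsDual Complex.I F → m.act (m.sdPart W) F = m.act V F := by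
    intro F hF
    -- Since (U,U) = -1, the bivector F + (U,F)U is the component of F orthogonal to U, with
    -- eigenvalue w; the rest -(U,F)U has eigenvalue -2w. Together they give wF + 3w(U,F)U.
    have hX : m.IsDual Complex.I (F + m.pair U F • U) := by
      refine ⟨?_, ?_⟩
      · rw [Matrix.transpose_add, Matrix.transpose_smul, hF.antisymm, hU.isDual.antisymm]; module
      · rw [hodge_add, hF.hodge_eq, ← act_eta, act_smul', act_eta, hU.isDual.hodge_eq, smul_add,
          smul_comm]
    have hp : m.pair U (F + m.pair U F • U) = 0 := by
      have e : m.pair U (F + m.pair U F • U) = m.pair U F + m.pair U F * m.pair U U := by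
        simp only [pair, up, Matrix.mul_add, Matrix.add_mul, Matrix.mul_smul, Matrix.smul_mul,
          Matrix.add_apply, Matrix.smul_apply, smul_eq_mul, mul_add, Finset.sum_add_distrib,
          smul_add, mul_left_comm (U _ _), ← Finset.mul_sum, mul_smul_comm]
      rw [e, hU.pair_self]; ring
    have k := double _ hX hp
    rw [act_add, act_smul', simple] at k
    rw [hV, hF.act_sdG h, eq_sub_of_add_eq k]
    simp only [smul_add, smul_smul]
    rw [add_sub_assoc, ← sub_smul, add_comm]
    congr 2
    ring
  -- Both sides vanish here: the left because W commutes with the dual, the right because U and 𝒢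
  -- are self-dual.
  have hasd : ∀ F, m.IsDual (-Complex.I) F → m.act (m.sdPart W) F = m.act V F := by
    intro F hF
    rw [hV, hF.act_sdG_eq_zero h, act_sdPart, hodge_act h hW, hF.hodge_eq, act_smul, smul_smul,
      mul_neg, Complex.I_mul_I, neg_neg, one_smul, sub_self, smul_zero, add_zero]
    have hp : m.pair U F = 0 := by
      rw [← hU.isDual.act_sdG h, pair_act h (sdG_pair h), hF.act_sdG_eq_zero h]
      simp [pair, up]
    rw [hp, mul_zero, zero_smul, smul_zero]
  have hall : ∀ F : M4 A, Fᵀ = -F → m.act (m.sdPart W) F = m.act V F := by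
    intro F hF
    have e : F = (1 / 2 : ℂ) • (F - Complex.I • m.hodge F)
        + (1 / 2 : ℂ) • (F - (-Complex.I) • m.hodge F) := by module
    rw [e, act_add, act_add, hsd _ (isDual_add h Complex.I_mul_I hF),
      hasd _ (isDual_add h (by simp) hF)]
  have hVa : ∀ a b c d, V a b c d = -V a b d c := by
    intro a b c d
    have : U c d = -U d c := congrFun (congrFun hU.isDual.antisymm d) c
    simp only [V, sdG_antisymm a b c d, this]; ring
  have k := hall _ (coordBivector_transpose (m := m) c d)
  rw [act_coordBivector h (sdPart_antisymm' hW), act_coordBivector h hVa] at k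
  exact congrFun (congrFun k a) b

end MetricData
end

section
set_option linter.unusedSectionVars false
set_option linter.unusedSimpArgs false

variable {A : Type*} [CommRing A] [Algebra ℂ A]

/-! ### Covariant derivatives with respect to a derivation `d` and a connection matrix `M` -/

variable (d : Derivation ℂ A A) (M : M4 A)

/-- Covariant derivative of a covector. -/
def cov1 (X : Fin 4 → A) (a : Fin 4) : A := d (X a) - ∑ m, M m a * X m

/-- Covariant derivative of a 2-tensor. -/
def cov2 (F : M4 A) : M4 A := Matrix.of fun a b =>
  d (F a b) - ∑ m, M m a * F m b - ∑ m, M m b * F a m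

/-- Covariant derivative of a 3-tensor. -/
def cov3 (T : Fin 4 → Fin 4 → Fin 4 → A) (a b c : Fin 4) : A :=
  d (T a b c) - ∑ m, M m a * T m b c - ∑ m, M m b * T a m c - ∑ m, M m c * T a b m

/-- Covariant derivative of a 4-tensor. -/
def cov4 (V : Quad A) (a b c e : Fin 4) : A :=
  d (V a b c e) - ∑ m, M m a * V m b c e - ∑ m, M m b * V a m c e - ∑ m, M m c * V a b m e
    - ∑ m, M m e * V a b c m

/-- The metric, its inverse and its volume element are parallel. -/
structure IsParallel (m : MetricData A) : Prop where
  metric : m.g.map d = Mᵀ * m.g + m.g * M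
  inv : m.gi.map d = -(M * m.gi) - m.gi * Mᵀ
  vol : d m.vol = M.trace * m.vol

variable {d M}

theorem cov2_eq (F : M4 A) : cov2 d M F = F.map d - Mᵀ * F - F * M := by
  ext a b
  simp [cov2, Matrix.mul_apply, mul_comm]

theorem map_mul_derivation (F H : M4 A) : (F * H).map d = F.map d * H + F * H.map d := by
  ext a b
  simp only [Matrix.map_apply, Matrix.mul_apply, map_sum, Derivation.leibniz, smul_eq_mul,
    Matrix.add_apply, Finset.sum_add_distrib]
  rw [add_comm]
  congr 1
  exact Finset.sum_congr rfl fun _ _ => mul_comm _ _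

theorem map_transpose_derivation (F : M4 A) : Fᵀ.map d = (F.map d)ᵀ := rfl

theorem cov2_add (F H : M4 A) : cov2 d M (F + H) = cov2 d M F + cov2 d M H := by
  ext a b
  simp only [cov2, Matrix.of_apply, Matrix.add_apply, map_add, mul_add, Finset.sum_add_distrib]
  ring

theorem cov2_smul (x : A) (F : M4 A) : cov2 d M (x • F) = d x • F + x • cov2 d M F := by
  ext a b
  simp only [cov2, Matrix.of_apply, Matrix.add_apply, Matrix.smul_apply, smul_eq_mul,
    Derivation.leibniz, mul_left_comm _ x, ← Finset.mul_sum]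
  ring

theorem cov2_smul_complex (x : ℂ) (F : M4 A) : cov2 d M (x • F) = x • cov2 d M F := by
  ext a b
  simp only [cov2, Matrix.of_apply, Matrix.smul_apply, Derivation.map_smul, mul_smul_comm,
    ← Finset.smul_sum, smul_sub]

theorem cov2_transpose (F : M4 A) : (cov2 d M F)ᵀ = cov2 d M Fᵀ := by
  ext a b
  simp only [cov2, Matrix.of_apply, Matrix.transpose_apply]
  ring

theorem cov2_antisymm {F : M4 A} (hF : Fᵀ = -F) : (cov2 d M F)ᵀ = -cov2 d M F := by
  rw [cov2_transpose, hF, ← neg_one_smul ℂ, cov2_smul_complex, neg_one_smul]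

theorem slice_cov4 (V : Quad A) (c e : Fin 4) : slice (cov4 d M V) c e =
    cov2 d M (slice V c e) - ∑ m, M m c • slice V m e - ∑ m, M m e • slice V c m := by
  ext a b
  simp only [slice_apply, cov4, cov2, Matrix.sub_apply, Matrix.sum_apply, Matrix.smul_apply,
    smul_eq_mul, Matrix.of_apply]

theorem dual_add (X Y : M4 A) : dual (X + Y) = dual X + dual Y := by
  ext a b
  simp [dual, mul_add, Finset.sum_add_distrib]

theorem dual_smul (x : A) (Y : M4 A) : dual (x • Y) = x • dual Y := by
  ext a b
  simp [dual, Finset.mul_sum, mul_left_comm, mul_smul_comm]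

theorem dual_sum {ι : Type*} (s : Finset ι) (X : ι → M4 A) :
    dual (∑ i ∈ s, X i) = ∑ i ∈ s, dual (X i) := by
  classical
  induction s using Finset.induction_on with
  | empty => ext a b; simp [dual]
  | insert i s hi ih => rw [Finset.sum_insert hi, Finset.sum_insert hi, dual_add, ih]

theorem map_dual (X : M4 A) : (dual X).map d = dual (X.map d) := by
  ext a b
  simp [dual, map_sum, Derivation.leibniz]

theorem cov4_add (V W : Quad A) (a b c e : Fin 4) :
    cov4 d M (fun a b c e => V a b c e + W a b c e) a b c e
      = cov4 d M V a b c e + cov4 d M W a b c e := by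
  simp only [cov4, map_add, mul_add, Finset.sum_add_distrib]; ring

theorem cov4_smul (x : A) (V : Quad A) (a b c e : Fin 4) :
    cov4 d M (fun a b c e => x * V a b c e) a b c e
      = d x * V a b c e + x * cov4 d M V a b c e := by
  simp only [cov4, Derivation.leibniz, mul_left_comm _ x, ← Finset.mul_sum, smul_eq_mul]; ring

theorem cov4_smul_complex (x : ℂ) (V : Quad A) (a b c e : Fin 4) :
    cov4 d M (fun a b c e => x • V a b c e) a b c e = x • cov4 d M V a b c e := by
  simp only [cov4, Derivation.map_smul, mul_smul_comm, ← Finset.smul_sum, smul_sub]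

theorem cov4_outer (F H : M4 A) (a b c e : Fin 4) :
    cov4 d M (fun a b c e => F a b * H c e) a b c e
      = cov2 d M F a b * H c e + F a b * cov2 d M H c e := by
  simp only [cov4, cov2, Derivation.leibniz, Matrix.of_apply, smul_eq_mul, mul_sub, sub_mul,
    Finset.mul_sum, Finset.sum_mul]
  simp only [mul_left_comm, mul_comm]
  ring

/-! ### Covariant differentiation commutes with the operations built from a parallel metric -/

namespace IsParallel

variable {m : MetricData A} (h : IsParallel d M m)
include h

theorem inv_transpose : m.giᵀ.map d = -(M * m.giᵀ) - m.giᵀ * Mᵀ := by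
  rw [map_transpose_derivation, h.inv]
  simp only [Matrix.transpose_sub, Matrix.transpose_neg, Matrix.transpose_mul,
    Matrix.transpose_transpose]
  abel

theorem map_up (F : M4 A) : (m.up F).map d = m.up (cov2 d M F) - M * m.up F - m.up F * Mᵀ := by
  simp only [MetricData.up, map_mul_derivation, h.inv, h.inv_transpose, cov2_eq]
  noncomm_ring

/-- The trace of the connection produced by `dual_infinitesimal` cancels the derivative of the
volume density. -/
theorem cov2_hodge {F : M4 A} (hF : Fᵀ = -F) :
    cov2 d M (m.hodge F) = m.hodge (cov2 d M F) := by
  have k := dual_infinitesimal M (MetricData.up_transpose hF (m := m))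
  rw [MetricData.hodge, MetricData.hodge, cov2_smul, cov2_eq, map_dual, h.map_up, h.vol, mul_comm,
    mul_smul, ← smul_add]
  congr 1
  rw [sub_sub (m.up _), sub_eq_add_neg (m.up _), dual_add, ← neg_one_smul A (_ + _), dual_smul, k]
  module

theorem cov4_bigG (a b c e : Fin 4) : cov4 d M m.bigG a b c e = 0 := by
  have k : ∀ a b, d (m.g a b) = ∑ n, M n a * m.g n b + ∑ n, M n b * m.g a n := by
    intro a b
    have := congrFun (congrFun h.metric a) b
    simp only [Matrix.map_apply, Matrix.add_apply, Matrix.mul_apply, Matrix.transpose_apply] at this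
    rw [this]
    simp only [mul_comm]
  simp only [cov4, MetricData.bigG, map_sub, Derivation.leibniz, k, smul_eq_mul, mul_sub,
    Finset.sum_sub_distrib, mul_add, Finset.mul_sum]
  simp only [Fin.sum_univ_four]
  ring

/-- The slices of η are the volume density times the duals of the constant matrices E_ce - E_ec. For
these `dual_infinitesimal` and the law of the density leave nothing. -/
theorem cov4_eta (a b c e : Fin 4) : cov4 d M m.eta a b c e = 0 := by
  let S : Fin 4 → Fin 4 → M4 A := fun c e => Matrix.single c e 1 - Matrix.single e c 1
  have hS : ∀ c e, (S c e)ᵀ = -S c e := fun c e => by simp [S, Matrix.transpose_single]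
  have hs : ∀ c e, slice m.eta c e = m.vol • dual (S c e) := by
    intro c e
    ext a b
    simp only [slice_apply, MetricData.eta, S, dual, Matrix.smul_apply, Matrix.of_apply,
      Matrix.sub_apply, smul_eq_mul, mul_sub, Finset.sum_sub_distrib, Matrix.single_apply]
    have : ∀ c e : Fin 4, ∑ x, ∑ y, (eps a b x y : A) * (if c = x ∧ e = y then 1 else 0)
        = eps a b c e := by
      intro c e
      simp [ite_and]
    rw [this, this, eps_swap_last a b e c]
    push_cast
    rw [sub_neg_eq_add, smul_add, half_add_half]
  have hd : ∀ c e, (S c e).map d = 0 := by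
    intro c e
    ext a b
    simp only [S, Matrix.map_apply, Matrix.sub_apply, Matrix.single_apply, map_sub, Matrix.zero_apply]
    split_ifs <;> simp
  have hM : ∑ n, M n c • S n e + ∑ n, M n e • S c n = M * S c e + S c e * Mᵀ := by
    ext a b
    simp only [S, Matrix.add_apply, Matrix.sum_apply, Matrix.smul_apply, Matrix.sub_apply,
      Matrix.mul_apply, Matrix.transpose_apply, Matrix.single_apply, smul_eq_mul, mul_sub, sub_mul,
      Finset.sum_sub_distrib, ite_and]
    simp [Finset.sum_ite_eq]
    ring
  have k := dual_infinitesimal M (hS c e)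
  rw [← hM, dual_add, dual_sum, dual_sum] at k
  simp only [dual_smul] at k
  have key : slice (cov4 d M m.eta) c e = 0 := by
    rw [slice_cov4]
    simp only [hs]
    rw [cov2_smul, cov2_eq, map_dual, hd, h.vol]
    have z : dual (0 : M4 A) = 0 := by ext; simp [dual]
    rw [z, mul_comm, mul_smul]
    simp only [smul_comm _ m.vol, ← Finset.smul_sum, ← smul_sub, ← smul_add]
    rw [sub_sub (_ + _) (∑ n, _), k]
    module
  exact congrFun (congrFun key a) b

theorem cov4_sdG (a b c e : Fin 4) : cov4 d M m.sdG a b c e = 0 := by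
  have : m.sdG = fun a b c e => (1 / 2 : ℂ) • (m.bigG a b c e + (-Complex.I) • m.eta a b c e) := by
    funext a b c e
    rw [MetricData.sdG, neg_smul, sub_eq_add_neg]
  rw [this, cov4_smul_complex, cov4_add, cov4_smul_complex, h.cov4_bigG, h.cov4_eta]
  simp

theorem cov4_sdPart {W : Quad A} (hW : ∀ a b c e, W a b c e = -W b a c e) (a b c e : Fin 4) :
    cov4 d M (m.sdPart W) a b c e = m.sdPart (cov4 d M W) a b c e := by
  have hW' : ∀ c e, (slice W c e)ᵀ = -slice W c e := fun c e => by
    ext a b; exact hW b a c e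
  have hs : ∀ V : Quad A, ∀ c e, slice (m.sdPart V) c e
      = (1 / 2 : ℂ) • (slice V c e - Complex.I • m.hodge (slice V c e)) := fun V c e => by
    ext a b; rfl
  have hsum : ∀ (x : Fin 4 → A) (F : Fin 4 → M4 A),
      m.hodge (∑ n, x n • F n) = ∑ n, x n • m.hodge (F n) := by
    intro x F
    simp only [MetricData.hodge, MetricData.up, Finset.mul_sum, Finset.sum_mul, Matrix.mul_smul,
      Matrix.smul_mul, dual_sum, dual_smul, Finset.smul_sum]
    exact Finset.sum_congr rfl fun _ _ => smul_comm _ _ _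
  have key : slice (cov4 d M (m.sdPart W)) c e = slice (m.sdPart (cov4 d M W)) c e := by
    rw [hs, slice_cov4, slice_cov4]
    simp only [hs, sub_eq_add_neg, MetricData.hodge_add, cov2_smul_complex, cov2_add,
      ← neg_one_smul ℂ (_ : M4 A), MetricData.hodge_smul, hsum, h.cov2_hodge (hW' c e), smul_add,
      Finset.sum_add_distrib, smul_comm (_ : A) (_ : ℂ) (_ : M4 A), ← Finset.smul_sum]
    module
  exact congrFun (congrFun key a) b

theorem map_contract (X Y : Fin 4 → A) :
    d (∑ a, ∑ b, m.gi a b * X a * Y b)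
      = ∑ a, ∑ b, m.gi a b * cov1 d M X a * Y b + ∑ a, ∑ b, m.gi a b * X a * cov1 d M Y b := by
  have k : ∀ a b, d (m.gi a b) = -∑ n, M a n * m.gi n b - ∑ n, m.gi a n * M b n := by
    intro a b
    have := congrFun (congrFun h.inv a) b
    simpa only [Matrix.map_apply, Matrix.sub_apply, Matrix.neg_apply, Matrix.mul_apply,
      Matrix.transpose_apply] using this
  simp only [cov1, map_sum, map_add, Derivation.leibniz, k, smul_eq_mul, Fin.sum_univ_four]
  ring

theorem map_trace (F : M4 A) : d (m.gi * F).trace = (m.gi * cov2 d M F).trace := by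
  have e : d (m.gi * F).trace = ((m.gi * F).map d).trace := by
    simp only [Matrix.trace, Matrix.diag, Matrix.map_apply, map_sum]
  rw [e, map_mul_derivation, h.inv, cov2_eq]
  simp only [mul_sub, sub_mul, neg_mul, Matrix.trace_add, Matrix.trace_sub, Matrix.trace_neg]
  rw [mul_assoc M, Matrix.trace_mul_comm M, ← mul_assoc m.gi F M, ← mul_assoc m.gi Mᵀ F]
  ring

theorem map_pair (F H : M4 A) :
    d (m.pair F H) = m.pair (cov2 d M F) H + m.pair F (cov2 d M H) := by
  have e : ∀ X Y : M4 A, ∑ a, ∑ b, X a b * Y a b = (Xᵀ * Y).trace := by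
    intro X Y
    simp only [Matrix.trace, Matrix.diag, Matrix.mul_apply, Matrix.transpose_apply]
    exact Finset.sum_comm
  have et : d (Fᵀ * m.up H).trace = ((Fᵀ * m.up H).map d).trace := by
    simp only [Matrix.trace, Matrix.diag, Matrix.map_apply, map_sum]
  simp only [MetricData.pair, Derivation.map_smul, ← smul_add, e]
  rw [et, map_mul_derivation, h.map_up, cov2_transpose, cov2_eq Fᵀ, ← Matrix.trace_add]
  congr 1
  simp only [mul_sub, sub_mul, neg_mul, Matrix.trace_add, Matrix.trace_sub, ← mul_assoc]
  rw [mul_assoc Mᵀ, Matrix.trace_mul_comm Mᵀ]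
  ring

end IsParallel

/-- Contraction of a covector with the first index of a 4-tensor. -/
def MetricData.interior (m : MetricData A) (X : Fin 4 → A) (V : Quad A) (a b c : Fin 4) : A :=
  ∑ i, ∑ j, m.gi i j * X j * V i a b c

/-- Contraction of a covector with the first index of a 2-tensor. -/
def MetricData.interior₂ (m : MetricData A) (X : Fin 4 → A) (F : M4 A) (a : Fin 4) : A :=
  ∑ i, ∑ j, m.gi i j * X j * F i a

theorem IsParallel.cov3_interior {m : MetricData A} (h : IsParallel d M m) (X : Fin 4 → A)
    (V : Quad A) (a b c : Fin 4) : cov3 d M (m.interior X V) a b c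
      = m.interior (cov1 d M X) V a b c + m.interior X (cov4 d M V) a b c := by
  have e : ∀ (X : Fin 4 → A) V a b c, m.interior X V a b c
      = ∑ i, ∑ j, m.gi i j * V i a b c * X j := by
    intro X V a b c
    exact Finset.sum_congr rfl fun _ _ => Finset.sum_congr rfl fun _ _ => by ring
  have k := h.map_contract (fun i => V i a b c) X
  have k2 : ∀ i, cov1 d M (fun i => V i a b c) i = cov4 d M V i a b c + ∑ n, M n a * V i n b c
      + ∑ n, M n b * V i a n c + ∑ n, M n c * V i a b n := by
    intro i; simp only [cov1, cov4]; ring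
  simp only [cov3, e, k, k2, mul_add, add_mul, Finset.sum_add_distrib]
  have r : ∀ f : Fin 4 → Fin 4 → A, ∀ a, ∑ n, M n a * ∑ i, ∑ j, m.gi i j * f n i * X j
      = ∑ i, ∑ j, m.gi i j * (∑ n, M n a * f n i) * X j := by
    intro f a
    simp only [Finset.mul_sum, Finset.sum_mul]
    rw [Finset.sum_comm]
    refine Finset.sum_congr rfl fun i _ => ?_
    rw [Finset.sum_comm]
    exact Finset.sum_congr rfl fun _ _ => Finset.sum_congr rfl fun _ _ => by ring
  rw [r (fun n i => V i n b c), r (fun n i => V i a n c), r (fun n i => V i a b n)]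
  ring

theorem IsParallel.cov1_interior₂ {m : MetricData A} (h : IsParallel d M m) (X : Fin 4 → A)
    (F : M4 A) (a : Fin 4) : cov1 d M (m.interior₂ X F) a
      = m.interior₂ (cov1 d M X) F a + m.interior₂ X (cov2 d M F) a := by
  have e : ∀ (X : Fin 4 → A) F a, m.interior₂ X F a = ∑ i, ∑ j, m.gi i j * F i a * X j := by
    intro X V a
    exact Finset.sum_congr rfl fun _ _ => Finset.sum_congr rfl fun _ _ => by ring
  have k := h.map_contract (fun i => F i a) X
  have k2 : ∀ i, cov1 d M (fun i => F i a) i = cov2 d M F i a + ∑ n, M n a * F i n := by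
    intro i; simp only [cov1, cov2, Matrix.of_apply]; ring
  have r : ∑ n, M n a * ∑ i, ∑ j, m.gi i j * F i n * X j
      = ∑ i, ∑ j, m.gi i j * (∑ n, M n a * F i n) * X j := by
    simp only [Finset.mul_sum, Finset.sum_mul]
    rw [Finset.sum_comm]
    refine Finset.sum_congr rfl fun i _ => ?_
    rw [Finset.sum_comm]
    exact Finset.sum_congr rfl fun _ _ => Finset.sum_congr rfl fun _ _ => by ring
  change d (m.interior₂ X F a) - ∑ n, M n a * m.interior₂ X F n = _
  simp only [e]
  rw [k, r]
  simp only [k2, mul_add, add_mul, Finset.sum_add_distrib]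
  ring

end

section
set_option linter.unusedSectionVars false
set_option linter.unusedSimpArgs false

variable {A : Type*} [CommRing A] [Algebra ℂ A]

/-! ### The Levi-Civita connection over a ring with four commuting derivations -/

/-- Commuting derivations, a metric and a connection `Γ c m b = Γ^m_{cb}`. -/
structure Geometry (A : Type*) [CommRing A] [Algebra ℂ A] where
  /-- the coordinate derivations -/
  der : Fin 4 → Derivation ℂ A A
  /-- the metric -/
  met : MetricData A
  /-- the connection -/
  conn : Fin 4 → M4 A

namespace Geometry

variable (γ : Geometry A)

/-- The conditions defining the Levi-Civita connection. -/
structure IsLeviCivita : Prop where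
  der_comm : ∀ a b x, γ.der a (γ.der b x) = γ.der b (γ.der a x)
  isMetric : γ.met.IsMetric
  torsion : ∀ a b c, γ.conn a b c = γ.conn c b a
  parallel : ∀ c, IsParallel (γ.der c) (γ.conn c) γ.met

/-- The curvature endomorphisms `R^a_{bcd}`. -/
def curv (c d : Fin 4) : M4 A :=
  (γ.conn d).map (γ.der c) - (γ.conn c).map (γ.der d) + γ.conn c * γ.conn d
    - γ.conn d * γ.conn c

/-- The Riemann tensor. -/
def riem : Quad A := fun a b c d => (γ.met.g * γ.curv c d) a b

/-- The covariant derivative of a covector. -/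
def nab1 (X : Fin 4 → A) : M4 A := Matrix.of fun a => cov1 (γ.der a) (γ.conn a) X

/-- The covariant derivative of a 2-tensor. -/
def nab2 (F : M4 A) (e : Fin 4) : M4 A := cov2 (γ.der e) (γ.conn e) F

variable {γ}

theorem map_comm (h : γ.IsLeviCivita) (a b : Fin 4) (F : M4 A) :
    (F.map (γ.der a)).map (γ.der b) = (F.map (γ.der b)).map (γ.der a) := by
  ext i j
  simp [h.der_comm a b]

theorem map_sub_derivation (d : Derivation ℂ A A) (F H : M4 A) :
    (F - H).map d = F.map d - H.map d := by
  ext i j; simp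

theorem map_add_derivation (d : Derivation ℂ A A) (F H : M4 A) :
    (F + H).map d = F.map d + H.map d := by
  ext i j; simp

theorem commutator_cov2 (h : γ.IsLeviCivita) (F : M4 A) (c d : Fin 4) :
    cov2 (γ.der c) (γ.conn c) (γ.nab2 F d) - cov2 (γ.der d) (γ.conn d) (γ.nab2 F c)
      = -((γ.curv c d)ᵀ * F) - F * γ.curv c d := by
  simp only [nab2, cov2_eq, map_mul_derivation, curv, map_sub_derivation, map_add_derivation,
    Matrix.transpose_sub, Matrix.transpose_add, Matrix.transpose_mul, map_comm h c d,
    map_transpose_derivation]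
  noncomm_ring

/-- Ricci identity. It differs from `commutator_cov2` by the connection terms on the index of
differentiation, which are symmetric in c, d for zero torsion and cancel. -/
theorem commutator_nab2 (h : γ.IsLeviCivita) (F : M4 A) (c d a b : Fin 4) :
    cov3 (γ.der c) (γ.conn c) (γ.nab2 F) d a b - cov3 (γ.der d) (γ.conn d) (γ.nab2 F) c a b
      = -∑ n, γ.curv c d n a * F n b - ∑ n, γ.curv c d n b * F a n := by
  have k := congrFun (congrFun (commutator_cov2 h F c d) a) b
  simp only [Matrix.sub_apply, cov2, Matrix.of_apply, Matrix.neg_apply, Matrix.mul_apply,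
    Matrix.transpose_apply, mul_comm (F _ _)] at k
  rw [← k]
  simp only [cov3, h.torsion d _ c]
  ring

theorem commutator_nab1 (h : γ.IsLeviCivita) (X : Fin 4 → A) (c d b : Fin 4) :
    cov2 (γ.der c) (γ.conn c) (γ.nab1 X) d b - cov2 (γ.der d) (γ.conn d) (γ.nab1 X) c b
      = -∑ n, γ.curv c d n b * X n := by
  simp only [cov2, nab1, cov1, Matrix.of_apply, curv, Matrix.sub_apply, Matrix.add_apply,
    Matrix.mul_apply, Matrix.map_apply, map_sub, map_sum, map_add, Derivation.leibniz, smul_eq_mul,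
    h.torsion d _ c, h.der_comm c d, Fin.sum_univ_four]
  ring

theorem curv_antisymm (c d : Fin 4) : γ.curv c d = -γ.curv d c := by
  simp only [curv]; abel

theorem riem_antisymm' (a b c d : Fin 4) : γ.riem a b c d = -γ.riem a b d c := by
  rw [riem, riem, curv_antisymm, Matrix.mul_neg, Matrix.neg_apply]

/-- Ricci identity for the parallel tensor g. -/
theorem riem_antisymm (h : γ.IsLeviCivita) (a b c d : Fin 4) :
    γ.riem a b c d = -γ.riem b a c d := by
  have k := commutator_cov2 h γ.met.g c d
  have z : ∀ e, γ.nab2 γ.met.g e = 0 := by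
    intro e
    rw [nab2, cov2_eq, (h.parallel e).metric]
    abel
  have z' : ∀ e, cov2 (γ.der e) (γ.conn e) 0 = 0 := by
    intro e
    rw [cov2_eq]; ext; simp
  rw [z, z, z', z', sub_self, eq_comm, sub_eq_zero] at k
  have k' := congrFun (congrFun k b) a
  have e : (γ.met.g * γ.curv c d)ᵀ = (γ.curv c d)ᵀ * γ.met.g := by
    rw [Matrix.transpose_mul, h.isMetric.symm]
  rw [← e, Matrix.neg_apply, Matrix.transpose_apply] at k'
  rw [riem, riem, ← k', neg_neg]

theorem curv_bianchi (h : γ.IsLeviCivita) (a b c d : Fin 4) :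
    γ.curv c d a b + γ.curv d b a c + γ.curv b c a d = 0 := by
  simp only [curv, Matrix.sub_apply, Matrix.add_apply, Matrix.mul_apply, Matrix.map_apply,
    h.torsion d a c, h.torsion d a b, h.torsion c a b, h.torsion d _ c, h.torsion d _ b,
    h.torsion c _ b]
  ring

theorem riem_bianchi (h : γ.IsLeviCivita) (a b c d : Fin 4) :
    γ.riem a b c d + γ.riem a c d b + γ.riem a d b c = 0 := by
  simp only [riem, Matrix.mul_apply, ← Finset.sum_add_distrib, ← mul_add, curv_bianchi h, mul_zero,
    Finset.sum_const_zero]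

/-- The classical combination of four first Bianchi identities with both antisymmetries gives twice
the equation. -/
theorem riem_pair (h : γ.IsLeviCivita) (a b c d : Fin 4) : γ.riem a b c d = γ.riem c d a b := by
  have k : (2 : ℂ) • γ.riem a b c d = (2 : ℂ) • γ.riem c d a b := by
    rw [two_smul, two_smul]
    have b1 := riem_bianchi h a b c d
    have b2 := riem_bianchi h b c d a
    have b3 := riem_bianchi h c d a b
    have b4 := riem_bianchi h d a b c
    have s1 := riem_antisymm h a b c d
    have s2 := riem_antisymm h a c d b
    have s3 := riem_antisymm h a d b c
    have s4 := riem_antisymm h b c d a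
    have s5 := riem_antisymm h b d a c
    have s6 := riem_antisymm h c d a b
    have t1 := γ.riem_antisymm' c a b d
    have t2 := γ.riem_antisymm' d b c a
    have t3 := γ.riem_antisymm' b a c d
    have t4 := γ.riem_antisymm' d a b c
    have t5 := γ.riem_antisymm' d c a b
    have t6 := γ.riem_antisymm' c b d a
    grind
  have := congrArg (fun x => (1 / 2 : ℂ) • x) k
  simpa only [smul_smul, show (1 / 2 * 2 : ℂ) = 1 by norm_num, one_smul] using this

/-- Jacobi identity for the operators ∂ + Γ, given that the coordinate derivations commute. -/
theorem curv_bianchi_second (h : γ.IsLeviCivita) (e c d : Fin 4) :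
    ((γ.curv c d).map (γ.der e) + γ.conn e * γ.curv c d - γ.curv c d * γ.conn e)
    + ((γ.curv d e).map (γ.der c) + γ.conn c * γ.curv d e - γ.curv d e * γ.conn c)
    + ((γ.curv e c).map (γ.der d) + γ.conn d * γ.curv e c - γ.curv e c * γ.conn d) = 0 := by
  simp only [curv, map_mul_derivation, map_sub_derivation, map_add_derivation, map_comm h c d,
    map_comm h c e, map_comm h d e]
  noncomm_ring

/-- The covariant derivative of the Riemann tensor. -/
def nabRiem (γ : Geometry A) (e : Fin 4) : Quad A := cov4 (γ.der e) (γ.conn e) γ.riem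

/-- The metric factor is parallel, and the connection terms on the form indices, absent from
`curv_bianchi_second`, cancel in the cyclic sum by vanishing torsion. -/
theorem nabRiem_bianchi (h : γ.IsLeviCivita) (a b e c d : Fin 4) :
    γ.nabRiem e a b c d + γ.nabRiem c a b d e + γ.nabRiem d a b e c = 0 := by
  have hc : ∀ e c d, cov2 (γ.der e) (γ.conn e) (slice γ.riem c d) = γ.met.g *
      ((γ.curv c d).map (γ.der e) + γ.conn e * γ.curv c d - γ.curv c d * γ.conn e) := by
    intro e c d
    have : slice γ.riem c d = γ.met.g * γ.curv c d := by ext; rfl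
    rw [this, cov2_eq, map_mul_derivation, (h.parallel e).metric]
    noncomm_ring
  have k : slice (γ.nabRiem e) c d + slice (γ.nabRiem c) d e + slice (γ.nabRiem d) e c = 0 := by
    have hs : ∀ c d, slice γ.riem c d = -slice γ.riem d c := by
      intro c d; ext a b; exact γ.riem_antisymm' a b c d
    have z := congrArg (fun X => γ.met.g * X) (curv_bianchi_second h e c d)
    simp only [mul_add, mul_zero] at z
    simp only [nabRiem, slice_cov4, hc]
    rw [← z]
    simp only [h.torsion d _ c, h.torsion d _ e, h.torsion c _ e, hs c, hs d, hs e, smul_neg,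
      Finset.sum_neg_distrib]
    simp only [mul_add, mul_sub]
    abel
  exact congrFun (congrFun k a) b

/-- `Ric = 0`. -/
def IsVacuum (γ : Geometry A) : Prop := ∀ b d, ∑ a, γ.curv a d a b = 0

theorem isWeylLike_riem (h : γ.IsLeviCivita) (hv : γ.IsVacuum) : γ.met.IsWeylLike γ.riem where
  antisymm := riem_antisymm h
  antisymm' := γ.riem_antisymm'
  pair_symm := riem_pair h
  traceless b d := by
    have e : ∀ c, ∑ a, γ.met.gi a c * γ.riem a b c d = γ.curv c d c b := by
      intro c
      have : γ.curv c d = γ.met.gi * (γ.met.g * γ.curv c d) := by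
        rw [← mul_assoc, h.isMetric.inv_mul, one_mul]
      conv_rhs => rw [this]
      rw [Matrix.mul_apply]
      exact Finset.sum_congr rfl fun a _ => by rw [h.isMetric.inv_symm_apply a c]; rfl
    rw [Finset.sum_comm]
    simp only [e]
    exact hv b d

end Geometry

/-! ### The contracted Bianchi identity for the self-dual Weyl tensor -/

theorem IsParallel.isWeylLike_cov4 {d : Derivation ℂ A A} {M : M4 A} {m : MetricData A}
    (h : IsParallel d M m) (hm : m.IsMetric) {W : Quad A} (hW : m.IsWeylLike W) :
    m.IsWeylLike (cov4 d M W) where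
  antisymm a b c e := by
    simp only [cov4, hW.antisymm a b c e, hW.antisymm a _ c e, hW.antisymm _ b c e,
      hW.antisymm a b _ e, hW.antisymm a b c _, map_neg, mul_neg, Finset.sum_neg_distrib]
    ring
  antisymm' a b c e := by
    simp only [cov4, hW.antisymm' a b c e, hW.antisymm' a _ c e, hW.antisymm' _ b c e,
      hW.antisymm' a b _ e, hW.antisymm' a b c _, map_neg, mul_neg, Finset.sum_neg_distrib]
    ring
  pair_symm a b c e := by
    simp only [cov4, hW.pair_symm a b c e, hW.pair_symm a _ c e, hW.pair_symm _ b c e,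
      hW.pair_symm a b _ e, hW.pair_symm a b c _]
    ring
  traceless b e := by
    have tr : ∀ F : M4 A, (m.gi * F).trace = ∑ a, ∑ c, m.gi a c * F a c := by
      intro F
      simp only [Matrix.trace, Matrix.diag, Matrix.mul_apply]
      rw [Finset.sum_comm]
      exact Finset.sum_congr rfl fun a _ => Finset.sum_congr rfl fun c _ => by
        rw [hm.inv_symm_apply]
    have k := h.map_trace (Matrix.of fun a c => W a b c e)
    rw [tr, tr] at k
    simp only [Matrix.of_apply, hW.traceless, map_zero] at k
    have e1 : ∀ a c, cov4 d M W a b c e = cov2 d M (Matrix.of fun a c => W a b c e) a c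
        - ∑ n, M n b * W a n c e - ∑ n, M n e * W a b c n := by
      intro a c; simp only [cov4, cov2, Matrix.of_apply]; ring
    have r : ∀ (f : Fin 4 → Fin 4 → Fin 4 → A) b, ∑ a, ∑ c, m.gi a c * ∑ n, M n b * f n a c
        = ∑ n, M n b * ∑ a, ∑ c, m.gi a c * f n a c := by
      intro f b
      simp only [Finset.mul_sum]
      conv_rhs => rw [Finset.sum_comm]
      refine Finset.sum_congr rfl fun i _ => ?_
      conv_rhs => rw [Finset.sum_comm]
      exact Finset.sum_congr rfl fun _ _ => Finset.sum_congr rfl fun _ _ => by ring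
    simp only [e1, mul_sub, Finset.sum_sub_distrib, ← k]
    rw [r (fun n a c => W a n c e), r (fun n a c => W a b c n)]
    simp [hW.traceless]

theorem sum_eps_mul_cyclic {T : Fin 4 → Fin 4 → Fin 4 → A}
    (hc : ∀ a b c, T a b c + T b c a + T c a b = 0) (b : Fin 4) :
    ∑ a, ∑ f, ∑ k, (eps a b f k : A) * T a f k = 0 := by
  have h1 := hc 1 2 3
  have h2 := hc 1 3 2
  have h3 := hc 0 2 3
  have h4 := hc 0 3 2
  have h5 := hc 0 1 3
  have h6 := hc 0 3 1
  have h7 := hc 0 1 2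
  have h8 := hc 0 2 1
  simp only [Fin.sum_univ_four]
  fin_cases b <;> simp only [Fin.zero_eta, Fin.mk_one, Fin.reduceFinMk, eps_eq_zero, eps_values,
    Int.cast_zero, Int.cast_one, Int.cast_neg]
  · linear_combination h2 - h1
  · linear_combination h3 - h4
  · linear_combination h6 - h5
  · linear_combination h7 - h8

/-- The algebra behind "dF = 0 implies δ*F = 0": contraction with ε sees only the cyclic sum of N
with its indices raised. -/
theorem sum_hodge_cyclic {m : MetricData A} (hm : m.IsMetric) {N : Fin 4 → M4 A}
    (hc : ∀ a b c, N a b c + N b c a + N c a b = 0) (b : Fin 4) :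
    ∑ e, ∑ a, m.gi e a * m.hodge (N e) a b = 0 := by
  let T : Fin 4 → Fin 4 → Fin 4 → A := fun a f k => ∑ e, m.gi a e * m.up (N e) f k
  have hT : ∀ a f k, T a f k = ∑ e, ∑ p, ∑ q, m.gi a e * m.gi f p * m.gi k q * N e p q := by
    intro a f k
    simp only [T, MetricData.up, Matrix.mul_apply, Matrix.transpose_apply, Finset.mul_sum,
      Finset.sum_mul]
    refine Finset.sum_congr rfl fun e _ => ?_
    rw [Finset.sum_comm]
    exact Finset.sum_congr rfl fun _ _ => Finset.sum_congr rfl fun _ _ => by ring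
  have hTc : ∀ a b c, T a b c + T b c a + T c a b = 0 := by
    intro a b c
    have e2 : T b c a = ∑ e, ∑ p, ∑ q, m.gi a e * m.gi b p * m.gi c q * N p q e := by
      rw [hT, Finset.sum_comm]
      have : ∀ f : Fin 4 → Fin 4 → Fin 4 → A, ∑ y, ∑ x, ∑ z, f x y z = ∑ z, ∑ x, ∑ y, f x y z := by
        intro f; simp only [Fin.sum_univ_four]; ring
      rw [this]
      exact Finset.sum_congr rfl fun _ _ => Finset.sum_congr rfl fun _ _ =>
        Finset.sum_congr rfl fun _ _ => by ring
    have e3 : T c a b = ∑ e, ∑ p, ∑ q, m.gi a e * m.gi b p * m.gi c q * N q e p := by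
      rw [hT]
      have : ∀ f : Fin 4 → Fin 4 → Fin 4 → A, ∑ x, ∑ y, ∑ z, f x y z = ∑ y, ∑ z, ∑ x, f x y z := by
        intro f; simp only [Fin.sum_univ_four]; ring
      rw [this]
      exact Finset.sum_congr rfl fun _ _ => Finset.sum_congr rfl fun _ _ =>
        Finset.sum_congr rfl fun _ _ => by ring
    rw [e2, e3, hT]
    simp only [← Finset.sum_add_distrib, ← mul_add, hc, mul_zero, Finset.sum_const_zero]
  have k := sum_eps_mul_cyclic hTc b
  calc ∑ e, ∑ a, m.gi e a * m.hodge (N e) a b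
      = (1 / 2 : ℂ) • (m.vol * ∑ a, ∑ f, ∑ k, (eps a b f k : A) * T a f k) := by
        simp only [MetricData.hodge, dual, T, Matrix.smul_apply, Matrix.of_apply, smul_eq_mul,
          mul_smul_comm, ← Finset.smul_sum, Finset.mul_sum]
        congr 1
        rw [Finset.sum_comm]
        refine Finset.sum_congr rfl fun a _ => ?_
        rw [Finset.sum_comm]
        refine Finset.sum_congr rfl fun f _ => ?_
        rw [Finset.sum_comm]
        exact Finset.sum_congr rfl fun _ _ => Finset.sum_congr rfl fun e _ => by
          rw [hm.inv_symm_apply e a]; ring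
    _ = 0 := by rw [k, mul_zero, smul_zero]

/-- The self-dual Weyl tensor is divergence-free in vacuum. -/
theorem Geometry.divergence_sdPart {γ : Geometry A} (h : γ.IsLeviCivita) (hv : γ.IsVacuum)
    (b c d : Fin 4) : ∑ e, ∑ a, γ.met.gi e a *
      cov4 (γ.der e) (γ.conn e) (γ.met.sdPart γ.riem) a b c d = 0 := by
  have hW : ∀ e, γ.met.IsWeylLike (γ.nabRiem e) := fun e =>
    (h.parallel e).isWeylLike_cov4 h.isMetric (isWeylLike_riem h hv)
  -- The Bianchi identity turns the divergence of Riem into a difference of traces of ∇Riem, which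
  -- vanish in vacuum.
  have h1 : ∑ e, ∑ a, γ.met.gi e a * γ.nabRiem e a b c d = 0 := by
    have e1 : ∀ e a, γ.nabRiem e a b c d = γ.nabRiem c a b e d - γ.nabRiem d a b e c := by
      intro e a
      rw [(hW c).antisymm']
      linear_combination nabRiem_bianchi h a b e c d
    have e2 : ∀ c d, ∑ e, ∑ a, γ.met.gi e a * γ.nabRiem c a b e d = 0 := by
      intro c d
      rw [Finset.sum_comm, ← (hW c).traceless b d]
      exact Finset.sum_congr rfl fun _ _ => Finset.sum_congr rfl fun _ _ => by
        rw [h.isMetric.inv_symm_apply]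
    simp only [e1, mul_sub, Finset.sum_sub_distrib, e2, sub_zero]
  -- Pair symmetry moves the Bianchi identity to the first index pair, so the divergence of the dual
  -- vanishes too.
  have h2 := sum_hodge_cyclic h.isMetric (N := fun e => slice (γ.nabRiem e) c d)
    (fun x y z => by
      simp only [slice_apply, (hW _).pair_symm _ _ c d]
      exact nabRiem_bianchi h c d x y z) b
  simp only [(h.parallel _).cov4_sdPart (riem_antisymm h), MetricData.sdPart, mul_smul_comm, mul_sub,
    Finset.sum_sub_distrib, ← Finset.smul_sum]
  unfold nabRiem at h1 h2
  rw [h1, h2, smul_zero, sub_zero, smul_zero]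

end

section
set_option linter.unusedSectionVars false
set_option linter.unusedSimpArgs false

variable {A : Type*} [CommRing A] [Algebra ℂ A]

/-! ### Type D vacuum geometries -/

theorem half_smul_cancel {x y : A} (h : (2 : ℂ) • x = (2 : ℂ) • y) : x = y := by
  have := congrArg (fun x => (1 / 2 : ℂ) • x) h
  simpa only [smul_smul, show (1 / 2 * 2 : ℂ) = 1 by norm_num, one_smul] using this

namespace MetricData

variable {m : MetricData A}

/-- In matrix form, repeated contraction with U becomes multiplication by g⁻¹U, whose square is ½.
-/
theorem interior₂_eq (h : m.IsMetric) (X : Fin 4 → A) (F : M4 A) :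
    m.interior₂ X F = Matrix.vecMul X (m.gi * F) := by
  ext a
  simp only [interior₂, Matrix.vecMul, dotProduct, Matrix.mul_apply, Finset.mul_sum]
  rw [Finset.sum_comm]
  exact Finset.sum_congr rfl fun j _ => Finset.sum_congr rfl fun i _ => by
    rw [h.inv_symm_apply i j]; ring

theorem interior_eq (X : Fin 4 → A) (V : Quad A) (a b c : Fin 4) :
    m.interior X V a b c = m.interior₂ X (slice V b c) a := rfl

/-- `U_{ab} U_{cd} + 𝒢_{abcd}`. -/
def bivectorQuad (m : MetricData A) (U : M4 A) : Quad A := fun a b c d =>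
  U a b * U c d + m.sdG a b c d

theorem interior_bivectorQuad (X : Fin 4 → A) (U : M4 A) (a b c : Fin 4) :
    m.interior X (m.bivectorQuad U) a b c
      = m.interior₂ X U a * U b c + m.interior X m.sdG a b c := by
  simp only [interior, interior₂, bivectorQuad, mul_add, Finset.sum_add_distrib, Finset.sum_mul,
    mul_assoc]

theorem interior_smul (x : A) (X : Fin 4 → A) (V : Quad A) (a b c : Fin 4) :
    m.interior (fun e => x * X e) V a b c = x * m.interior X V a b c := by
  simp only [interior, Finset.mul_sum]
  exact Finset.sum_congr rfl fun _ _ => Finset.sum_congr rfl fun _ _ => by ring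

theorem interior₂_smul (x : A) (X : Fin 4 → A) (F : M4 A) (a : Fin 4) :
    m.interior₂ (fun e => x * X e) F a = x * m.interior₂ X F a := by
  simp only [interior₂, Finset.mul_sum]
  exact Finset.sum_congr rfl fun _ _ => Finset.sum_congr rfl fun _ _ => by ring

end MetricData

namespace Geometry

theorem curv_eq {γ : Geometry A} (h : γ.IsLeviCivita) (c d a b : Fin 4) :
    γ.curv c d a b = ∑ p, γ.met.gi a p * γ.riem p b c d := by
  have : γ.curv c d = γ.met.gi * (γ.met.g * γ.curv c d) := by
    rw [← mul_assoc, h.isMetric.inv_mul, one_mul]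
  conv_lhs => rw [this]
  rw [Matrix.mul_apply]
  rfl

/-- The divergence `-∇_a U^a_b`. -/
def divergence (γ : Geometry A) (U : M4 A) (b : Fin 4) : A :=
  -∑ a, ∑ c, γ.met.gi a c * γ.nab2 U a c b

/-- A type D vacuum geometry with eigenvalue `s ^ 3`, canonical bivector `U`, and
`Z = s⁻¹ δU`. -/
structure IsTypeD (γ : Geometry A) (s : A) (U : M4 A) (Z : Fin 4 → A) : Prop where
  leviCivita : γ.IsLeviCivita
  vacuum : γ.IsVacuum
  unit : IsUnit s
  bivector : γ.met.IsUnitBivector U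
  weyl : γ.met.sdPart γ.riem
    = fun a b c d => s ^ 3 * (3 * (U a b * U c d) + γ.met.sdG a b c d)
  divergence_eq : ∀ b, γ.divergence U b = s * Z b

namespace IsTypeD

variable {γ : Geometry A} {s : A} {U : M4 A} {Z : Fin 4 → A} (h : γ.IsTypeD s U Z)
include h

/-- Derivative of (U,U) = -1. -/
theorem pair_nab2 (e : Fin 4) : γ.met.pair (γ.nab2 U e) U = 0 := by
  have k := (h.leviCivita.parallel e).map_pair U U
  rw [h.bivector.pair_self, MetricData.pair_comm h.leviCivita.isMetric h.bivector.isDual.antisymm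
    (cov2_antisymm h.bivector.isDual.antisymm), map_neg, Derivation.map_one_eq_zero, neg_zero] at k
  refine half_smul_cancel ?_
  rw [smul_zero, two_smul]
  exact k.symm

/-- Leibniz expansion of div 𝒲 = 0 for 𝒲 = w(3 U⊗U + 𝒢) with 𝒢 parallel. This single equation
determines both dw and ∇U from δU. -/
theorem bianchi (c d : Fin 4) :
    (3 * U c d) • Matrix.vecMul (fun e => γ.der e (s ^ 3)) (γ.met.gi * U)
      + Matrix.vecMul (fun e => γ.der e (s ^ 3)) (γ.met.gi * slice γ.met.sdG c d)
      - (3 * s ^ 3 * U c d) • γ.divergence U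
      + (3 * s ^ 3) • Matrix.vecMul (fun e => γ.nab2 U e c d) (γ.met.gi * U) = 0 := by
  funext b
  have k := divergence_sdPart h.leviCivita h.vacuum b c d
  have e1 : ∀ e a, cov4 (γ.der e) (γ.conn e) (γ.met.sdPart γ.riem) a b c d
      = γ.der e (s ^ 3) * (3 * (U a b * U c d) + γ.met.sdG a b c d)
        + s ^ 3 * (3 * (γ.nab2 U e a b * U c d + U a b * γ.nab2 U e c d)) := by
    intro e a
    have three : γ.der e 3 = 0 := (γ.der e).map_natCast 3
    rw [h.weyl, cov4_smul, cov4_add, cov4_smul, cov4_outer,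
      (h.leviCivita.parallel e).cov4_sdG, three]
    simp only [nab2]
    ring
  simp only [e1] at k
  have v : ∀ (u : Fin 4 → A) (X : M4 A), Matrix.vecMul u (γ.met.gi * X) b
      = ∑ e, ∑ a, γ.met.gi e a * (u e * X a b) := by
    intro u X
    simp only [Matrix.vecMul, dotProduct, Matrix.mul_apply, Finset.mul_sum]
    exact Finset.sum_congr rfl fun _ _ => Finset.sum_congr rfl fun _ _ => by ring
  simp only [Pi.add_apply, Pi.sub_apply, Pi.smul_apply, Pi.zero_apply, v, smul_eq_mul, divergence]
  rw [← k]
  simp only [mul_neg, sub_neg_eq_add, Finset.mul_sum, ← Finset.sum_add_distrib, slice_apply]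
  exact Finset.sum_congr rfl fun _ _ => Finset.sum_congr rfl fun _ _ => by ring

theorem isUnit_three_cube : IsUnit (3 * s ^ 3) := by
  refine IsUnit.mul ?_ (h.unit.pow 3)
  rw [← map_ofNat (algebraMap ℂ A) 3]
  exact (isUnit_iff_ne_zero.mpr (by norm_num)).map _

/-- Contract `bianchi` with U^{cd}. The ∇U term dies by `pair_nab2`; as U_{cd}U^{cd} = -2 and 𝒢
reproduces 2U, the dw terms have coefficient -6 + 2 = -4 and the δU term has coefficient 6w. -/
theorem divergence_eq_der :
    (3 * s ^ 3) • γ.divergence U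
      = (2 : A) • Matrix.vecMul (fun e => γ.der e (s ^ 3)) (γ.met.gi * U) := by
  have hm := h.leviCivita.isMetric
  set u := fun e => γ.der e (s ^ 3) with hu
  funext b
  have k : ∀ c d, γ.met.up U c d * _ = γ.met.up U c d * _ := fun c d =>
    congrArg (fun x => γ.met.up U c d * x) (congrFun (h.bianchi c d) b)
  have hUU : ∑ c, ∑ d, U c d * γ.met.up U c d = -2 := by
    have := congrArg (fun x => (2 : ℂ) • x) h.bivector.pair_self
    simp only [MetricData.pair, smul_smul, show (2 * (1 / 2) : ℂ) = 1 by norm_num, one_smul] at this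
    rw [this, smul_neg, two_smul]; norm_num
  have hG : ∀ a b, ∑ c, ∑ d, γ.met.sdG a b c d * γ.met.up U c d = 2 * U a b := by
    intro a b
    have := congrFun (congrFun (h.bivector.isDual.act_sdG hm) a) b
    rw [← this, MetricData.act, Matrix.of_apply, mul_smul_comm, half_smul_two_mul]
  have hE : ∀ e, ∑ c, ∑ d, γ.nab2 U e c d * γ.met.up U c d = 0 := by
    intro e
    have := congrArg (fun x => (2 : ℂ) • x) (h.pair_nab2 e)
    simpa only [MetricData.pair, smul_smul, show (2 * (1 / 2) : ℂ) = 1 by norm_num, one_smul,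
      smul_zero] using this
  have v : ∀ (u : Fin 4 → A) (X : M4 A), Matrix.vecMul u (γ.met.gi * X) b
      = ∑ e, ∑ a, γ.met.gi e a * (u e * X a b) := by
    intro u X
    simp only [Matrix.vecMul, dotProduct, Matrix.mul_apply, Finset.mul_sum]
    exact Finset.sum_congr rfl fun _ _ => Finset.sum_congr rfl fun _ _ => by ring
  have k2 : ∑ c, ∑ d, γ.met.up U c d * ((3 * U c d) • Matrix.vecMul u (γ.met.gi * U)
      + Matrix.vecMul u (γ.met.gi * slice γ.met.sdG c d)
      - (3 * s ^ 3 * U c d) • γ.divergence U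
      + (3 * s ^ 3) • Matrix.vecMul (fun e => γ.nab2 U e c d) (γ.met.gi * U)) b = 0 := by
    refine Finset.sum_eq_zero fun c _ => Finset.sum_eq_zero fun d _ => ?_
    rw [h.bianchi c d]; simp
  simp only [Pi.add_apply, Pi.sub_apply, Pi.smul_apply, smul_eq_mul, mul_add, mul_sub,
    Finset.sum_add_distrib, Finset.sum_sub_distrib] at k2
  have t1 : ∀ x : A, ∑ c, ∑ d, γ.met.up U c d * (3 * U c d * x) = -6 * x := by
    intro x
    calc _ = 3 * x * ∑ c, ∑ d, U c d * γ.met.up U c d := by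
          simp only [Finset.mul_sum]
          exact Finset.sum_congr rfl fun _ _ => Finset.sum_congr rfl fun _ _ => by ring
      _ = _ := by rw [hUU]; ring
  have t3 : ∀ x : A, ∑ c, ∑ d, γ.met.up U c d * (3 * s ^ 3 * U c d * x) = -6 * s ^ 3 * x := by
    intro x
    calc _ = 3 * s ^ 3 * x * ∑ c, ∑ d, U c d * γ.met.up U c d := by
          simp only [Finset.mul_sum]
          exact Finset.sum_congr rfl fun _ _ => Finset.sum_congr rfl fun _ _ => by ring
      _ = _ := by rw [hUU]; ring
  have t2 : ∑ c, ∑ d, γ.met.up U c d * Matrix.vecMul u (γ.met.gi * slice γ.met.sdG c d) b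
      = 2 * Matrix.vecMul u (γ.met.gi * U) b := by
    simp only [v, slice_apply, Finset.mul_sum]
    rw [MetricData.sum_comm_pairs]
    refine Finset.sum_congr rfl fun e _ => Finset.sum_congr rfl fun a _ => ?_
    calc _ = γ.met.gi e a * u e * ∑ c, ∑ d, γ.met.sdG a b c d * γ.met.up U c d := by
          simp only [Finset.mul_sum]
          exact Finset.sum_congr rfl fun _ _ => Finset.sum_congr rfl fun _ _ => by ring
      _ = _ := by rw [hG]; ring
  have t4 : ∑ c, ∑ d, γ.met.up U c d *
      (3 * s ^ 3 * Matrix.vecMul (fun e => γ.nab2 U e c d) (γ.met.gi * U) b) = 0 := by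
    simp only [v, Finset.mul_sum]
    rw [MetricData.sum_comm_pairs]
    refine Finset.sum_eq_zero fun e _ => Finset.sum_eq_zero fun a _ => ?_
    calc _ = 3 * s ^ 3 * γ.met.gi e a * U a b * ∑ c, ∑ d, γ.nab2 U e c d * γ.met.up U c d := by
          simp only [Finset.mul_sum]
          exact Finset.sum_congr rfl fun _ _ => Finset.sum_congr rfl fun _ _ => by ring
      _ = _ := by rw [hE]; ring
  rw [t1, t2, t3, t4] at k2
  refine half_smul_cancel ?_
  simp only [two_smul, Pi.smul_apply, smul_eq_mul]
  linear_combination k2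

/-- `divergence_eq_der` inverted by means of (g⁻¹U)² = ½. -/
theorem der_cube : (fun e => γ.der e (s ^ 3))
    = (3 * s ^ 3) • Matrix.vecMul (γ.divergence U) (γ.met.gi * U) := by
  have hm := h.leviCivita.isMetric
  rw [← Matrix.smul_vecMul, h.divergence_eq_der, Matrix.smul_vecMul, Matrix.vecMul_vecMul,
    ← mul_assoc, h.bivector.inv_sq hm, Matrix.vecMul_smul, Matrix.vecMul_one]
  ext e
  simp only [Pi.smul_apply, smul_eq_mul, mul_smul_comm, half_smul_two_mul]

/-- Multiplying `bianchi` on the right by g⁻¹U frees ∇U, again because (g⁻¹U)² = ½. The 𝒢 term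
becomes a conjugate by U, known from `conj_eq`, dw is eliminated with `der_cube`, and the unit 3w is
cancelled. -/
theorem nab2_eq_divergence (c d : Fin 4) : (fun e => γ.nab2 U e c d)
    = U c d • Matrix.vecMul (γ.divergence U) (γ.met.gi * U)
      + Matrix.vecMul (γ.divergence U) (γ.met.gi * slice γ.met.sdG c d) := by
  have hm := h.leviCivita.isMetric
  have k := congrArg (fun x => Matrix.vecMul x (γ.met.gi * U)) (h.bianchi c d)
  have sq : γ.met.gi * U * (γ.met.gi * U) = (1 / 2 : ℂ) • 1 := by
    rw [← mul_assoc, h.bivector.inv_sq hm]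
  have conj : γ.met.gi * U * (γ.met.gi * slice γ.met.sdG c d * (γ.met.gi * U))
      = -((1 / 2 : ℂ) • (γ.met.gi * slice γ.met.sdG c d)) - U c d • (γ.met.gi * U) := by
    have := h.bivector.conj_eq hm (MetricData.isDual_slice_sdG hm c d)
    rw [MetricData.pair_slice_sdG hm h.bivector.isDual] at this
    calc _ = γ.met.gi * (U * γ.met.gi * slice γ.met.sdG c d * γ.met.gi * U) := by
          simp only [mul_assoc]
      _ = _ := by rw [this, mul_sub, mul_neg, Matrix.mul_smul, Matrix.mul_smul]
  simp only [Matrix.add_vecMul, Matrix.sub_vecMul, Matrix.smul_vecMul, Matrix.vecMul_vecMul, sq,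
    Matrix.zero_vecMul] at k
  rw [h.der_cube] at k
  simp only [Matrix.smul_vecMul, Matrix.vecMul_vecMul, sq, conj] at k
  simp only [Matrix.mul_smul, mul_one, Matrix.vecMul_smul, Matrix.vecMul_one, Matrix.vecMul_sub,
    Matrix.vecMul_neg] at k
  funext e
  have k := congrFun k e
  simp only [Pi.add_apply, Pi.sub_apply, Pi.smul_apply, Pi.neg_apply, Pi.zero_apply,
    smul_eq_mul] at k ⊢
  simp only [Algebra.smul_def (R := ℂ) (A := A)] at k
  have two : algebraMap ℂ A (1 / 2) * 2 = 1 := by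
    rw [← map_ofNat (algebraMap ℂ A) 2, ← map_mul]; norm_num
  rw [← sub_eq_zero, ← (h.isUnit_three_cube).mul_right_eq_zero]
  linear_combination 2 * k - (3 * s ^ 3) * (γ.nab2 U e c d
    + 3 * U c d * Matrix.vecMul (γ.divergence U) (γ.met.gi * U) e
    - Matrix.vecMul (γ.divergence U) (γ.met.gi * slice γ.met.sdG c d) e) * two

theorem divergence_eq_mul : γ.divergence U = fun b => s * Z b := funext h.divergence_eq

/-- The covariant derivative of the canonical bivector. -/
theorem nab2_eq (e c d : Fin 4) :
    γ.nab2 U e c d = s * γ.met.interior Z (γ.met.bivectorQuad U) e c d := by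
  have hm := h.leviCivita.isMetric
  rw [congrFun (h.nab2_eq_divergence c d) e, h.divergence_eq_mul, ← MetricData.interior_smul,
    MetricData.interior_bivectorQuad, MetricData.interior_eq, MetricData.interior₂_eq hm,
    MetricData.interior₂_eq hm]
  simp only [Pi.add_apply, Pi.smul_apply, smul_eq_mul]
  ring

/-- The derivative of the cube root of the Weyl eigenvalue. -/
theorem der_eq (e : Fin 4) : γ.der e s = s ^ 2 * γ.met.interior₂ Z U e := by
  have hm := h.leviCivita.isMetric
  have k := congrFun h.der_cube e
  rw [Derivation.leibniz_pow, h.divergence_eq_mul, Pi.smul_apply, ← MetricData.interior₂_eq hm,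
    MetricData.interior₂_smul] at k
  simp only [smul_eq_mul, nsmul_eq_mul] at k
  have u : IsUnit (3 * s ^ 3) := h.isUnit_three_cube
  rw [← sub_eq_zero, ← u.mul_right_eq_zero]
  push_cast at k
  linear_combination s * k

/-- The equation of a conformal Killing-Yano tensor for `w^{-1/3} U`. -/
theorem nab2_smul_eq {t : A} (ht : s * t = 1) (e : Fin 4) :
    γ.nab2 (t • U) e = Matrix.of fun c d => γ.met.interior Z γ.met.sdG e c d := by
  -- With t = s⁻¹, dt = -s⁻² ds; this exactly removes the U⊗U part of ∇U.
  have hd : γ.der e t = -γ.met.interior₂ Z U e := by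
    have k := congrArg (γ.der e) ht
    rw [Derivation.leibniz, Derivation.map_one_eq_zero, h.der_eq] at k
    simp only [smul_eq_mul] at k
    linear_combination t * k - (γ.der e t + γ.met.interior₂ Z U e * (s * t + 1)) * ht
  ext c d
  have k := h.nab2_eq e c d
  rw [MetricData.interior_bivectorQuad] at k
  rw [nab2] at k
  rw [nab2, cov2_smul, hd]
  simp only [Matrix.add_apply, Matrix.smul_apply, smul_eq_mul, k, Matrix.of_apply]
  linear_combination (γ.met.interior₂ Z U e * U c d + γ.met.interior Z γ.met.sdG e c d) * ht

theorem cov3_nab2_smul {t : A} (ht : s * t = 1) (b e c d : Fin 4) :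
    cov3 (γ.der b) (γ.conn b) (γ.nab2 (t • U)) e c d
      = γ.met.interior (γ.nab1 Z b) γ.met.sdG e c d := by
  have e1 : (fun e c d => γ.nab2 (t • U) e c d) = γ.met.interior Z γ.met.sdG := by
    funext e c d
    rw [h.nab2_smul_eq ht e]; rfl
  have e2 := (h.leviCivita.parallel b).cov3_interior Z γ.met.sdG e c d
  rw [← e1] at e2
  have e3 : γ.met.interior Z (cov4 (γ.der b) (γ.conn b) γ.met.sdG) e c d = 0 := by
    simp only [MetricData.interior, (h.leviCivita.parallel b).cov4_sdG, mul_zero,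
      Finset.sum_const_zero]
  rw [e3, add_zero] at e2
  exact e2

/-- `Z` is a Killing field. -/
theorem nab1_antisymm : (γ.nab1 Z)ᵀ = -γ.nab1 Z := by
  have hm := h.leviCivita.isMetric
  have hW := isWeylLike_riem h.leviCivita h.vacuum
  obtain ⟨t, ht⟩ := h.unit.exists_right_inv
  -- The Ricci identity for Y = s⁻¹U, whose second derivatives are contractions of ∇Z with 𝒢, is
  -- contracted over b and c. Its part symmetric in e, d is a linear equation for the symmetric part
  -- of N = ∇Z.
  set N := γ.nab1 Z with hN
  set Y := t • U with hY
  have hYa : ∀ a b, Y a b = -Y b a := fun a b => by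
    have : U a b = -U b a := congrFun (congrFun h.bivector.isDual.antisymm b) a
    simp [hY, this]
  have hgg : ∀ a b, ∑ c, γ.met.gi a c * γ.met.g c b = if a = b then 1 else 0 := fun a b => by
    have := congrFun (congrFun hm.inv_mul a) b
    rwa [Matrix.mul_apply, Matrix.one_apply] at this
  set tr := ∑ i, ∑ j, γ.met.gi i j * N i j with htr
  -- the contracted left-hand side
  have l2 : ∀ e d, ∑ b, ∑ c, γ.met.gi b c * γ.met.interior (N e) γ.met.sdG b c d
      = -(3 / 2 : ℂ) • N e d := by
    intro e d
    calc _ = ∑ j, N e j * ∑ i, γ.met.gi i j * ∑ b, ∑ c, γ.met.gi b c * γ.met.sdG i b c d := by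
          simp only [MetricData.interior, Finset.mul_sum]
          have : ∀ f : Fin 4 → Fin 4 → Fin 4 → Fin 4 → A,
              ∑ b, ∑ c, ∑ i, ∑ j, f b c i j = ∑ j, ∑ i, ∑ b, ∑ c, f b c i j := by
            intro f
            rw [MetricData.sum_comm_pairs, Finset.sum_comm]
          rw [this]
          exact Finset.sum_congr rfl fun _ _ => Finset.sum_congr rfl fun _ _ =>
            Finset.sum_congr rfl fun _ _ => Finset.sum_congr rfl fun _ _ => by ring
      _ = -(3 / 2 : ℂ) • ∑ j, N e j * ∑ i, γ.met.gi j i * γ.met.g i d := by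
          simp only [MetricData.trace_sdG hm, mul_smul_comm, ← Finset.smul_sum,
            hm.inv_symm_apply _ (_ : Fin 4)]
      _ = _ := by simp [hgg]
  have l1 : ∀ e d, ∑ b, ∑ c, γ.met.gi b c * γ.met.interior (N b) γ.met.sdG e c d
      = (1 / 2 : ℂ) • (tr * γ.met.g e d - N e d - Complex.I •
        ∑ b, ∑ c, ∑ i, ∑ j, γ.met.gi b c * γ.met.gi i j * N b j * γ.met.eta i e c d) := by
    intro e d
    have re : ∀ f : Fin 4 → Fin 4 → Fin 4 → Fin 4 → A,
        ∑ b, ∑ c, ∑ i, ∑ j, f b c i j = ∑ b, ∑ j, ∑ i, ∑ c, f b c i j := by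
      intro f
      refine Finset.sum_congr rfl fun b _ => ?_
      rw [Finset.sum_comm]
      conv_rhs => rw [Finset.sum_comm]
      exact Finset.sum_congr rfl fun i _ => Finset.sum_comm
    have q1 : ∑ b, ∑ c, ∑ i, ∑ j, γ.met.gi b c * γ.met.gi i j * N b j * (γ.met.g i c * γ.met.g e d)
        = tr * γ.met.g e d := by
      calc _ = ∑ b, ∑ j, N b j * γ.met.g e d * ∑ i, γ.met.gi i j *
            ∑ c, γ.met.gi b c * γ.met.g c i := by
            rw [re]
            simp only [Finset.mul_sum]
            exact Finset.sum_congr rfl fun _ _ => Finset.sum_congr rfl fun _ _ =>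
              Finset.sum_congr rfl fun i _ => Finset.sum_congr rfl fun c _ => by
                rw [hm.symm_apply i c]; ring
        _ = _ := by
            simp only [hgg, mul_ite, mul_one, mul_zero, Finset.sum_ite_eq, Finset.mem_univ, if_true,
              htr, Finset.sum_mul]
            exact Finset.sum_congr rfl fun _ _ => Finset.sum_congr rfl fun _ _ => by ring
    have q2 : ∑ b, ∑ c, ∑ i, ∑ j, γ.met.gi b c * γ.met.gi i j * N b j * (γ.met.g i d * γ.met.g e c)
        = N e d := by
      calc _ = ∑ b, ∑ j, N b j * (∑ i, γ.met.gi j i * γ.met.g i d) *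
            ∑ c, γ.met.gi b c * γ.met.g c e := by
            rw [re]
            simp only [Finset.mul_sum, Finset.sum_mul]
            refine Finset.sum_congr rfl fun _ _ => Finset.sum_congr rfl fun j _ => ?_
            rw [Finset.sum_comm]
            exact Finset.sum_congr rfl fun c _ => Finset.sum_congr rfl fun i _ => by
                rw [hm.symm_apply e c, hm.inv_symm_apply i j]; ring
        _ = _ := by simp [hgg]
    rw [← q1, ← q2]
    simp only [MetricData.interior, MetricData.sdG, MetricData.bigG, Finset.mul_sum, mul_smul_comm,
      mul_sub, ← Finset.smul_sum, Finset.sum_sub_distrib, mul_assoc]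
  -- This contraction contains the Ricci tensor.
  have r1 : ∀ e d, ∑ b, ∑ c, γ.met.gi b c * ∑ n, γ.curv b e n c * Y n d = 0 := by
    intro e d
    calc _ = ∑ n, ∑ p, γ.met.gi n p * Y n d * ∑ b, ∑ c, γ.met.gi b c * γ.riem p c b e := by
          simp only [curv_eq h.leviCivita, Finset.mul_sum, Finset.sum_mul]
          rw [MetricData.sum_comm_pairs]
          exact Finset.sum_congr rfl fun _ _ => Finset.sum_congr rfl fun _ _ =>
            Finset.sum_congr rfl fun _ _ => Finset.sum_congr rfl fun _ _ => by ring
      _ = 0 := by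
          refine Finset.sum_eq_zero fun n _ => Finset.sum_eq_zero fun p _ => ?_
          have : ∑ b, ∑ c, γ.met.gi b c * γ.riem p c b e
              = -∑ c, ∑ b, γ.met.gi c b * γ.riem c p b e := by
            rw [Finset.sum_comm, ← Finset.sum_neg_distrib]
            refine Finset.sum_congr rfl fun c _ => ?_
            rw [← Finset.sum_neg_distrib]
            exact Finset.sum_congr rfl fun b _ => by
              rw [hm.inv_symm_apply b c, hW.antisymm p c]; ring
          rw [this, hW.traceless, neg_zero, mul_zero]
  -- Antisymmetry of Y and pair symmetry of Riem make the remaining curvature term antisymmetric in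
  -- e, d.
  have r2 : ∀ e d, ∑ b, ∑ c, γ.met.gi b c * ∑ n, γ.curv b e n d * Y c n
      = -∑ b, ∑ c, γ.met.gi b c * ∑ n, γ.curv b d n e * Y c n := by
    intro e d
    simp only [curv_eq h.leviCivita, Finset.mul_sum, Finset.sum_mul]
    have re : ∀ f : Fin 4 → Fin 4 → Fin 4 → Fin 4 → A,
        ∑ b, ∑ c, ∑ n, ∑ p, f b c n p = ∑ p, ∑ n, ∑ c, ∑ b, f b c n p := by
      intro f
      rw [MetricData.sum_comm_pairs, Finset.sum_comm]
      exact Finset.sum_congr rfl fun _ _ => Finset.sum_congr rfl fun _ _ => Finset.sum_comm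
    rw [re]
    simp only [← Finset.sum_neg_distrib]
    exact Finset.sum_congr rfl fun b _ => Finset.sum_congr rfl fun c _ =>
      Finset.sum_congr rfl fun n _ => Finset.sum_congr rfl fun p _ => by
        rw [hYa c n, hW.pair_symm p e b d, hm.inv_symm_apply b c, hm.inv_symm_apply n p]; ring
  have key : ∀ e d, (1 / 2 : ℂ) • (tr * γ.met.g e d - N e d - Complex.I •
        ∑ b, ∑ c, ∑ i, ∑ j, γ.met.gi b c * γ.met.gi i j * N b j * γ.met.eta i e c d)
      + (3 / 2 : ℂ) • N e d = -∑ b, ∑ c, γ.met.gi b c * ∑ n, γ.curv b e n d * Y c n := by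
    intro e d
    have k := fun b c => congrArg (fun x => γ.met.gi b c * x)
      (commutator_nab2 h.leviCivita Y b e c d)
    simp only [hY, h.cov3_nab2_smul ht] at k
    have k2 := Finset.sum_congr (rfl : (Finset.univ : Finset (Fin 4)) = Finset.univ)
      (fun b _ => Finset.sum_congr (rfl : (Finset.univ : Finset (Fin 4)) = Finset.univ)
        (fun c _ => k b c))
    simp only [mul_sub, mul_neg, Finset.sum_sub_distrib, Finset.sum_neg_distrib] at k2
    rw [l1, l2, r1, neg_smul, sub_neg_eq_add] at k2
    rw [k2, neg_zero, zero_sub]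
  -- Symmetrization removes the volume and curvature terms; the coefficient of N is -1/2 + 3/2 = 1.
  have sym : ∀ e d, tr * γ.met.g e d + (N e d + N d e) = 0 := by
    intro e d
    have k1 := key e d
    have k2 := key d e
    have he : ∑ b, ∑ c, ∑ i, ∑ j, γ.met.gi b c * γ.met.gi i j * N b j * γ.met.eta i e c d
        = -∑ b, ∑ c, ∑ i, ∑ j, γ.met.gi b c * γ.met.gi i j * N b j * γ.met.eta i d c e := by
      simp only [← Finset.sum_neg_distrib]
      exact Finset.sum_congr rfl fun b _ => Finset.sum_congr rfl fun c _ =>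
        Finset.sum_congr rfl fun n _ => Finset.sum_congr rfl fun p _ => by
          simp only [MetricData.eta]
          rw [eps_swap_last _ e, eps_swap_mid _ e, eps_swap_last _ d]
          push_cast; ring
    rw [r2 e d, neg_neg, he] at k1
    rw [hm.symm_apply d e] at k2
    have k3 := congrArg₂ (· + ·) k1 k2
    simp only [add_neg_cancel] at k3
    rw [← k3]
    module
  -- The trace of the symmetric equation reads (4 + 2) tr = 0.
  have tr0 : tr = 0 := by
    have k : ∑ e, ∑ d, γ.met.gi e d * (tr * γ.met.g e d + (N e d + N d e)) = 0 := by
      simp only [sym, mul_zero, Finset.sum_const_zero]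
    simp only [mul_add, Finset.sum_add_distrib] at k
    have k1 : ∑ e, ∑ d, γ.met.gi e d * (tr * γ.met.g e d) = 4 * tr := by
      calc _ = ∑ e, tr * ∑ d, γ.met.gi e d * γ.met.g d e := by
            simp only [Finset.mul_sum]
            exact Finset.sum_congr rfl fun e _ => Finset.sum_congr rfl fun d _ => by
              rw [hm.symm_apply e d]; ring
        _ = _ := by simp [hgg]
    have k2 : ∑ e, ∑ d, γ.met.gi e d * N d e = tr := by
      rw [Finset.sum_comm]
      exact Finset.sum_congr rfl fun e _ => Finset.sum_congr rfl fun d _ => by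
        rw [hm.inv_symm_apply d e]
    rw [k1, k2] at k
    have k6 : (6 : ℂ) • tr = 0 := by
      rw [← k]; rw [Algebra.smul_def]; simp only [map_ofNat]; ring
    have := congrArg (fun x => (1 / 6 : ℂ) • x) k6
    simpa only [smul_smul, show (1 / 6 * 6 : ℂ) = 1 by norm_num, one_smul, smul_zero] using this
  ext e d
  have := sym e d
  rw [tr0, zero_mul, zero_add] at this
  rw [Matrix.transpose_apply, Matrix.neg_apply]
  linear_combination this

/-- The second covariant derivative of the Killing field `Z`. -/
theorem nab_nab1 (a b c : Fin 4) :
    cov2 (γ.der a) (γ.conn a) (γ.nab1 Z) b c = γ.met.interior Z γ.riem a b c := by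
  have hm := h.leviCivita.isMetric
  set B : Fin 4 → Fin 4 → Fin 4 → A := fun a => cov2 (γ.der a) (γ.conn a) (γ.nab1 Z) with hB
  -- As in the derivation of the Christoffel formula: antisymmetry in the last two indices and the
  -- three commutators determine B, and the first Bianchi identity reduces the curvature terms to
  -- one.
  have anti : ∀ a b c, B a b c = -B a c b := fun a b c =>
    congrFun (congrFun (cov2_antisymm h.nab1_antisymm) c) b
  have comm : ∀ a b c, B a b c - B b a c = -γ.met.interior Z γ.riem c a b := by
    intro c d b
    rw [hB]
    simp only
    rw [commutator_nab1 h.leviCivita]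
    simp only [MetricData.interior, curv_eq h.leviCivita, Finset.sum_mul]
    rw [Finset.sum_comm]
    congr 1
    exact Finset.sum_congr rfl fun p _ => Finset.sum_congr rfl fun n _ => by
      rw [hm.inv_symm_apply n p]; ring
  have cyc : γ.met.interior Z γ.riem a b c + γ.met.interior Z γ.riem b c a
      + γ.met.interior Z γ.riem c a b = 0 := by
    simp only [MetricData.interior, ← Finset.sum_add_distrib, ← mul_add, riem_bianchi h.leviCivita,
      mul_zero, Finset.sum_const_zero]
  change B a b c = _
  refine half_smul_cancel ?_
  rw [two_smul, two_smul]
  linear_combination comm a b c + comm c a b - comm b c a + anti a b c + anti b c a - anti c b a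
    - cyc


end IsTypeD
end Geometry
end

section
set_option linter.unusedSectionVars false
set_option linter.unusedSimpArgs false

/-! ### Universal polynomials -/

/-- Polynomials in the curvature variables. -/
abbrev Pol : Type := MvPolynomial Var ℂ

namespace Pol

open MvPolynomial

/-- The metric variables. -/
def met : MetricData Pol where
  g := Matrix.of fun a b => X (.metric a b)
  gi := Matrix.of fun a b => X (.invMetric a b)
  -- One component suffices: `MetricData.eta` rebuilds the others with `eps`.
  vol := X (.volume 0 1 2 3)

/-- The metric variables, with the opposite orientation. -/
def metConj : MetricData Pol := { met with vol := -met.vol }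

/-- The canonical bivector. -/
def biv : M4 Pol := Matrix.of fun a b => X (.bivector a b)

/-- The conjugate canonical bivector. -/
def bivConj : M4 Pol := Matrix.of fun a b => X (.bivectorConj a b)

/-- The Killing vector. -/
def kil : Fin 4 → Pol := fun a => X (.killing a)

/-- The conjugate Killing vector. -/
def kilConj : Fin 4 → Pol := fun a => X (.killingConj a)

/-- The self-dual Weyl tensor of type D. -/
def typeDWeyl {A : Type*} [CommRing A] [Algebra ℂ A] (m : MetricData A) (s : A) (U : M4 A) :
    Quad A :=
  fun a b c d => s ^ 3 * (3 * (U a b * U c d) + m.sdG a b c d)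

/-- The Riemann tensor of a type D vacuum solution. -/
def riem : Quad Pol := fun a b c d =>
  -- 𝒲 plus its conjugate; the conjugate of 𝒢 = ½(G - iη) is 𝒢 for the reversed orientation.
  typeDWeyl met (X .cubeRoot) biv a b c d + typeDWeyl metConj (X .cubeRootConj) bivConj a b c d

/-- The matrix units, generating changes of frame. -/
def unitMat (m b : Fin 4) : M4 Pol := Matrix.single m b 1

/-- Infinitesimal changes of frame. -/
def frameDer (m b : Fin 4) : Derivation ℂ Pol Pol := mkDerivation ℂ fun v => match v with
  | .metric i j => ∑ n, unitMat m b n i * X (.metric n j) + ∑ n, unitMat m b n j * X (.metric i n)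
  | .invMetric i j =>
      -∑ n, unitMat m b i n * X (.invMetric n j) - ∑ n, unitMat m b j n * X (.invMetric i n)
  | .volume i j k l => (unitMat m b).trace * X (.volume i j k l)
  | .cubeRoot => 0
  | .bivector i j =>
      ∑ n, unitMat m b n i * X (.bivector n j) + ∑ n, unitMat m b n j * X (.bivector i n)
  | .killing i => ∑ n, unitMat m b n i * X (.killing n)
  | .dKilling i j =>
      ∑ n, unitMat m b n i * X (.dKilling n j) + ∑ n, unitMat m b n j * X (.dKilling i n)
  | .cubeRootConj => 0
  | .bivectorConj i j =>
      ∑ n, unitMat m b n i * X (.bivectorConj n j) + ∑ n, unitMat m b n j * X (.bivectorConj i n)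
  | .killingConj i => ∑ n, unitMat m b n i * X (.killingConj n)
  | .dKillingConj i j =>
      ∑ n, unitMat m b n i * X (.dKillingConj n j) + ∑ n, unitMat m b n j * X (.dKillingConj i n)

/-- The covariant derivatives of the variables. -/
def covVar (a : Fin 4) : Var → Pol
  | .metric _ _ => 0
  | .invMetric _ _ => 0
  | .volume _ _ _ _ => 0
  -- The rules transcribe `der_eq`, `nab2_eq`, the name of ∇Z as a variable, and `nab_nab1`; the
  -- remaining ones are their conjugates.
  | .cubeRoot => X .cubeRoot ^ 2 * met.interior₂ kil biv a
  | .bivector i j => X .cubeRoot * met.interior kil (met.bivectorQuad biv) a i j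
  | .killing i => X (.dKilling a i)
  | .dKilling i j => met.interior kil riem a i j
  | .cubeRootConj => X .cubeRootConj ^ 2 * met.interior₂ kilConj bivConj a
  | .bivectorConj i j =>
      X .cubeRootConj * met.interior kilConj (metConj.bivectorQuad bivConj) a i j
  | .killingConj i => X (.dKillingConj a i)
  | .dKillingConj i j => met.interior kilConj riem a i j

/-- The covariant derivative as a derivation on polynomials. -/
def covDer (a : Fin 4) : Derivation ℂ Pol Pol := mkDerivation ℂ (covVar a)

/-- Read `frameDer m b` as a derivation and the matrix unit as its connection: zero covariant
derivative then says that components transform as a tensor under infinitesimal changes of frame. The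
calculus of parallel tensors thereby proves equivariance. -/
theorem isParallel (m b : Fin 4) : IsParallel (frameDer m b) (unitMat m b) met where
  metric := by
    ext1 i j
    simp only [met, Matrix.map_apply, Matrix.of_apply, frameDer, mkDerivation_X, Matrix.add_apply,
      Matrix.mul_apply, Matrix.transpose_apply, mul_comm (X _)]
  inv := by
    ext1 i j
    simp only [met, Matrix.map_apply, Matrix.of_apply, frameDer, mkDerivation_X, Matrix.sub_apply,
      Matrix.mul_apply, Matrix.transpose_apply, mul_comm (X _), Matrix.neg_apply]
  vol := by simp only [met, frameDer, mkDerivation_X]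

theorem isParallel_conj (m b : Fin 4) : IsParallel (frameDer m b) (unitMat m b) metConj where
  metric := (isParallel m b).metric
  inv := (isParallel m b).inv
  vol := by
    have := (isParallel m b).vol
    simp only [metConj, map_neg, this, mul_neg]

theorem cov2_biv (m b : Fin 4) : cov2 (frameDer m b) (unitMat m b) biv = 0 := by
  ext1 i j
  simp only [cov2, biv, Matrix.of_apply, frameDer, mkDerivation_X, Matrix.zero_apply]
  ring

theorem cov2_bivConj (m b : Fin 4) : cov2 (frameDer m b) (unitMat m b) bivConj = 0 := by
  ext1 i j
  simp only [cov2, bivConj, Matrix.of_apply, frameDer, mkDerivation_X, Matrix.zero_apply]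
  ring

theorem cov1_kil (m b : Fin 4) : cov1 (frameDer m b) (unitMat m b) kil = 0 := by
  funext i
  simp only [cov1, kil, frameDer, mkDerivation_X, Pi.zero_apply, sub_self]

theorem cov1_kilConj (m b : Fin 4) : cov1 (frameDer m b) (unitMat m b) kilConj = 0 := by
  funext i
  simp only [cov1, kilConj, frameDer, mkDerivation_X, Pi.zero_apply, sub_self]

end Pol

/-! ### Frame equivariance of the structure equations and of the derivatives of Riem -/

section
variable {A : Type*} [CommRing A] [Algebra ℂ A] {d : Derivation ℂ A A} {M : M4 A}
  {m : MetricData A}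

theorem cov4_bivectorQuad (h : IsParallel d M m) (U : M4 A) (a b c e : Fin 4) :
    cov4 d M (m.bivectorQuad U) a b c e
      = cov2 d M U a b * U c e + U a b * cov2 d M U c e := by
  have : m.bivectorQuad U = fun a b c e => U a b * U c e + m.sdG a b c e := rfl
  rw [this, cov4_add, cov4_outer, h.cov4_sdG, add_zero]

theorem cov4_typeDWeyl (h : IsParallel d M m) (s : A) (U : M4 A) (a b c e : Fin 4) :
    cov4 d M (Pol.typeDWeyl m s U) a b c e
      = d (s ^ 3) * (3 * (U a b * U c e) + m.sdG a b c e)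
        + s ^ 3 * (3 * (cov2 d M U a b * U c e + U a b * cov2 d M U c e)) := by
  have three : d 3 = 0 := d.map_natCast 3
  have : Pol.typeDWeyl m s U = fun a b c e => s ^ 3 * (3 * (U a b * U c e) + m.sdG a b c e) := rfl
  rw [this, cov4_smul, cov4_add, cov4_smul, cov4_outer, h.cov4_sdG, three]
  ring

end

namespace Pol
open MvPolynomial

theorem cov4_riem (m b : Fin 4) (i j k l : Fin 4) :
    cov4 (frameDer m b) (unitMat m b) riem i j k l = 0 := by
  have e1 : frameDer m b (X .cubeRoot) = 0 := by simp only [frameDer, mkDerivation_X]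
  have e2 : frameDer m b (X .cubeRootConj) = 0 := by simp only [frameDer, mkDerivation_X]
  have : riem = fun a b c d => typeDWeyl met (X .cubeRoot) biv a b c d
    + typeDWeyl metConj (X .cubeRootConj) bivConj a b c d := rfl
  rw [this, cov4_add, cov4_typeDWeyl (isParallel m b), cov4_typeDWeyl (isParallel_conj m b),
    cov2_biv, cov2_bivConj, Derivation.leibniz_pow, Derivation.leibniz_pow, e1, e2]
  simp

theorem interior_zero (m : MetricData Pol) (V : Quad Pol) (a b c : Fin 4) :
    m.interior 0 V a b c = 0 := by simp [MetricData.interior]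

theorem frameDer_interior {Z : Fin 4 → Pol} {V : Quad Pol} (m b : Fin 4)
    (hZ : cov1 (frameDer m b) (unitMat m b) Z = 0)
    (hV : ∀ i j k l, cov4 (frameDer m b) (unitMat m b) V i j k l = 0) (a i j : Fin 4) :
    cov3 (frameDer m b) (unitMat m b) (met.interior Z V) a i j = 0 := by
  rw [(isParallel m b).cov3_interior, hZ, interior_zero, zero_add, MetricData.interior]
  simp [hV]

theorem frameDer_interior₂ {Z : Fin 4 → Pol} {F : M4 Pol} (m b : Fin 4)
    (hZ : cov1 (frameDer m b) (unitMat m b) Z = 0)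
    (hF : cov2 (frameDer m b) (unitMat m b) F = 0) (a : Fin 4) :
    cov1 (frameDer m b) (unitMat m b) (met.interior₂ Z F) a = 0 := by
  rw [(isParallel m b).cov1_interior₂, hZ, hF]
  simp [MetricData.interior₂]

theorem covDer_unitMat (a m b i j : Fin 4) : covDer a (unitMat m b i j) = 0 := by
  rw [unitMat, Matrix.single_apply]
  split_ifs <;> simp

theorem covDer_mul (a m b i j : Fin 4) (x : Pol) :
    covDer a (unitMat m b i j * x) = unitMat m b i j * covDer a x := by
  rw [Derivation.leibniz, covDer_unitMat, smul_zero, add_zero, smul_eq_mul]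

theorem covDer_X (a : Fin 4) (v : Var) : covDer a (X v) = covVar a v := mkDerivation_X ..

/-- Covariant differentiation is equivariant under changes of frame. -/
theorem frameDer_covDer_X (m b a : Fin 4) (v : Var) :
    frameDer m b (covDer a (X v)) - covDer a (frameDer m b (X v))
      - ∑ n, unitMat m b n a * covDer n (X v) = 0 := by
  have e1 : frameDer m b (X .cubeRoot) = 0 := by simp only [frameDer, mkDerivation_X]
  have e2 : frameDer m b (X .cubeRootConj) = 0 := by simp only [frameDer, mkDerivation_X]
  cases v with
  | metric i j =>
    simp [frameDer, mkDerivation_X, covDer_X, covVar, covDer_mul, covDer_unitMat]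
  | invMetric i j =>
    simp [frameDer, mkDerivation_X, covDer_X, covVar, covDer_mul, covDer_unitMat]
  | volume i j k l =>
    simp [frameDer, mkDerivation_X, covDer_X, covVar, covDer_mul, covDer_unitMat, Matrix.trace, Finset.sum_mul]
  | cubeRoot =>
    have k := frameDer_interior₂ m b (cov1_kil m b) (cov2_biv m b) a
    rw [cov1, sub_eq_zero] at k
    rw [covDer_X, e1, map_zero, covVar, Derivation.leibniz, Derivation.leibniz_pow, e1, k]
    simp only [covDer_X, covVar, smul_eq_mul, smul_zero, mul_zero, add_zero, sub_zero,
      Finset.mul_sum]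
    rw [← Finset.sum_sub_distrib]
    exact Finset.sum_eq_zero fun _ _ => by ring
  | bivector i j =>
    have k := frameDer_interior m b (V := met.bivectorQuad biv) (cov1_kil m b) (fun i j k l => by
      rw [cov4_bivectorQuad (isParallel m b), cov2_biv]; simp) a i j
    rw [cov3] at k
    rw [covDer_X, covVar, Derivation.leibniz, e1]
    simp only [frameDer, mkDerivation_X, map_add, map_sum, covDer_mul, covDer_X, covVar]
    simp only [frameDer] at k
    simp only [mul_left_comm _ (X Var.cubeRoot), ← Finset.mul_sum, smul_eq_mul]
    linear_combination X Var.cubeRoot * k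
  | killing i =>
    simp only [frameDer, mkDerivation_X, map_add, map_sum, covDer_mul, covDer_X, covVar]
    ring
  | dKilling i j =>
    have k := frameDer_interior m b (cov1_kil m b) (cov4_riem m b) a i j
    rw [cov3] at k
    simp only [frameDer, mkDerivation_X, map_add, map_sum, covDer_mul, covDer_X, covVar] at k ⊢
    linear_combination k
  | cubeRootConj =>
    have k := frameDer_interior₂ m b (cov1_kilConj m b) (cov2_bivConj m b) a
    rw [cov1, sub_eq_zero] at k
    rw [covDer_X, e2, map_zero, covVar, Derivation.leibniz, Derivation.leibniz_pow, e2, k]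
    simp only [covDer_X, covVar, smul_eq_mul, smul_zero, mul_zero, add_zero, sub_zero,
      Finset.mul_sum]
    rw [← Finset.sum_sub_distrib]
    exact Finset.sum_eq_zero fun _ _ => by ring
  | bivectorConj i j =>
    have k := frameDer_interior m b (V := metConj.bivectorQuad bivConj) (cov1_kilConj m b)
      (fun i j k l => by
        rw [cov4_bivectorQuad (isParallel_conj m b), cov2_bivConj]; simp) a i j
    rw [cov3] at k
    rw [covDer_X, covVar, Derivation.leibniz, e2]
    simp only [frameDer, mkDerivation_X, map_add, map_sum, covDer_mul, covDer_X, covVar]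
    simp only [frameDer] at k
    simp only [mul_left_comm _ (X Var.cubeRootConj), ← Finset.mul_sum, smul_eq_mul]
    linear_combination X Var.cubeRootConj * k
  | killingConj i =>
    simp only [frameDer, mkDerivation_X, map_add, map_sum, covDer_mul, covDer_X, covVar]
    ring
  | dKillingConj i j =>
    have k := frameDer_interior m b (cov1_kilConj m b) (cov4_riem m b) a i j
    rw [cov3] at k
    simp only [frameDer, mkDerivation_X, map_add, map_sum, covDer_mul, covDer_X, covVar] at k ⊢
    linear_combination k

/-- A commutator of derivations is a derivation, so it is enough to compare on the variables. -/
theorem frameDer_covDer (m b a : Fin 4) (P : Pol) :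
    frameDer m b (covDer a P) = covDer a (frameDer m b P)
      + ∑ n, unitMat m b n a * covDer n P := by
  have k : ⁅frameDer m b, covDer a⁆ = ∑ n, unitMat m b n a • covDer n := by
    refine MvPolynomial.derivation_ext fun v => ?_
    have := frameDer_covDer_X m b a v
    rw [Derivation.commutator_apply]
    rw [sub_eq_zero] at this
    rw [this]
    simp only [Fin.sum_univ_four, Derivation.add_apply, Derivation.smul_apply, smul_eq_mul]
  have k2 := congrArg (fun δ => δ P) k
  simp only [Derivation.commutator_apply] at k2
  rw [sub_eq_iff_eq_add'.mp k2]
  simp only [Fin.sum_univ_four, Derivation.add_apply, Derivation.smul_apply, smul_eq_mul]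

/-- Equivariance of a family of polynomials under changes of frame: they are the components of a
covariant tensor. -/
def IsTensorial {k : ℕ} (P : (Fin k → Fin 4) → Pol) : Prop :=
  ∀ m b i, frameDer m b (P i) = ∑ r, ∑ n, unitMat m b n (i r) * P (Function.update i r n)

/-- The covariant derivative of a family of polynomials. -/
def nabla {k : ℕ} (P : (Fin k → Fin 4) → Pol) (i : Fin (k + 1) → Fin 4) : Pol :=
  covDer (i 0) (P (Fin.tail i))

/-- The commutator term of `frameDer_covDer` is precisely the frame action on the new index. -/
theorem IsTensorial.nabla {k : ℕ} {P : (Fin k → Fin 4) → Pol} (hP : IsTensorial P) :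
    IsTensorial (Pol.nabla P) := by
  intro m b i
  have h0 : ∀ (r : Fin k) n, Function.update i r.succ n 0 = i 0 := fun r n =>
    Function.update_of_ne (Fin.succ_ne_zero r).symm _ _
  rw [Pol.nabla, frameDer_covDer, hP, Fin.sum_univ_succ (n := k), add_comm]
  simp only [map_sum, covDer_mul, Pol.nabla, Function.update_self, Fin.tail_update_zero,
    Fin.tail_update_succ, h0]
  rfl

/-- Iterated covariant derivatives of the Riemann tensor. -/
def nablaRiem : (n : ℕ) → (Fin (4 + n) → Fin 4) → Pol
  | 0 => fun i => riem (i 0) (i 1) (i 2) (i 3)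
  | n + 1 => nabla (nablaRiem n)

theorem isTensorial_nablaRiem : ∀ n, IsTensorial (nablaRiem n)
  | 0 => by
    intro m b i
    have k := cov4_riem m b (i 0) (i 1) (i 2) (i 3)
    rw [cov4] at k
    simp only [nablaRiem]
    rw [Fin.sum_univ_four]
    simp [Function.update]
    linear_combination k
  | n + 1 => (isTensorial_nablaRiem n).nabla

end Pol
end

section
set_option linter.unusedSectionVars false
set_option linter.unusedSimpArgs false

variable {A : Type*} [CommRing A] [Algebra ℂ A]

/-! ### Evaluation of the universal polynomials -/

namespace Geometry

/-- The covariant derivative of a tensor of rank `k`. -/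
def nabla (γ : Geometry A) {k : ℕ} (T : (Fin k → Fin 4) → A) (i : Fin (k + 1) → Fin 4) : A :=
  γ.der (i 0) (T (Fin.tail i))
    - ∑ r : Fin k, ∑ m, γ.conn (i 0) m (Fin.tail i r) * T (Function.update (Fin.tail i) r m)

/-- Iterated covariant derivatives of a tensor. -/
def nablaIter (γ : Geometry A) {k : ℕ} (T : (Fin k → Fin 4) → A) :
    (n : ℕ) → (Fin (k + n) → Fin 4) → A
  | 0 => T
  | n + 1 => γ.nabla (nablaIter γ T n)

/-- A complex conjugation for which the geometry is real. -/
structure IsReal (γ : Geometry A) (conj : A →+* A) : Prop where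
  conj_algebraMap : ∀ c : ℂ, conj (algebraMap ℂ A c) = algebraMap ℂ A (star c)
  der_conj : ∀ a x, γ.der a (conj x) = conj (γ.der a x)
  metric : ∀ a b, conj (γ.met.g a b) = γ.met.g a b
  inv : ∀ a b, conj (γ.met.gi a b) = γ.met.gi a b
  vol : conj γ.met.vol = γ.met.vol
  conn : ∀ c a b, conj (γ.conn c a b) = γ.conn c a b

/-- The values of the curvature variables. -/
def varVal (γ : Geometry A) (conj : A →+* A) (s : A) (U : M4 A) (Z : Fin 4 → A) : Var → A
  | .metric a b => γ.met.g a b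
  | .invMetric a b => γ.met.gi a b
  | .volume a b c d => γ.met.eta a b c d
  | .cubeRoot => s
  | .bivector a b => U a b
  | .killing a => Z a
  | .dKilling a b => γ.nab1 Z a b
  | .cubeRootConj => conj s
  | .bivectorConj a b => conj (U a b)
  | .killingConj a => conj (Z a)
  | .dKillingConj a b => conj (γ.nab1 Z a b)

variable {γ : Geometry A} {conj : A →+* A} (hr : γ.IsReal conj)
include hr

namespace IsReal

theorem conj_smul (c : ℂ) (x : A) : conj (c • x) = star c • conj x := by
  rw [Algebra.smul_def, map_mul, hr.conj_algebraMap, ← Algebra.smul_def]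

theorem conj_half_smul (x : A) : conj ((1 / 2 : ℂ) • x) = (1 / 2 : ℂ) • conj x := by
  rw [hr.conj_smul]; simp

theorem conj_riem (a b c d : Fin 4) : conj (γ.riem a b c d) = γ.riem a b c d := by
  simp only [riem, curv, Matrix.mul_apply, Matrix.add_apply, Matrix.sub_apply, Matrix.map_apply,
    map_sum, map_mul, map_add, map_sub, hr.metric, ← hr.der_conj, hr.conn]

theorem conj_hodge {F : M4 A} (hF : ∀ a b, conj (F a b) = F a b) (a b : Fin 4) :
    conj (γ.met.hodge F a b) = γ.met.hodge F a b := by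
  simp only [MetricData.hodge, dual, MetricData.up, Matrix.smul_apply, Matrix.of_apply, smul_eq_mul,
    Matrix.mul_apply, Matrix.transpose_apply, map_mul, hr.vol, hr.conj_half_smul, map_sum, hr.inv, hF,
    map_intCast]

theorem conj_sdG (a b c d : Fin 4) : conj (γ.met.sdG a b c d)
    = (1 / 2 : ℂ) • (γ.met.bigG a b c d + Complex.I • γ.met.eta a b c d) := by
  simp only [MetricData.sdG, hr.conj_half_smul, map_sub, hr.conj_smul, MetricData.bigG,
    MetricData.eta, map_mul, hr.metric, hr.vol, map_intCast]
  simp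

/-- The Riemann tensor and its dual are real, so the dual parts cancel. -/
theorem sdPart_add_conj (a b c d : Fin 4) :
    γ.met.sdPart γ.riem a b c d + conj (γ.met.sdPart γ.riem a b c d) = γ.riem a b c d := by
  have k : conj (γ.met.hodge (slice γ.riem c d) a b) = γ.met.hodge (slice γ.riem c d) a b :=
    hr.conj_hodge (fun a b => hr.conj_riem a b c d) a b
  simp only [MetricData.sdPart, hr.conj_half_smul, map_sub, hr.conj_smul, hr.conj_riem, k]
  simp only [Complex.star_def, Complex.conj_I, neg_smul, sub_neg_eq_add]
  module

end IsReal

namespace IsTypeD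

variable {s : A} {U : M4 A} {Z : Fin 4 → A} (h : γ.IsTypeD s U Z)
include h

theorem riem_eq (a b c d : Fin 4) : γ.riem a b c d
    = Pol.typeDWeyl γ.met s U a b c d + conj (Pol.typeDWeyl γ.met s U a b c d) := by
  have := hr.sdPart_add_conj a b c d
  rw [h.weyl] at this
  exact this.symm

omit h

/-- Evaluation of polynomials in the curvature variables. -/
abbrev ev (γ : Geometry A) (conj : A →+* A) (s : A) (U : M4 A) (Z : Fin 4 → A) : Pol →ₐ[ℂ] A :=
  MvPolynomial.aeval (γ.varVal conj s U Z)

omit hr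

theorem ev_sdG (a b c d : Fin 4) :
    ev γ conj s U Z (Pol.met.sdG a b c d) = γ.met.sdG a b c d := by
  simp [MetricData.sdG, MetricData.bigG, Pol.met, MetricData.eta, varVal, eps_values]

theorem ev_interior (X : Fin 4 → Pol) (V : Quad Pol) (a b c : Fin 4) :
    ev γ conj s U Z (Pol.met.interior X V a b c)
      = γ.met.interior (fun i => ev γ conj s U Z (X i))
        (fun i j k l => ev γ conj s U Z (V i j k l)) a b c := by
  simp [MetricData.interior, Pol.met, varVal]

theorem ev_interior₂ (X : Fin 4 → Pol) (F : M4 Pol) (a : Fin 4) :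
    ev γ conj s U Z (Pol.met.interior₂ X F a)
      = γ.met.interior₂ (fun i => ev γ conj s U Z (X i)) (F.map (ev γ conj s U Z)) a := by
  simp [MetricData.interior₂, Pol.met, varVal]

theorem ev_kil : (fun i => ev γ conj s U Z (Pol.kil i)) = Z := by
  funext i; simp [Pol.kil, varVal]

theorem ev_kilConj : (fun i => ev γ conj s U Z (Pol.kilConj i)) = fun i => conj (Z i) := by
  funext i; simp [Pol.kilConj, varVal]

theorem ev_biv : Pol.biv.map (ev γ conj s U Z) = U := by
  ext i j; simp [Pol.biv, varVal]

theorem ev_bivConj : Pol.bivConj.map (ev γ conj s U Z) = U.map conj := by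
  ext i j; simp [Pol.bivConj, varVal]

theorem ev_bivectorQuad :
    (fun a b c d => ev γ conj s U Z (Pol.met.bivectorQuad Pol.biv a b c d))
      = γ.met.bivectorQuad U := by
  funext a b c d
  simp only [MetricData.bivectorQuad, map_add, map_mul, ev_sdG]
  simp [Pol.biv, varVal]

include hr

theorem ev_sdG_conj (a b c d : Fin 4) :
    ev γ conj s U Z (Pol.metConj.sdG a b c d) = conj (γ.met.sdG a b c d) := by
  rw [hr.conj_sdG]
  simp [MetricData.sdG, MetricData.bigG, Pol.met, Pol.metConj, MetricData.eta, varVal, eps_values]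

theorem ev_bivectorQuad_conj :
    (fun a b c d => ev γ conj s U Z (Pol.metConj.bivectorQuad Pol.bivConj a b c d))
      = fun a b c d => conj (γ.met.bivectorQuad U a b c d) := by
  funext a b c d
  simp only [MetricData.bivectorQuad, map_add, map_mul, ev_sdG_conj hr]
  simp [Pol.bivConj, varVal]

include h

theorem ev_riem (a b c d : Fin 4) :
    ev γ conj s U Z (Pol.riem a b c d) = γ.riem a b c d := by
  rw [riem_eq hr h, Pol.riem, map_add]
  simp only [Pol.typeDWeyl, map_mul, map_add, map_pow, ev_sdG, ev_sdG_conj hr, Pol.biv, Pol.bivConj,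
    Matrix.of_apply, MvPolynomial.aeval_X, varVal, map_ofNat]

theorem conj_interior (X : Fin 4 → A) (V : Quad A) (a b c : Fin 4) :
    conj (γ.met.interior X V a b c)
      = γ.met.interior (fun i => conj (X i)) (fun i j k l => conj (V i j k l)) a b c := by
  simp only [MetricData.interior, map_sum, map_mul, hr.inv]

theorem conj_interior₂ (X : Fin 4 → A) (F : M4 A) (a : Fin 4) :
    conj (γ.met.interior₂ X F a) = γ.met.interior₂ (fun i => conj (X i)) (F.map conj) a := by
  simp only [MetricData.interior₂, map_sum, map_mul, hr.inv, Matrix.map_apply]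

/-- For each variable, ∂ = ∇ + connection terms: the structure equations identify the first with
`covDer`, and the second is the frame action weighted by Γ. Conjugate variables follow because the
connection is real. -/
theorem der_ev_X (c : Fin 4) (v : Var) : γ.der c (ev γ conj s U Z (MvPolynomial.X v))
    = ev γ conj s U Z (Pol.covDer c (MvPolynomial.X v))
      + ∑ m, ∑ b, γ.conn c m b * ev γ conj s U Z (Pol.frameDer m b (MvPolynomial.X v)) := by
  have hm := h.leviCivita.isMetric
  have hp := h.leviCivita.parallel c
  have unit : ∀ m b n i, ev γ conj s U Z (Pol.unitMat m b n i)
      = if m = n ∧ b = i then 1 else 0 := by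
    intro m b n i
    rw [Pol.unitMat, Matrix.single_apply]
    split_ifs <;> simp
  have k1 : ∀ i (x : Fin 4 → A), ∑ m, ∑ b, γ.conn c m b *
      ∑ n, ev γ conj s U Z (Pol.unitMat m b n i) * x n = ∑ n, γ.conn c n i * x n := by
    intro i x
    simp [unit, ite_and]
  have k2 : ∀ i (x : Fin 4 → A), ∑ m, ∑ b, γ.conn c m b *
      ∑ n, ev γ conj s U Z (Pol.unitMat m b i n) * x n = ∑ n, γ.conn c i n * x n := by
    intro i x
    simp [unit, ite_and]
  have k3 : ∀ x : A, ∑ m, ∑ b, γ.conn c m b *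
      ((∑ n, ev γ conj s U Z (Pol.unitMat m b n n)) * x) = (γ.conn c).trace * x := by
    intro x
    simp [unit, ite_and, Matrix.trace, Finset.sum_mul]
  have ds : γ.der c s = s ^ 2 * γ.met.interior₂ Z U c := h.der_eq c
  have dU : ∀ i j, γ.der c (U i j) = s * γ.met.interior Z (γ.met.bivectorQuad U) c i j
      + (∑ n, γ.conn c n i * U n j + ∑ n, γ.conn c n j * U i n) := by
    intro i j
    rw [← h.nab2_eq c i j]
    simp only [nab2, cov2, Matrix.of_apply]
    ring
  have dZ : ∀ i, γ.der c (Z i) = γ.nab1 Z c i + ∑ n, γ.conn c n i * Z n := by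
    intro i
    simp only [nab1, cov1, Matrix.of_apply]
    ring
  have dN : ∀ i j, γ.der c (γ.nab1 Z i j) = γ.met.interior Z γ.riem c i j
      + (∑ n, γ.conn c n i * γ.nab1 Z n j + ∑ n, γ.conn c n j * γ.nab1 Z i n) := by
    intro i j
    rw [← h.nab_nab1 c i j]
    simp only [cov2, Matrix.of_apply]
    ring
  have eR : (fun i j k l => ev γ conj s U Z (Pol.riem i j k l)) = γ.riem := by
    funext i j k l; exact ev_riem hr h i j k l
  have cR : (fun i j k l => conj (γ.riem i j k l)) = γ.riem := by
    funext i j k l; exact hr.conj_riem i j k l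
  rw [Pol.covDer_X]
  cases v with
  | metric i j =>
    have k := congrFun (congrFun hp.metric i) j
    simp only [Matrix.map_apply, Matrix.add_apply, Matrix.mul_apply, Matrix.transpose_apply] at k
    simp only [Pol.covVar, Pol.frameDer, MvPolynomial.mkDerivation_X, map_add, map_sum, map_mul,
      MvPolynomial.aeval_X, varVal, mul_add, Finset.sum_add_distrib, k1, map_zero, zero_add, k,
      mul_comm (γ.met.g _ _)]
  | invMetric i j =>
    have k := congrFun (congrFun hp.inv i) j
    simp only [Matrix.map_apply, Matrix.sub_apply, Matrix.neg_apply, Matrix.mul_apply,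
      Matrix.transpose_apply] at k
    simp only [Pol.covVar, Pol.frameDer, MvPolynomial.mkDerivation_X, map_sub, map_neg, map_sum,
      map_mul, MvPolynomial.aeval_X, varVal, mul_sub, mul_neg, Finset.sum_sub_distrib,
      Finset.sum_neg_distrib, k2, map_zero, zero_add, k, mul_comm (γ.met.gi _ _)]
  | volume i j k l =>
    simp only [Pol.covVar, Pol.frameDer, MvPolynomial.mkDerivation_X, map_mul, Matrix.trace,
      Matrix.diag, map_sum, MvPolynomial.aeval_X, varVal, k3, map_zero, zero_add, MetricData.eta,
      Derivation.leibniz, Derivation.map_intCast, smul_zero, hp.vol, smul_eq_mul]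
    ring
  | cubeRoot =>
    simp only [Pol.covVar, Pol.frameDer, MvPolynomial.mkDerivation_X, map_zero, map_mul, map_pow,
      MvPolynomial.aeval_X, varVal, mul_zero, Finset.sum_const_zero, add_zero, ds,
      ev_interior₂, ev_kil, ev_biv]
  | bivector i j =>
    simp only [Pol.covVar, Pol.frameDer, MvPolynomial.mkDerivation_X, map_add, map_sum, map_mul,
      MvPolynomial.aeval_X, varVal, mul_add, Finset.sum_add_distrib, k1, dU, ev_interior, ev_kil,
      ev_bivectorQuad]
  | killing i =>
    simp only [Pol.covVar, Pol.frameDer, MvPolynomial.mkDerivation_X, map_sum, map_mul,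
      MvPolynomial.aeval_X, varVal, k1, dZ]
  | dKilling i j =>
    simp only [Pol.covVar, Pol.frameDer, MvPolynomial.mkDerivation_X, map_add, map_sum, map_mul,
      MvPolynomial.aeval_X, varVal, mul_add, Finset.sum_add_distrib, k1, dN, ev_interior, ev_kil, eR]
  | cubeRootConj =>
    simp only [Pol.covVar, Pol.frameDer, MvPolynomial.mkDerivation_X, map_zero, map_mul, map_pow,
      MvPolynomial.aeval_X, varVal, mul_zero, Finset.sum_const_zero, add_zero, hr.der_conj, ds,
      ev_interior₂, ev_kilConj, ev_bivConj, conj_interior₂ hr h]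
  | bivectorConj i j =>
    simp only [Pol.covVar, Pol.frameDer, MvPolynomial.mkDerivation_X, map_add, map_sum, map_mul,
      MvPolynomial.aeval_X, varVal, mul_add, Finset.sum_add_distrib, k1, hr.der_conj, dU, ev_interior,
      ev_kilConj, ev_bivectorQuad_conj hr, conj_interior hr h, hr.conn]
  | killingConj i =>
    simp only [Pol.covVar, Pol.frameDer, MvPolynomial.mkDerivation_X, map_sum, map_mul, map_add,
      MvPolynomial.aeval_X, varVal, k1, hr.der_conj, dZ, hr.conn]
  | dKillingConj i j =>
    simp only [Pol.covVar, Pol.frameDer, MvPolynomial.mkDerivation_X, map_add, map_sum, map_mul,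
      MvPolynomial.aeval_X, varVal, mul_add, Finset.sum_add_distrib, k1, hr.der_conj, dN, ev_interior,
      ev_kilConj, eR, conj_interior hr h, cR, hr.conn]

/-- Both sides obey the Leibniz rule along the evaluation, so `der_ev_X` decides. -/
theorem der_ev (c : Fin 4) (P : Pol) : γ.der c (ev γ conj s U Z P)
    = ev γ conj s U Z (Pol.covDer c P)
      + ∑ m, ∑ b, γ.conn c m b * ev γ conj s U Z (Pol.frameDer m b P) := by
  induction P using MvPolynomial.induction_on with
  | C a => simp [MvPolynomial.derivation_C]
  | add p q hp hq =>
    simp only [map_add, hp, hq, mul_add, Finset.sum_add_distrib]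
    ring
  | mul_X p v hp =>
    have k := der_ev_X hr h c v
    rw [map_mul, Derivation.leibniz, hp, k]
    simp only [Derivation.leibniz, map_add, smul_eq_mul, map_mul, mul_add, Finset.sum_add_distrib,
      Finset.mul_sum]
    have r : ∀ (x : A) (f : Fin 4 → Fin 4 → A), ∑ m, ∑ b, γ.conn c m b * (x * f m b)
        = ∑ m, ∑ b, x * (γ.conn c m b * f m b) := fun x f =>
      Finset.sum_congr rfl fun _ _ => Finset.sum_congr rfl fun _ _ => by ring
    rw [r, r]
    ring

/-- Covariant derivatives of the Riemann tensor are given by the universal polynomials. -/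
theorem ev_nablaRiem : ∀ (n : ℕ) (i : Fin (4 + n) → Fin 4),
    γ.nablaIter (fun i => γ.riem (i 0) (i 1) (i 2) (i 3)) n i
      = ev γ conj s U Z (Pol.nablaRiem n i)
  | 0, i => (ev_riem hr h _ _ _ _).symm
  | n + 1, i => by
    have ih : γ.nablaIter (fun i => γ.riem (i 0) (i 1) (i 2) (i 3)) n
        = fun i => ev γ conj s U Z (Pol.nablaRiem n i) := funext (ev_nablaRiem n)
    change γ.nabla (γ.nablaIter (fun i => γ.riem (i 0) (i 1) (i 2) (i 3)) n) i = _
    rw [ih, nabla, der_ev hr h]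
    have unit : ∀ m b n i, ev γ conj s U Z (Pol.unitMat m b n i)
        = if m = n ∧ b = i then 1 else 0 := by
      intro m b n i
      rw [Pol.unitMat, Matrix.single_apply]
      split_ifs <;> simp
    -- Tensoriality turns the frame part of `der_ev` into the Christoffel sum that ∇ subtracts.
    have e : ∑ m, ∑ b, γ.conn (i 0) m b *
          ev γ conj s U Z (Pol.frameDer m b (Pol.nablaRiem n (Fin.tail i)))
        = ∑ r, ∑ m, γ.conn (i 0) m (Fin.tail i r) *
          ev γ conj s U Z (Pol.nablaRiem n (Function.update (Fin.tail i) r m)) := by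
      simp only [Pol.isTensorial_nablaRiem n _ _ _, map_sum, map_mul, unit, Finset.mul_sum]
      rw [Finset.sum_congr rfl fun m _ => Finset.sum_comm, Finset.sum_comm]
      simp [ite_and]
    rw [e]
    exact add_sub_cancel_right _ _

end IsTypeD
end Geometry
end

section
set_option linter.unusedSectionVars false
set_option linter.unusedSimpArgs false

variable {A : Type*} [CommRing A] [Algebra ℂ A]

/-! ### The Killing field is determined by the curvature and its first two derivatives -/

theorem IsParallel.cov2_act {d : Derivation ℂ A A} {M : M4 A} {m : MetricData A}
    (h : IsParallel d M m) (V : Quad A) (F : M4 A) :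
    cov2 d M (m.act V F) = m.act (cov4 d M V) F + m.act V (cov2 d M F) := by
  have e : ∀ (V : Quad A) F a b, m.act V F a b = m.pair (Matrix.of fun c e => V a b c e) F := by
    intro V F a b; rfl
  have k2 : ∀ a b, cov2 d M (Matrix.of fun c e => V a b c e)
      = (Matrix.of fun c e => cov4 d M V a b c e)
        + ∑ n, M n a • (Matrix.of fun c e => V n b c e)
        + ∑ n, M n b • (Matrix.of fun c e => V a n c e) := by
    intro a b
    ext c e
    simp only [cov2, cov4, Matrix.of_apply, Matrix.add_apply, Matrix.sum_apply, Matrix.smul_apply,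
      smul_eq_mul]
    ring
  have ladd : ∀ X Y H : M4 A, m.pair (X + Y) H = m.pair X H + m.pair Y H := by
    intro X Y H
    simp only [MetricData.pair, Matrix.add_apply, add_mul, Finset.sum_add_distrib, smul_add]
  have lsmul : ∀ (x : A) (X H : M4 A), m.pair (x • X) H = x * m.pair X H := by
    intro x X H
    simp only [MetricData.pair, Matrix.smul_apply, smul_eq_mul, mul_assoc, ← Finset.mul_sum,
      mul_smul_comm]
  have lsum : ∀ (x : Fin 4 → A) (X : Fin 4 → M4 A) (H : M4 A),
      m.pair (∑ n, x n • X n) H = ∑ n, x n * m.pair (X n) H := by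
    intro x X H
    simp only [Fin.sum_univ_four, ladd, lsmul]
  ext a b
  simp only [cov2, Matrix.of_apply, Matrix.add_apply, e]
  rw [h.map_pair, k2, ladd, ladd, lsum, lsum]
  simp only [cov2, Matrix.of_apply]
  ring

theorem cov1_smul {d : Derivation ℂ A A} {M : M4 A} (x : A) (X : Fin 4 → A) (a : Fin 4) :
    cov1 d M (fun a => x * X a) a = d x * X a + x * cov1 d M X a := by
  simp only [cov1, Derivation.leibniz, mul_left_comm _ x, ← Finset.mul_sum, smul_eq_mul]; ring

namespace Geometry

/-- The second covariant derivative of the Riemann tensor. -/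
def nabnabRiem (γ : Geometry A) (h e : Fin 4) : Quad A := fun a b c d =>
  cov4 (γ.der h) (γ.conn h) (γ.nabRiem e) a b c d - ∑ n, γ.conn h n e * γ.nabRiem n a b c d

theorem nablaIter_riem_one (γ : Geometry A) (e a b c d : Fin 4) :
    γ.nablaIter (fun i => γ.riem (i 0) (i 1) (i 2) (i 3)) 1 ![e, a, b, c, d]
      = γ.nabRiem e a b c d := by
  simp [nablaIter, nabla, nabRiem, cov4, Fin.sum_univ_four, Fin.tail, Function.update, Fin.ext_iff]
  ring

theorem nablaIter_riem_two (γ : Geometry A) (h e a b c d : Fin 4) :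
    γ.nablaIter (fun i => γ.riem (i 0) (i 1) (i 2) (i 3)) 2 ![h, e, a, b, c, d]
      = γ.nabnabRiem h e a b c d := by
  have k : γ.nablaIter (fun i => γ.riem (i 0) (i 1) (i 2) (i 3)) 1
      = fun (i : Fin (4 + 1) → Fin 4) => γ.nabRiem (i 0) (i 1) (i 2) (i 3) (i 4) := by
    funext i
    rw [← nablaIter_riem_one]
    congr 1
    funext j
    fin_cases j <;> rfl
  change γ.nabla (γ.nablaIter (fun i => γ.riem (i 0) (i 1) (i 2) (i 3)) 1) _ = _
  rw [k]
  rw [nabla, show (Finset.univ : Finset (Fin (4 + 1))) = (Finset.univ : Finset (Fin 5)) from rfl,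
    Fin.sum_univ_five]
  change γ.der h (γ.nabRiem e a b c d) - (∑ m, γ.conn h m e * γ.nabRiem m a b c d
    + ∑ m, γ.conn h m a * γ.nabRiem e m b c d + ∑ m, γ.conn h m b * γ.nabRiem e a m c d
    + ∑ m, γ.conn h m c * γ.nabRiem e a b m d + ∑ m, γ.conn h m d * γ.nabRiem e a b c m) = _
  simp only [nabnabRiem, cov4]
  ring

namespace IsTypeD

variable {γ : Geometry A} {s : A} {U : M4 A} {Z : Fin 4 → A} (h : γ.IsTypeD s U Z)
include h

/-- Riem commutes with the dual and U is self-dual, so Riem and 𝒲 act alike on U. -/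
theorem act_riem : γ.met.act γ.riem U = (-2 * s ^ 3) • U := by
  have hm := h.leviCivita.isMetric
  have hW := isWeylLike_riem h.leviCivita h.vacuum
  have k := MetricData.act_sdPart (m := γ.met) γ.riem U
  rw [MetricData.hodge_act hm hW, h.bivector.isDual.hodge_eq, MetricData.act_smul, smul_smul,
    Complex.I_mul_I, h.weyl] at k
  have k2 : γ.met.act (fun a b c d => s ^ 3 * (3 * (U a b * U c d) + γ.met.sdG a b c d)) U
      = s ^ 3 • ((3 * γ.met.pair U U) • U + γ.met.act γ.met.sdG U) := by
    rw [mul_smul, ← MetricData.act_outer]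
    ext a b
    simp only [MetricData.act, Matrix.of_apply, Matrix.smul_apply, Matrix.add_apply, smul_eq_mul,
      mul_smul_comm, ← smul_add, Finset.mul_sum, ← Finset.sum_add_distrib]
    congr 1
    exact Finset.sum_congr rfl fun _ _ => Finset.sum_congr rfl fun _ _ => by ring
  rw [k2, h.bivector.pair_self, h.bivector.isDual.act_sdG hm] at k
  have k3 : γ.met.act γ.riem U
      = (1 / 2 : ℂ) • (γ.met.act γ.riem U - (-1 : ℂ) • γ.met.act γ.riem U) := by module
  rw [k3, ← k]
  module

/-- Derivative of (U, Riem(U)) = 2w. The terms in ∇U vanish, U being an eigenbivector orthogonal to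
∇U, so no derivative of U is needed to obtain dw. -/
theorem pair_act_nabRiem (e : Fin 4) :
    γ.met.pair U (γ.met.act (γ.nabRiem e) U) = 2 * γ.der e (s ^ 3) := by
  have hm := h.leviCivita.isMetric
  have hp := h.leviCivita.parallel e
  have lsmul : ∀ (x : A) (X Y : M4 A), γ.met.pair X (x • Y) = x * γ.met.pair X Y := by
    intro x X Y
    simp only [MetricData.pair, MetricData.up, Matrix.mul_smul, Matrix.smul_mul, Matrix.smul_apply,
      smul_eq_mul, mul_left_comm _ x, ← Finset.mul_sum, mul_smul_comm]
  have k1 : γ.met.pair U (γ.met.act γ.riem U) = 2 * s ^ 3 := by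
    rw [h.act_riem, lsmul, h.bivector.pair_self]; ring
  have k2 := congrArg (γ.der e) k1
  have z : γ.met.pair (cov2 (γ.der e) (γ.conn e) U) U = 0 := h.pair_nab2 e
  rw [hp.map_pair, hp.cov2_act, h.act_riem, lsmul, z] at k2
  have z2 : γ.met.pair U (γ.met.act γ.riem (cov2 (γ.der e) (γ.conn e) U)) = 0 := by
    rw [← MetricData.pair_act hm (riem_pair h.leviCivita), h.act_riem, MetricData.pair_comm hm,
      lsmul, z, mul_zero]
    · rw [Matrix.transpose_smul, h.bivector.isDual.antisymm, smul_neg]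
    · exact cov2_antisymm h.bivector.isDual.antisymm
  have ladd : ∀ X Y H : M4 A, γ.met.pair H (X + Y) = γ.met.pair H X + γ.met.pair H Y := by
    intro X Y H
    simp only [MetricData.pair, MetricData.up, Matrix.mul_add, Matrix.add_mul, Matrix.add_apply,
      mul_add, Finset.sum_add_distrib, smul_add]
  rw [ladd, z2, Derivation.leibniz, show γ.der e 2 = 0 from (γ.der e).map_natCast 2] at k2
  simp only [smul_eq_mul] at k2
  rw [nabRiem]
  linear_combination k2

theorem pair_act_nabnabRiem (i e : Fin 4) :
    2 * cov1 (γ.der i) (γ.conn i) (fun e => γ.der e (s ^ 3)) e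
      = γ.met.pair (γ.nab2 U i) (γ.met.act (γ.nabRiem e) U)
        + γ.met.pair U (γ.met.act (γ.nabRiem e) (γ.nab2 U i))
        + γ.met.pair U (γ.met.act (γ.nabnabRiem i e) U) := by
  have hp := h.leviCivita.parallel i
  have ladd : ∀ X Y H : M4 A, γ.met.pair H (X + Y) = γ.met.pair H X + γ.met.pair H Y := by
    intro X Y H
    simp only [MetricData.pair, MetricData.up, Matrix.mul_add, Matrix.add_mul, Matrix.add_apply,
      mul_add, Finset.sum_add_distrib, smul_add]
  have lsmul : ∀ (x : A) (X Y : M4 A), γ.met.pair X (x • Y) = x * γ.met.pair X Y := by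
    intro x X Y
    simp only [MetricData.pair, MetricData.up, Matrix.mul_smul, Matrix.smul_mul, Matrix.smul_apply,
      smul_eq_mul, mul_left_comm _ x, ← Finset.mul_sum, mul_smul_comm]
  have k := congrArg (γ.der i) (h.pair_act_nabRiem e)
  rw [hp.map_pair, hp.cov2_act, ladd, Derivation.leibniz,
    show γ.der i 2 = 0 from (γ.der i).map_natCast 2] at k
  simp only [smul_eq_mul] at k
  have e1 : γ.met.act (cov4 (γ.der i) (γ.conn i) (γ.nabRiem e)) U
      = γ.met.act (γ.nabnabRiem i e) U + ∑ n, γ.conn i n e • γ.met.act (γ.nabRiem n) U := by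
    ext a b
    simp only [MetricData.act, nabnabRiem, Matrix.add_apply, Matrix.of_apply, Fin.sum_univ_four,
      Matrix.smul_apply, smul_eq_mul, mul_smul_comm, ← smul_add]
    congr 1
    ring
  have e2 : γ.met.pair U (∑ n, γ.conn i n e • γ.met.act (γ.nabRiem n) U)
      = ∑ n, γ.conn i n e * (2 * γ.der n (s ^ 3)) := by
    simp only [← h.pair_act_nabRiem, Fin.sum_univ_four, ladd, lsmul]
  rw [e1, ladd, e2] at k
  simp only [cov1, nab2, mul_left_comm _ (2 : A), ← Finset.mul_sum] at k ⊢
  linear_combination - k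

/-- `divergence_eq_der` with δU = sZ, so dw and U determine Z; its derivative below serves the same
purpose for ∇Z. -/
theorem killing_eq (b : Fin 4) :
    3 * s ^ 4 * Z b = 2 * γ.met.interior₂ (fun e => γ.der e (s ^ 3)) U b := by
  have k := congrFun h.divergence_eq_der b
  rw [h.divergence_eq_mul, ← MetricData.interior₂_eq h.leviCivita.isMetric] at k
  simp only [Pi.smul_apply, smul_eq_mul] at k
  rw [← k]; ring

theorem nab_killing_eq (i b : Fin 4) :
    12 * s ^ 3 * γ.der i s * Z b + 3 * s ^ 4 * γ.nab1 Z i b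
      = 2 * γ.met.interior₂ (cov1 (γ.der i) (γ.conn i) fun e => γ.der e (s ^ 3)) U b
        + 2 * γ.met.interior₂ (fun e => γ.der e (s ^ 3)) (γ.nab2 U i) b := by
  have hp := h.leviCivita.parallel i
  have k : (fun b => (3 * s ^ 4) * Z b)
      = fun b => 2 * γ.met.interior₂ (fun e => γ.der e (s ^ 3)) U b := funext h.killing_eq
  have k2 := congrArg (fun X => cov1 (γ.der i) (γ.conn i) X b) k
  simp only [cov1_smul] at k2
  have e1 : cov1 (γ.der i) (γ.conn i) (fun b => γ.met.interior₂ (fun e => γ.der e (s ^ 3)) U b) b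
      = _ := hp.cov1_interior₂ _ U b
  rw [e1, Derivation.leibniz, Derivation.leibniz_pow, show γ.der i 2 = 0 from
    (γ.der i).map_natCast 2, show γ.der i 3 = 0 from (γ.der i).map_natCast 3] at k2
  simp only [smul_eq_mul, nsmul_eq_mul] at k2
  push_cast at k2
  simp only [nab1, Matrix.of_apply, nab2]
  linear_combination k2

end IsTypeD

/-- If, at two points, the metrics, the canonical bivectors, the eigenvalues and the first two
derivatives of the Riemann tensor coincide, so do `Z` and `∇Z`. -/
theorem killing_determined {A' : Type*} [CommRing A'] [Algebra ℂ A'] {γ : Geometry A}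
    {γ' : Geometry A'} {s : A} {s' : A'} {U : M4 A} {U' : M4 A'} {Z : Fin 4 → A}
    {Z' : Fin 4 → A'} (h : γ.IsTypeD s U Z) (h' : γ'.IsTypeD s' U' Z') (π : A →ₐ[ℂ] ℂ)
    (π' : A' →ₐ[ℂ] ℂ) (hg : ∀ a b, π (γ.met.g a b) = π' (γ'.met.g a b))
    (hi : ∀ a b, π (γ.met.gi a b) = π' (γ'.met.gi a b)) (hv : π γ.met.vol = π' γ'.met.vol)
    (hs : π s = π' s') (hU : ∀ a b, π (U a b) = π' (U' a b))
    (h1 : ∀ e a b c d, π (γ.nabRiem e a b c d) = π' (γ'.nabRiem e a b c d))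
    (h2 : ∀ i e a b c d, π (γ.nabnabRiem i e a b c d) = π' (γ'.nabnabRiem i e a b c d)) :
    (∀ a, π (Z a) = π' (Z' a)) ∧ ∀ a b, π (γ.nab1 Z a b) = π' (γ'.nab1 Z' a b) := by
  have two : (2 : ℂ) ≠ 0 := two_ne_zero
  have hs0 : π' s' ≠ 0 := (h'.unit.map π').ne_zero
  have hpair : ∀ {F H : M4 A} {F' H' : M4 A'}, (∀ a b, π (F a b) = π' (F' a b)) →
      (∀ a b, π (H a b) = π' (H' a b)) → π (γ.met.pair F H) = π' (γ'.met.pair F' H') := by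
    intro F H F' H' hF hH
    simp only [MetricData.pair, MetricData.up, Matrix.mul_apply, Matrix.transpose_apply, map_smul,
      map_sum, map_mul, hi, hF, hH]
  have hact : ∀ {V : Quad A} {V' : Quad A'} {F : M4 A} {F' : M4 A'},
      (∀ a b c d, π (V a b c d) = π' (V' a b c d)) → (∀ a b, π (F a b) = π' (F' a b)) →
      ∀ a b, π (γ.met.act V F a b) = π' (γ'.met.act V' F' a b) := by
    intro V V' F F' hV hF a b
    simp only [MetricData.act, MetricData.up, Matrix.of_apply, Matrix.mul_apply,
      Matrix.transpose_apply, map_smul, map_sum, map_mul, hi, hF, hV]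
  have hint : ∀ {X : Fin 4 → A} {X' : Fin 4 → A'} {F : M4 A} {F' : M4 A'},
      (∀ a, π (X a) = π' (X' a)) → (∀ a b, π (F a b) = π' (F' a b)) →
      ∀ a, π (γ.met.interior₂ X F a) = π' (γ'.met.interior₂ X' F' a) := by
    intro X X' F F' hX hF a
    simp only [MetricData.interior₂, map_sum, map_mul, hi, hX, hF]
  -- Order of determination: ∇Riem gives dw, hence Z, hence ds and ∇U; then ∇∇Riem gives ∇dw, hence
  -- ∇Z. Each division is by a nonzero number in the common field ℂ.
  have hu : ∀ e, π (γ.der e (s ^ 3)) = π' (γ'.der e (s' ^ 3)) := by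
    intro e
    have k := congrArg π (h.pair_act_nabRiem e)
    have k' := congrArg π' (h'.pair_act_nabRiem e)
    rw [hpair hU (hact (h1 e) hU), k', map_mul, map_mul, map_ofNat, map_ofNat] at k
    exact (mul_left_cancel₀ two k).symm
  have hZ : ∀ a, π (Z a) = π' (Z' a) := by
    intro a
    have k := congrArg π (h.killing_eq a)
    have k' := congrArg π' (h'.killing_eq a)
    simp only [map_mul, map_pow, map_ofNat] at k k'
    rw [hint hu hU, ← k', hs] at k
    exact mul_left_cancel₀ (mul_ne_zero three_ne_zero (pow_ne_zero 4 hs0)) k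
  have hds : ∀ e, π (γ.der e s) = π' (γ'.der e s') := by
    intro e
    rw [h.der_eq, h'.der_eq, map_mul, map_mul, map_pow, map_pow, hs, hint hZ hU]
  have hsd : ∀ a b c d, π (γ.met.sdG a b c d) = π' (γ'.met.sdG a b c d) := by
    intro a b c d
    simp only [MetricData.sdG, MetricData.bigG, MetricData.eta, map_smul, map_sub, map_mul, hg, hv,
      map_intCast]
  have hdU : ∀ e c d, π (γ.nab2 U e c d) = π' (γ'.nab2 U' e c d) := by
    intro e c d
    rw [h.nab2_eq, h'.nab2_eq, map_mul, map_mul, hs, MetricData.interior_eq, MetricData.interior_eq]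
    congr 1
    refine hint hZ (fun a b => ?_) e
    simp only [slice_apply, MetricData.bivectorQuad, map_add, map_mul, hU, hsd]
  have hH : ∀ i e, π (cov1 (γ.der i) (γ.conn i) (fun e => γ.der e (s ^ 3)) e)
      = π' (cov1 (γ'.der i) (γ'.conn i) (fun e => γ'.der e (s' ^ 3)) e) := by
    intro i e
    have k := congrArg π (h.pair_act_nabnabRiem i e)
    have k' := congrArg π' (h'.pair_act_nabnabRiem i e)
    simp only [map_add, map_mul, map_ofNat] at k k'
    rw [hpair (hdU i) (hact (h1 e) hU), hpair hU (hact (h1 e) (hdU i)),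
      hpair hU (hact (h2 i e) hU), ← k'] at k
    exact mul_left_cancel₀ two k
  refine ⟨hZ, fun i b => ?_⟩
  have k := congrArg π (h.nab_killing_eq i b)
  have k' := congrArg π' (h'.nab_killing_eq i b)
  simp only [map_add, map_mul, map_pow, map_ofNat] at k k'
  rw [hint (hH i) hU, hint hu (hdU i), ← k', hs, hds, hZ] at k
  exact mul_left_cancel₀ (mul_ne_zero three_ne_zero (pow_ne_zero 4 hs0)) (add_left_cancel k)

end Geometry
end

section

open TopologicalSpace (Opens)

/-! ### The ring of smooth functions on an open set of the coordinate space -/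

/-- Smooth complex functions on the open set `Ω`. -/
def smoothFunctions (Ω : Opens Coord) : Subalgebra ℂ (Ω → ℂ) where
  -- Elements live on Ω alone, so equality is tested at its points; the extension, arbitrary outside
  -- Ω, is there to be differentiated.
  carrier := {f | ∃ F : Coord → ℂ, ContDiffOn ℝ ∞ F Ω ∧ ∀ y : Ω, f y = F y}
  mul_mem' := by
    rintro f h ⟨F, hF, hf⟩ ⟨H, hH, hh⟩
    exact ⟨F * H, hF.mul hH, fun y => by simp [hf, hh]⟩
  add_mem' := by
    rintro f h ⟨F, hF, hf⟩ ⟨H, hH, hh⟩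
    exact ⟨F + H, hF.add hH, fun y => by simp [hf, hh]⟩
  algebraMap_mem' c := ⟨fun _ => c, contDiffOn_const, fun _ => rfl⟩

/-- The ring of smooth complex functions on `Ω`. -/
abbrev Smooth (Ω : Opens Coord) : Type := smoothFunctions Ω

namespace Smooth

variable {Ω : Opens Coord}

/-- The element of the ring defined by a function on the coordinate space. -/
def mk (F : Coord → ℂ) (hF : ContDiffOn ℝ ∞ F Ω) : Smooth Ω := ⟨fun y => F y, F, hF, fun _ => rfl⟩

/-- Evaluation at a point. -/
def eval (y : Ω) : Smooth Ω →ₐ[ℂ] ℂ := (Pi.evalAlgHom ℂ (fun _ : Ω => ℂ) y).comp (smoothFunctions Ω).val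

@[simp] theorem eval_mk (F : Coord → ℂ) (hF : ContDiffOn ℝ ∞ F Ω) (y : Ω) :
    eval y (mk F hF) = F y := rfl

@[ext] theorem ext {f h : Smooth Ω} (H : ∀ y, eval y f = eval y h) : f = h :=
  Subtype.ext (funext H)

theorem exists_mk (f : Smooth Ω) : ∃ F hF, f = mk F hF := by
  obtain ⟨f, F, hF, h⟩ := f
  exact ⟨F, hF, ext h⟩

/-- An extension of a smooth function on `Ω` to the coordinate space. -/
def toFun (f : Smooth Ω) : Coord → ℂ := f.exists_mk.choose

theorem contDiffOn_toFun (f : Smooth Ω) : ContDiffOn ℝ ∞ f.toFun Ω := f.exists_mk.choose_spec.choose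

theorem toFun_apply (f : Smooth Ω) (y : Ω) : f.toFun y = eval y f := by
  conv_rhs => rw [f.exists_mk.choose_spec.choose_spec]
  rfl

theorem isUnit (f : Smooth Ω) (h : ∀ y, eval y f ≠ 0) : IsUnit f := by
  refine IsUnit.of_mul_eq_one (mk (fun y => (f.toFun y)⁻¹)
    (f.contDiffOn_toFun.inv fun y hy => ?_)) (ext fun y => ?_)
  · exact (f.toFun_apply ⟨y, hy⟩).symm ▸ h ⟨y, hy⟩
  · rw [map_mul, eval_mk, toFun_apply, mul_inv_cancel₀ (h y), map_one]

theorem contDiffOn_fderiv_apply {F : Coord → ℂ} (hF : ContDiffOn ℝ ∞ F Ω) (v : Coord) :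
    ContDiffOn ℝ ∞ (fun y => fderiv ℝ F y v) Ω :=
  (hF.fderiv_of_isOpen Ω.isOpen (m := ∞) (by simp)).clm_apply contDiffOn_const

theorem differentiableAt {E : Type*} [NormedAddCommGroup E] [NormedSpace ℝ E] {F : Coord → E}
    (hF : ContDiffOn ℝ ∞ F Ω) (y : Ω) : DifferentiableAt ℝ F y :=
  (hF.contDiffAt (Ω.isOpen.mem_nhds y.2)).differentiableAt (by simp)

theorem fderiv_eq {E : Type*} [NormedAddCommGroup E] [NormedSpace ℝ E] {F H : Coord → E}
    (h : ∀ y : Ω, F y = H y) (y : Ω) : fderiv ℝ F y = fderiv ℝ H y :=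
  Filter.EventuallyEq.fderiv_eq (Filter.mem_of_superset (Ω.isOpen.mem_nhds y.2) fun z hz => h ⟨z, hz⟩)

/-- The coordinate derivations. -/
def der (c : Fin 4) : Derivation ℂ (Smooth Ω) (Smooth Ω) :=
  Derivation.mk'
    { toFun f := mk (fun y => fderiv ℝ f.toFun y (coordVec c))
        (contDiffOn_fderiv_apply f.contDiffOn_toFun _)
      map_add' f h := ext fun y => by
        rw [map_add, eval_mk, eval_mk, eval_mk, ← add_apply,
          ← fderiv_add (differentiableAt f.contDiffOn_toFun y)
            (differentiableAt h.contDiffOn_toFun y)]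
        exact DFunLike.congr_fun (fderiv_eq (fun z => by simp [toFun_apply]) y) (coordVec c)
      map_smul' a f := ext fun y => by
        rw [RingHom.id_apply, map_smul, eval_mk, eval_mk, ← smul_apply,
          ← fderiv_const_smul (differentiableAt f.contDiffOn_toFun y)]
        exact DFunLike.congr_fun (fderiv_eq (fun z => by simp [toFun_apply]) y) (coordVec c) }
    fun f h => ext fun y => by
      change fderiv ℝ (f * h).toFun y (coordVec c)
        = eval y f • fderiv ℝ h.toFun y (coordVec c) + eval y h • fderiv ℝ f.toFun y (coordVec c)
      rw [← toFun_apply, ← toFun_apply, ← smul_apply,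
        ← smul_apply, ← add_apply,
        ← fderiv_mul (differentiableAt f.contDiffOn_toFun y)
          (differentiableAt h.contDiffOn_toFun y)]
      exact DFunLike.congr_fun (fderiv_eq (fun z => by simp [toFun_apply]) y) (coordVec c)

/-- Since Ω is open, any extension computes the derivative, not only the chosen one. -/
theorem eval_der {f : Smooth Ω} {F : Coord → ℂ} (h : ∀ y : Ω, eval y f = F y) (c : Fin 4) (y : Ω) :
    eval y (der c f) = fderiv ℝ F y (coordVec c) :=
  DFunLike.congr_fun (fderiv_eq (fun z => by rw [toFun_apply, h]) y) (coordVec c)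

theorem der_comm (a b : Fin 4) (f : Smooth Ω) : der a (der b f) = der b (der a f) := by
  have key : ∀ a b, ∀ y : Ω, eval y (der a (der b f))
      = fderiv ℝ (fderiv ℝ f.toFun) y (coordVec a) (coordVec b) := by
    intro a b y
    rw [eval_der (F := fun z => fderiv ℝ f.toFun z (coordVec b))
      (fun z => eval_der (fun w => (f.toFun_apply w).symm) b z)]
    have hd : DifferentiableAt ℝ (fderiv ℝ f.toFun) (y : Coord) :=
      differentiableAt (f.contDiffOn_toFun.fderiv_of_isOpen Ω.isOpen (m := ∞) (by simp)) y
    rw [fderiv_clm_apply hd (differentiableAt_const _)]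
    simp
  refine ext fun y => ?_
  rw [key, key]
  exact ((f.contDiffOn_toFun.contDiffAt (Ω.isOpen.mem_nhds y.2)).isSymmSndFDerivAt
    (by simpa using (WithTop.coe_le_coe.2 (le_top : (2 : ℕ∞) ≤ ⊤)))) _ _

/-- Pointwise complex conjugation. -/
def conj : Smooth Ω →+* Smooth Ω where
  toFun f := mk (fun y => star (f.toFun y))
    (Complex.conjCLE.contDiff.comp_contDiffOn f.contDiffOn_toFun)
  map_one' := ext fun y => by simp [toFun_apply]
  map_zero' := ext fun y => by simp [toFun_apply]
  map_add' _ _ := ext fun y => by simp [toFun_apply]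
  map_mul' _ _ := ext fun y => by simp [toFun_apply]

@[simp] theorem eval_conj (f : Smooth Ω) (y : Ω) : eval y (conj f) = star (eval y f) := by
  change star (f.toFun y) = _
  rw [toFun_apply]

theorem der_conj (a : Fin 4) (f : Smooth Ω) : der a (conj f) = conj (der a f) := by
  refine ext fun y => ?_
  have hd := differentiableAt f.contDiffOn_toFun y
  rw [eval_conj, eval_der (fun z => (f.toFun_apply z).symm), eval_der (F := Complex.conjCLE ∘ f.toFun)
    (fun z => by rw [eval_conj, ← toFun_apply]; rfl), ContinuousLinearEquiv.comp_fderiv]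
  rfl

/-- The element of the ring defined by a real function. -/
def ofReal (F : Coord → ℝ) (hF : ContDiffOn ℝ ∞ F Ω) : Smooth Ω :=
  mk (fun y => (F y : ℂ)) (Complex.ofRealCLM.contDiff.comp_contDiffOn hF)

@[simp] theorem eval_ofReal (F : Coord → ℝ) (hF : ContDiffOn ℝ ∞ F Ω) (y : Ω) :
    eval y (ofReal F hF) = F y := rfl

theorem conj_ofReal (F : Coord → ℝ) (hF : ContDiffOn ℝ ∞ F Ω) : conj (ofReal F hF) = ofReal F hF :=
  ext fun y => by simp

theorem eval_der_ofReal {F : Coord → ℝ} (hF : ContDiffOn ℝ ∞ F Ω) (c : Fin 4) (y : Ω) :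
    eval y (der c (ofReal F hF)) = (fderiv ℝ F y (coordVec c) : ℝ) := by
  rw [eval_der (F := Complex.ofRealCLM ∘ F) (fun z => eval_ofReal F hF z),
    fderiv_comp (y : Coord) Complex.ofRealCLM.differentiableAt (differentiableAt hF y)]
  simp

end Smooth

end

section

open TopologicalSpace (Opens)

/-! ### The geometry of a Lorentzian metric on a coordinate domain -/

variable {g : Coord → Matrix (Fin 4) (Fin 4) ℝ} {Ω : Opens Coord}

/-- Smooth components of a Lorentzian metric. -/
structure IsLorentz (g : Coord → Matrix (Fin 4) (Fin 4) ℝ) (Ω : Opens Coord) : Prop where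
  smooth : ∀ a b, ContDiffOn ℝ ∞ (fun y => g y a b) Ω
  symm : ∀ y ∈ Ω, ∀ a b, g y a b = g y b a
  det_neg : ∀ y ∈ Ω, (g y).det < 0

theorem contDiffOn_det {N : Coord → Matrix (Fin 4) (Fin 4) ℝ}
    (h : ∀ a b, ContDiffOn ℝ ∞ (fun y => N y a b) Ω) : ContDiffOn ℝ ∞ (fun y => (N y).det) Ω := by
  simp only [Matrix.det_apply]
  exact ContDiffOn.sum fun σ _ => (contDiffOn_prod fun i _ => h _ _).const_smul _

/-- Infinitesimal form of det(PᵀFP) = (det P)² det F; it supplies the law of the volume density. -/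
theorem der_det {A : Type*} [CommRing A] [Algebra ℂ A] (d : Derivation ℂ A A) {F M : M4 A}
    (h : F.map d = Mᵀ * F + F * M) : d F.det = 2 * M.trace * F.det := by
  have k : ∀ a b, d (F a b) = (M 0 a * F 0 b + M 1 a * F 1 b + M 2 a * F 2 b + M 3 a * F 3 b)
      + (F a 0 * M 0 b + F a 1 * M 1 b + F a 2 * M 2 b + F a 3 * M 3 b) := by
    intro a b
    have := congrFun (congrFun h a) b
    simpa [Matrix.mul_apply, Fin.sum_univ_four] using this
  rw [det_four]
  simp only [Derivation.leibniz, map_add, map_sub, smul_eq_mul, k, Matrix.trace, Matrix.diag,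
    Fin.sum_univ_four]
  ring

/-- Pointwise metric data. -/
def metricAt (g : Coord → Matrix (Fin 4) (Fin 4) ℝ) (y : Coord) : MetricData ℂ where
  g := Matrix.of fun a b => (g y a b : ℂ)
  gi := Matrix.of fun a b => (ginv g y a b : ℂ)
  vol := (√(-(g y).det) : ℝ)

namespace IsLorentz

variable (hg : IsLorentz g Ω)
include hg

theorem contDiffOn_ginv (a b : Fin 4) : ContDiffOn ℝ ∞ (fun y => ginv g y a b) Ω := by
  -- Cramer's rule displays the inverse as a quotient of determinants.
  have e : (fun y => ginv g y a b)
      = fun y => ((g y).det)⁻¹ * ((g y)ᵀ.updateCol b (Pi.single a 1)).det := by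
    funext y
    rw [ginv, Matrix.inv_def, Matrix.smul_apply, Ring.inverse_eq_inv, Matrix.adjugate_def,
      Matrix.of_apply, Matrix.cramer_apply, smul_eq_mul]
  rw [e]
  refine ContDiffOn.mul ((contDiffOn_det hg.smooth).inv fun y hy => (hg.det_neg y hy).ne)
    (contDiffOn_det fun i j => ?_)
  simp only [Matrix.updateCol_apply, Matrix.transpose_apply]
  split_ifs
  · exact contDiffOn_const
  · exact hg.smooth _ _

theorem contDiffOn_dg (c a b : Fin 4) : ContDiffOn ℝ ∞ (fun y => dg g y c a b) Ω :=
  ((hg.smooth a b).fderiv_of_isOpen Ω.isOpen (m := ∞) (by simp)).clm_apply contDiffOn_const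

theorem contDiffOn_christoffel (m a b : Fin 4) : ContDiffOn ℝ ∞ (fun y => christoffel g y m a b) Ω :=
  contDiffOn_const.mul (ContDiffOn.sum fun l _ => (hg.contDiffOn_ginv m l).mul
    (((hg.contDiffOn_dg _ _ _).add (hg.contDiffOn_dg _ _ _)).sub (hg.contDiffOn_dg _ _ _)))

theorem contDiffOn_volume : ContDiffOn ℝ ∞ (fun y => √(-(g y).det)) Ω :=
  (contDiffOn_det hg.smooth).neg.sqrt fun y hy => (neg_pos.2 (hg.det_neg y hy)).ne'

/-- The geometry of the metric. -/
def geometry : Geometry (Smooth Ω) where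
  der := Smooth.der
  met :=
    { g := Matrix.of fun a b => Smooth.ofReal _ (hg.smooth a b)
      gi := Matrix.of fun a b => Smooth.ofReal _ (hg.contDiffOn_ginv a b)
      vol := Smooth.ofReal _ hg.contDiffOn_volume }
  conn c := Matrix.of fun m b => Smooth.ofReal _ (hg.contDiffOn_christoffel m c b)

theorem eval_g (y : Ω) (a b : Fin 4) : Smooth.eval y (hg.geometry.met.g a b) = g y a b := rfl
theorem eval_gi (y : Ω) (a b : Fin 4) : Smooth.eval y (hg.geometry.met.gi a b) = ginv g y a b := rfl
theorem eval_vol (y : Ω) : Smooth.eval y hg.geometry.met.vol = (√(-(g y).det) : ℝ) := rfl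
theorem eval_conn (y : Ω) (c m b : Fin 4) :
    Smooth.eval y (hg.geometry.conn c m b) = christoffel g y m c b := rfl

theorem sum_mul_ginv {y : Coord} (hy : y ∈ Ω) (a b : Fin 4) :
    ∑ c, g y a c * ginv g y c b = if a = b then 1 else 0 := by
  have := congrFun (congrFun (Matrix.mul_nonsing_inv (g y) (hg.det_neg y hy).ne.isUnit) a) b
  rwa [Matrix.mul_apply, Matrix.one_apply] at this

theorem dg_symm (y : Ω) (c a b : Fin 4) : dg g y c a b = dg g y c b a :=
  DFunLike.congr_fun (Smooth.fderiv_eq (fun z => hg.symm z z.2 a b) y) _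

theorem christoffel_symm (y : Ω) (m a b : Fin 4) : christoffel g y m a b = christoffel g y m b a := by
  simp only [christoffel, hg.dg_symm y _ a b]
  congr 1
  exact Finset.sum_congr rfl fun l _ => by ring

theorem sum_mul_christoffel (y : Ω) (a c b : Fin 4) : ∑ m, g y a m * christoffel g y m c b
    = (1 / 2) * (dg g y c b a + dg g y b c a - dg g y a c b) := by
  simp only [christoffel, mul_left_comm _ (1 / 2 : ℝ), ← Finset.mul_sum]
  congr 1
  simp only [Finset.mul_sum]
  rw [Finset.sum_comm]
  simp only [← mul_assoc, ← Finset.sum_mul, hg.sum_mul_ginv y.2]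
  simp

theorem dg_eq (y : Ω) (c a b : Fin 4) : dg g y c a b
    = ∑ m, christoffel g y m c a * g y m b + ∑ m, g y a m * christoffel g y m c b := by
  simp only [hg.symm y y.2 _ b, mul_comm (christoffel g _ _ _ _)]
  rw [hg.sum_mul_christoffel, hg.sum_mul_christoffel, hg.dg_symm y c b a, hg.dg_symm y b c a]
  ring

theorem isMetric : hg.geometry.met.IsMetric where
  symm := by
    ext a b y
    exact congrArg Complex.ofReal (hg.symm y y.2 b a)
  mul_inv := by
    ext a b y
    simp only [Matrix.mul_apply, map_sum, map_mul, eval_g, eval_gi, Matrix.one_apply]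
    rw [apply_ite (Smooth.eval y), map_one, map_zero]
    have := congrArg Complex.ofReal (hg.sum_mul_ginv y.2 a b)
    simpa [apply_ite Complex.ofReal] using this
  vol_sq := by
    ext y
    rw [map_pow, map_neg, eval_vol, AlgHom.map_det]
    have e : (Smooth.eval y).mapMatrix hg.geometry.met.g = (g y).map Complex.ofRealHom := rfl
    rw [e, ← RingHom.mapMatrix_apply, ← RingHom.map_det, ← Complex.ofReal_pow,
      Real.sq_sqrt (neg_pos.2 (hg.det_neg y y.2)).le]
    simp

theorem isUnit_vol : IsUnit hg.geometry.met.vol :=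
  Smooth.isUnit _ fun y => by
    rw [eval_vol]
    exact_mod_cast (Real.sqrt_pos.2 (neg_pos.2 (hg.det_neg y y.2))).ne'

theorem isLeviCivita : hg.geometry.IsLeviCivita where
  der_comm := Smooth.der_comm
  isMetric := hg.isMetric
  torsion a b c := Smooth.ext fun y => congrArg Complex.ofReal (hg.christoffel_symm y b a c)
  parallel c := by
    have hm := hg.isMetric
    have m1 : hg.geometry.met.g.map (hg.geometry.der c)
        = (hg.geometry.conn c)ᵀ * hg.geometry.met.g + hg.geometry.met.g * hg.geometry.conn c := by
      ext a b y
      simp only [Matrix.add_apply, Matrix.mul_apply, Matrix.transpose_apply, map_add, map_sum,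
        map_mul, eval_g, eval_conn]
      refine (Smooth.eval_der_ofReal (hg.smooth a b) c y).trans ?_
      exact_mod_cast hg.dg_eq y c a b
    refine ⟨m1, ?_, ?_⟩
    -- The derivative of g⁻¹g = 1 is solved for that of g⁻¹.
    · have k : (hg.geometry.met.gi * hg.geometry.met.g).map (hg.geometry.der c) = 0 := by
        rw [hm.inv_mul]
        ext a b : 2
        simp [Matrix.one_apply, apply_ite (hg.geometry.der c)]
      rw [map_mul_derivation, m1] at k
      have k2 := congrArg (· * hg.geometry.met.gi) k
      simp only [Matrix.add_mul, Matrix.mul_add, zero_mul, Matrix.mul_assoc, hm.mul_inv] at k2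
      simp only [← Matrix.mul_assoc, hm.inv_mul, Matrix.one_mul, Matrix.mul_one] at k2
      rw [eq_sub_iff_add_eq, eq_neg_iff_add_eq_zero, ← k2]
      abel
    -- Differentiate vol² = -det g and cancel 2 vol.
    · have k := congrArg (hg.geometry.der c) hm.vol_sq
      rw [map_neg, der_det _ m1, pow_two, Derivation.leibniz, smul_eq_mul] at k
      refine hg.isUnit_vol.mul_left_cancel (half_smul_cancel ?_)
      simp only [two_smul]
      linear_combination k - 2 * (hg.geometry.conn c).trace * hm.vol_sq

theorem isReal : hg.geometry.IsReal Smooth.conj where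
  conj_algebraMap c := Smooth.ext fun y => by
    rw [Smooth.eval_conj, AlgHom.commutes, AlgHom.commutes]; rfl
  der_conj := Smooth.der_conj
  metric a b := Smooth.conj_ofReal _ (hg.smooth a b)
  inv a b := Smooth.conj_ofReal _ (hg.contDiffOn_ginv a b)
  vol := Smooth.conj_ofReal _ hg.contDiffOn_volume
  conn c m b := Smooth.conj_ofReal _ (hg.contDiffOn_christoffel m c b)

end IsLorentz
end

section

open TopologicalSpace (Opens)

variable {g : Coord → Matrix (Fin 4) (Fin 4) ℝ} {Ω : Opens Coord}

/-! ### Covariant derivatives of general rank in low ranks -/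

namespace Geometry

variable {A : Type*} [CommRing A] [Algebra ℂ A] (γ : Geometry A)

theorem nabla_covector (X : Fin 4 → A) :
    γ.nabla (fun i : Fin 1 → Fin 4 => X (i 0)) = fun i => γ.nab1 X (i 0) (i 1) := by
  funext i
  rw [nabla, Fin.sum_univ_one]
  rfl

theorem nabla_bitensor (F : M4 A) :
    γ.nabla (fun i : Fin 2 → Fin 4 => F (i 0) (i 1)) = fun i => γ.nab2 F (i 0) (i 1) (i 2) := by
  funext i
  rw [nabla, Fin.sum_univ_two, ← sub_sub]
  rfl

theorem nablaIter_covector_two (X : Fin 4 → A) (a b c : Fin 4) :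
    γ.nablaIter (fun i : Fin 1 → Fin 4 => X (i 0)) 2 ![a, b, c]
      = cov2 (γ.der a) (γ.conn a) (γ.nab1 X) b c := by
  change γ.nabla (γ.nabla (fun i : Fin 1 → Fin 4 => X (i 0))) _ = _
  rw [nabla_covector]
  exact congrFun (γ.nabla_bitensor (γ.nab1 X)) ![a, b, c]

end Geometry

/-! ### Bivectors at a point -/

namespace IsLorentz

theorem raise_eq (y : Coord) (F : Bitensor) (a b : Fin 4) :
    raise g y F a b = (metricAt g y).up (Matrix.of F) a b := by
  simp only [raise, MetricData.up, metricAt, Matrix.mul_apply, Matrix.of_apply,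
    Matrix.transpose_apply, Finset.sum_mul]
  rw [Finset.sum_comm]
  exact Finset.sum_congr rfl fun _ _ => Finset.sum_congr rfl fun _ _ => by ring

theorem pairing_eq (y : Coord) (F H : Bitensor) :
    pairing g y F H = (metricAt g y).pair (Matrix.of F) (Matrix.of H) := by
  simp only [pairing, MetricData.pair, raise_eq, smul_eq_mul, Matrix.of_apply]

theorem act_eq (y : Coord) (V : Quadtensor) (F : Bitensor) (a b : Fin 4) :
    act g y V F a b = (metricAt g y).act V (Matrix.of F) a b := by
  simp only [act, MetricData.act, raise_eq, smul_eq_mul, Matrix.of_apply]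

theorem eta_eq (y : Coord) (a b c d : Fin 4) : (eta g y a b c d : ℂ) = (metricAt g y).eta a b c d := by
  simp [eta, MetricData.eta, metricAt, permSymbol_eq]

theorem hodge_eq (y : Coord) (F : Bitensor) (a b : Fin 4) :
    hodge g y F a b = (metricAt g y).hodge (Matrix.of F) a b := by
  rw [hodge, act_eq, ← MetricData.act_eta]
  simp only [eta_eq]

theorem sdG_eq (y : Coord) (a b c d : Fin 4) : sdG g y a b c d = (metricAt g y).sdG a b c d := by
  simp only [sdG, MetricData.sdG, bigG, MetricData.bigG, eta_eq, smul_eq_mul]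
  simp [metricAt]

theorem isSelfDual_iff (y : Coord) (F : Bitensor) :
    IsSelfDual g y F ↔ (metricAt g y).IsDual Complex.I (Matrix.of F) := by
  constructor
  · rintro ⟨h1, h2⟩
    refine ⟨?_, ?_⟩
    · ext a b; exact h1 b a
    · ext a b
      rw [← hodge_eq, h2]; rfl
  · rintro ⟨h1, h2⟩
    refine ⟨fun a b => congrFun (congrFun h1 b) a, fun a b => ?_⟩
    rw [hodge_eq, h2]; rfl

theorem weyl_eq_riemann {y : Coord} (h : ∀ a b, ricci g y a b = 0) (a b c d : Fin 4) :
    weyl g y a b c d = riemann g y a b c d := by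
  simp [weyl, scalarCurv, h]

theorem sdWeyl_eq {y : Coord} (h : ∀ a b, ricci g y a b = 0) :
    sdWeyl g y = (metricAt g y).sdPart fun a b c d => (riemann g y a b c d : ℂ) := by
  funext a b c d
  simp only [sdWeyl, MetricData.sdPart, weyl_eq_riemann h, hodge_eq, smul_eq_mul]
  rfl

/-! ### Curvature and derivatives -/

variable (hg : IsLorentz g Ω)
include hg

theorem eval_curv (y : Ω) (a b c d : Fin 4) :
    Smooth.eval y (hg.geometry.curv c d a b) = riemannUp g y a b c d := by
  have k : ∀ m b c d, Smooth.eval y (hg.geometry.der c (hg.geometry.conn d m b))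
      = (fderiv ℝ (fun z => christoffel g z m b d) y (coordVec c) : ℝ) := by
    intro m b c d
    rw [hg.isLeviCivita.torsion]
    exact Smooth.eval_der_ofReal (hg.contDiffOn_christoffel m b d) c y
  simp only [Geometry.curv, Matrix.sub_apply, Matrix.add_apply, Matrix.map_apply, Matrix.mul_apply,
    map_sub, map_add, map_sum, map_mul, k, eval_conn, riemannUp, hg.christoffel_symm y _ c,
    hg.christoffel_symm y _ d, Finset.sum_sub_distrib]
  push_cast
  simp only [mul_comm]
  ring

theorem eval_riem (y : Ω) (a b c d : Fin 4) :
    Smooth.eval y (hg.geometry.riem a b c d) = riemann g y a b c d := by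
  simp only [Geometry.riem, Matrix.mul_apply, map_sum, map_mul, eval_curv, eval_g, riemann]
  push_cast
  rfl

theorem isVacuum (h : ∀ y ∈ Ω, ∀ a b, ricci g y a b = 0) : hg.geometry.IsVacuum := by
  intro b d
  ext y
  rw [map_sum, map_zero]
  simp only [eval_curv]
  exact_mod_cast h y y.2 b d

theorem eval_nabla {k : ℕ} {T : TField k} {T' : (Fin k → Fin 4) → Smooth Ω}
    (h : ∀ (y : Ω) i, Smooth.eval y (T' i) = T y i) (y : Ω) (i : Fin (k + 1) → Fin 4) :
    Smooth.eval y (hg.geometry.nabla T' i) = nabla g T y i := by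
  simp only [Geometry.nabla, nabla, map_sub, map_sum, map_mul, eval_conn, h]
  congr 1
  exact Smooth.eval_der (F := fun z => T z (Fin.tail i)) (fun z => h z _) _ y

theorem eval_nablaIter {k : ℕ} {T : TField k} {T' : (Fin k → Fin 4) → Smooth Ω}
    (h : ∀ (y : Ω) i, Smooth.eval y (T' i) = T y i) : ∀ (n : ℕ) (y : Ω) (i : Fin (k + n) → Fin 4),
    Smooth.eval y (hg.geometry.nablaIter T' n i) = nablaIter g T n y i
  | 0 => h
  | n + 1 => hg.eval_nabla (eval_nablaIter h n)

theorem eval_nablaIter_riem (n : ℕ) (y : Ω) (i : Fin (4 + n) → Fin 4) :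
    Smooth.eval y (hg.geometry.nablaIter
      (fun i => hg.geometry.riem (i 0) (i 1) (i 2) (i 3)) n i)
      = nablaIter g (riemannField g) n y i :=
  hg.eval_nablaIter (fun y _ => hg.eval_riem y _ _ _ _) n y i

theorem eval_up (y : Ω) {F : M4 (Smooth Ω)} {F' : M4 ℂ} (h : ∀ a b, Smooth.eval y (F a b) = F' a b)
    (a b : Fin 4) : Smooth.eval y (hg.geometry.met.up F a b) = (metricAt g y).up F' a b := by
  simp only [MetricData.up, Matrix.mul_apply, Matrix.transpose_apply, map_sum, map_mul, h]
  rfl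

theorem eval_hodge (y : Ω) {F : M4 (Smooth Ω)} {F' : M4 ℂ} (h : ∀ a b, Smooth.eval y (F a b) = F' a b)
    (a b : Fin 4) : Smooth.eval y (hg.geometry.met.hodge F a b) = (metricAt g y).hodge F' a b := by
  simp only [MetricData.hodge, dual, Matrix.smul_apply, Matrix.of_apply, map_smul, map_sum, map_mul,
    smul_eq_mul, hg.eval_up y h, map_intCast]
  rfl

theorem eval_pair (y : Ω) {F H : M4 (Smooth Ω)} {F' H' : M4 ℂ}
    (hF : ∀ a b, Smooth.eval y (F a b) = F' a b) (hH : ∀ a b, Smooth.eval y (H a b) = H' a b) :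
    Smooth.eval y (hg.geometry.met.pair F H) = (metricAt g y).pair F' H' := by
  simp only [MetricData.pair, map_smul, map_sum, map_mul, hg.eval_up y hH, hF]

theorem eval_sdPart (y : Ω) {V : Quad (Smooth Ω)} {V' : Quad ℂ}
    (h : ∀ a b c d, Smooth.eval y (V a b c d) = V' a b c d) (a b c d : Fin 4) :
    Smooth.eval y (hg.geometry.met.sdPart V a b c d) = (metricAt g y).sdPart V' a b c d := by
  have k := hg.eval_hodge y (F := slice V c d) (F' := slice V' c d) (fun a b => h a b c d) a b
  simp only [MetricData.sdPart, map_smul, map_sub, h, k]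

theorem eval_eta (y : Ω) (a b c d : Fin 4) :
    Smooth.eval y (hg.geometry.met.eta a b c d) = (metricAt g y).eta a b c d := by
  simp only [MetricData.eta, map_mul, map_intCast]
  rfl

theorem eval_sdG (y : Ω) (a b c d : Fin 4) :
    Smooth.eval y (hg.geometry.met.sdG a b c d) = sdG g y a b c d := by
  rw [sdG_eq]
  simp only [MetricData.sdG, MetricData.bigG, map_smul, map_sub, map_mul, hg.eval_eta]
  rfl

theorem isMetric_metricAt {y : Coord} (hy : y ∈ Ω) : (metricAt g y).IsMetric where
  symm := by
    ext a b
    exact congrArg Complex.ofReal (hg.symm y hy b a)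
  mul_inv := by
    ext a b
    have := congrArg Complex.ofReal (hg.sum_mul_ginv hy a b)
    simpa [Matrix.mul_apply, Matrix.one_apply, metricAt, apply_ite Complex.ofReal] using this
  vol_sq := by
    have e : (metricAt g y).g = (g y).map Complex.ofRealHom := rfl
    rw [e, ← RingHom.mapMatrix_apply, ← RingHom.map_det]
    change ((√(-(g y).det) : ℝ) : ℂ) ^ 2 = _
    rw [← Complex.ofReal_pow, Real.sq_sqrt (neg_pos.2 (hg.det_neg y hy)).le]
    simp

theorem isWeylLike_riemann (h : ∀ y ∈ Ω, ∀ a b, ricci g y a b = 0) (y : Ω) :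
    (metricAt g y).IsWeylLike fun a b c d => (riemann g y a b c d : ℂ) := by
  have k := Geometry.isWeylLike_riem hg.isLeviCivita (hg.isVacuum h)
  refine ⟨fun a b c d => ?_, fun a b c d => ?_, fun a b c d => ?_, fun b d => ?_⟩
  · simpa only [map_neg, eval_riem] using congrArg (Smooth.eval y) (k.antisymm a b c d)
  · simpa only [map_neg, eval_riem] using congrArg (Smooth.eval y) (k.antisymm' a b c d)
  · simpa only [map_neg, eval_riem] using congrArg (Smooth.eval y) (k.pair_symm a b c d)
  · have t := congrArg (Smooth.eval y) (k.traceless b d)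
    simp only [map_sum, map_mul, map_zero, eval_riem, eval_gi] at t
    exact t

/-- Type D is a condition on bivectors at a point, so the algebraic decomposition is applied over ℂ;
its smooth version follows by testing at every point. -/
theorem sdWeyl_eq_of_typeD (h : ∀ y ∈ Ω, ∀ a b, ricci g y a b = 0) {y : Coord} (hy : y ∈ Ω) {w : ℂ}
    {U : Bitensor} (hD : IsTypeDAt g y w U) (a b c d : Fin 4) :
    sdWeyl g y a b c d = w * (3 * U a b * U c d + sdG g y a b c d) := by
  have hW := hg.isWeylLike_riemann h ⟨y, hy⟩
  have e := sdWeyl_eq (h y hy)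
  rw [e, sdG_eq]
  refine MetricData.sdPart_eq_of_typeD (U := Matrix.of U) (hg.isMetric_metricAt hy) hW
    ⟨(isSelfDual_iff y U).1 hD.selfDual, ?_⟩ ?_ ?_ a b c d
  · rw [← pairing_eq, hD.normalized]
  · ext a b
    rw [← e, ← act_eq, hD.simple]; rfl
  · intro X hX hUX
    ext a b
    have hX' : (Matrix.of fun a b => X a b) = X := rfl
    rw [← e, ← hX', ← act_eq, hD.double _ ((isSelfDual_iff y _).2 hX) 
      ((pairing_eq y U fun a b => X a b).trans hUX)]
    rfl

end IsLorentz

/-! ### The canonical fields -/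

namespace IsCanonical

variable (hg : IsLorentz g Ω) {w s : Coord → ℂ} {U : Coord → Bitensor} (h : IsCanonical g Ω w s U)
include hg h

/-- The cube root of the eigenvalue as a smooth function. -/
def root (h : IsCanonical g Ω w s U) : Smooth Ω := .mk s h.smooth_s

/-- The canonical bivector as a matrix of smooth functions. -/
def biv (h : IsCanonical g Ω w s U) : M4 (Smooth Ω) := Matrix.of fun a b => .mk _ (h.smooth_U a b)

/-- The Killing vector as a tuple of smooth functions. -/
def killing (hg : IsLorentz g Ω) (h : IsCanonical g Ω w s U) (b : Fin 4) : Smooth Ω :=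
  Ring.inverse h.root * hg.geometry.divergence h.biv b

omit hg in
theorem eval_root_ne_zero (y : Ω) : Smooth.eval y h.root ≠ 0 := by
  intro h0
  have h1 : s y = 0 := h0
  refine (h.typeD y y.2).ne_zero ?_
  rw [← h.cube y y.2, h1]
  simp

omit hg in
theorem isUnit_root : IsUnit h.root := Smooth.isUnit _ h.eval_root_ne_zero

theorem eval_nab2 (y : Ω) (e a b : Fin 4) :
    Smooth.eval y (hg.geometry.nab2 h.biv e a b) = nabla g (bivectorField U) y ![e, a, b] := by
  rw [← hg.eval_nabla (T' := fun i => h.biv (i 0) (i 1)) (fun _ _ => rfl)]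
  rw [Geometry.nabla_bitensor]
  rfl

theorem eval_killing (y : Ω) (i : Fin 1 → Fin 4) :
    Smooth.eval y (killing hg h (i 0)) = fieldZ g s U y i := by
  have e : Smooth.eval y (Ring.inverse h.root) = (s y)⁻¹ := by
    refine eq_inv_of_mul_eq_one_left ?_
    have := congrArg (Smooth.eval y) (Ring.inverse_mul_cancel _ h.isUnit_root)
    rwa [map_mul, map_one] at this
  rw [killing, map_mul, e, fieldZ, Geometry.divergence, deltaU]
  simp only [map_neg, map_sum, map_mul, eval_nab2, IsLorentz.eval_gi]

theorem eval_nab1 (y : Ω) (a b : Fin 4) :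
    Smooth.eval y (hg.geometry.nab1 (killing hg h) a b) = nabla g (fieldZ g s U) y ![a, b] := by
  rw [← hg.eval_nabla (h.eval_killing hg), Geometry.nabla_covector]
  rfl

theorem isTypeD (hR : ∀ y ∈ Ω, ∀ a b, ricci g y a b = 0) :
    hg.geometry.IsTypeD h.root h.biv (killing hg h) where
  leviCivita := hg.isLeviCivita
  vacuum := hg.isVacuum hR
  unit := h.isUnit_root
  bivector := by
    have k : ∀ y : Ω, (metricAt g y).IsDual Complex.I (Matrix.of (U y)) := fun y =>
      (IsLorentz.isSelfDual_iff y _).1 (h.typeD y y.2).selfDual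
    refine ⟨⟨?_, ?_⟩, ?_⟩
    · ext a b y
      exact congrFun (congrFun (k y).antisymm a) b
    · ext a b y
      rw [hg.eval_hodge y (F' := Matrix.of (U y)) (fun _ _ => rfl), (k y).hodge_eq]
      rfl
    · ext y
      rw [hg.eval_pair y (F' := Matrix.of (U y)) (H' := Matrix.of (U y)) (fun _ _ => rfl)
        (fun _ _ => rfl), ← IsLorentz.pairing_eq, (h.typeD y y.2).normalized]
      simp
  weyl := by
    funext a b c d
    ext y
    rw [hg.eval_sdPart y (fun a b c d => hg.eval_riem y a b c d), ← IsLorentz.sdWeyl_eq (hR y y.2),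
      hg.sdWeyl_eq_of_typeD hR y.2 (h.typeD y y.2), ← h.cube y y.2]
    simp only [map_mul, map_add, map_pow, map_ofNat, hg.eval_sdG]
    rw [mul_assoc]
    rfl
  divergence_eq b := by
    rw [killing, ← mul_assoc, Ring.mul_inverse_cancel _ h.isUnit_root, one_mul]

/-- The values of the curvature variables at a point. -/
theorem eval_varVal (y : Ω) (v : Var) :
    Smooth.eval y (hg.geometry.varVal Smooth.conj h.root h.biv (killing hg h) v)
      = varValue g s U y v := by
  cases v with
  | metric a b => rfl
  | invMetric a b => rfl
  | volume a b c d => exact (hg.eval_eta y a b c d).trans (IsLorentz.eta_eq y a b c d).symm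
  | cubeRoot => rfl
  | bivector a b => rfl
  | killing a => exact h.eval_killing hg y ![a]
  | dKilling a b => exact h.eval_nab1 hg y a b
  | cubeRootConj => exact Smooth.eval_conj _ y
  | bivectorConj a b => exact Smooth.eval_conj _ y
  | killingConj a =>
    exact (Smooth.eval_conj _ y).trans (congrArg star (h.eval_killing hg y ![a]))
  | dKillingConj a b =>
    exact (Smooth.eval_conj _ y).trans (congrArg star (h.eval_nab1 hg y a b))

/-- Covariant derivatives of the Riemann tensor are universal polynomials. -/
theorem nablaIter_riemannField (hR : ∀ y ∈ Ω, ∀ a b, ricci g y a b = 0) (n : ℕ)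
    (i : Fin (4 + n) → Fin 4) (y : Ω) : nablaIter g (riemannField g) n y i
      = MvPolynomial.eval (varValue g s U y) (Pol.nablaRiem n i) := by
  rw [← hg.eval_nablaIter_riem, Geometry.IsTypeD.ev_nablaRiem hg.isReal (h.isTypeD hg hR)]
  have e : ((Smooth.eval y).comp (Geometry.IsTypeD.ev hg.geometry Smooth.conj h.root h.biv
      (killing hg h))) = MvPolynomial.aeval (varValue g s U y) := by
    refine MvPolynomial.algHom_ext fun v => ?_
    rw [AlgHom.comp_apply, MvPolynomial.aeval_X, MvPolynomial.aeval_X, h.eval_varVal hg]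
  have k := DFunLike.congr_fun e (Pol.nablaRiem n i)
  rwa [MvPolynomial.aeval_eq_eval] at k

/-- The second covariant derivative of the Killing vector. -/
theorem nablaIter_fieldZ (hR : ∀ y ∈ Ω, ∀ a b, ricci g y a b = 0) (y : Ω) (a b c : Fin 4) :
    nablaIter g (fieldZ g s U) 2 y ![a, b, c]
      = interiorProd g y (fieldZ g s U y) (fun i j k l =>
          w y * (3 * U y i j * U y k l + sdG g y i j k l)
            + star (w y * (3 * U y i j * U y k l + sdG g y i j k l))) a b c := by
  have hD := h.isTypeD hg hR
  have k := congrArg (Smooth.eval y) (hD.nab_nab1 a b c)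
  have e : ∀ a b c d, Smooth.eval y (hg.geometry.riem a b c d)
      = w y * (3 * U y a b * U y c d + sdG g y a b c d)
        + star (w y * (3 * U y a b * U y c d + sdG g y a b c d)) := by
    intro a b c d
    rw [← hg.isReal.sdPart_add_conj, map_add, Smooth.eval_conj,
      hg.eval_sdPart y (fun a b c d => hg.eval_riem y a b c d), ← IsLorentz.sdWeyl_eq (hR y y.2),
      hg.sdWeyl_eq_of_typeD hR y.2 (h.typeD y y.2)]
  have l : Smooth.eval y (cov2 (hg.geometry.der a) (hg.geometry.conn a)
      (hg.geometry.nab1 (killing hg h)) b c) = nablaIter g (fieldZ g s U) 2 y ![a, b, c] := by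
    rw [← hg.eval_nablaIter (h.eval_killing hg)]
    congr 1
    exact (hg.geometry.nablaIter_covector_two _ a b c).symm
  rw [← l, k, interiorProd]
  simp only [MetricData.interior, map_sum, map_mul, e, IsLorentz.eval_gi]
  exact Finset.sum_congr rfl fun i _ => Finset.sum_congr rfl fun j _ => by
    rw [← h.eval_killing hg y ![j]]; rfl

end IsCanonical
end

section

open TopologicalSpace (Opens)

/-! ### The eigenvalue as a rational function of the Weyl tensor -/

namespace MetricData

variable {A : Type*} [CommRing A] [Algebra ℂ A] {m : MetricData A}

/-- The composition of double 2-forms. -/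
def comp (m : MetricData A) (V V' : Quad A) : Quad A := fun a b c d => m.act V (slice V' c d) a b

/-- The scalar `g^{ad} g^{bc} V_{abcd}`. -/
def contract (m : MetricData A) (V : Quad A) : A :=
  ∑ a, ∑ d, m.gi a d * ∑ b, ∑ c, m.gi b c * V a b c d

/-- Double 2-forms with the symmetries of a type D self-dual Weyl tensor. -/
def axial (m : MetricData A) (U : M4 A) (p q : A) : Quad A := fun a b c d =>
  3 * p * (U a b * U c d) + q * m.sdG a b c d

theorem act_axial (h : m.IsMetric) {U X : M4 A} (hX : m.IsDual Complex.I X) (p q : A) :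
    m.act (m.axial U p q) X = (3 * p * m.pair U X) • U + q • X := by
  have k : q • X = q • m.act m.sdG X := by rw [hX.act_sdG h]
  rw [k, mul_smul, ← act_outer]
  ext a b
  simp only [act, axial, Matrix.of_apply, Matrix.smul_apply, Matrix.add_apply, smul_eq_mul,
    mul_smul_comm, ← smul_add, Finset.mul_sum, ← Finset.sum_add_distrib]
  congr 1
  exact Finset.sum_congr rfl fun _ _ => Finset.sum_congr rfl fun _ _ => by ring

/-- On self-dual bivectors `axial U p q` is q on the complement of U and q - 3p on U, and these
eigenvalues multiply. -/
theorem comp_axial (h : m.IsMetric) {U : M4 A} (hU : m.IsUnitBivector U) (p q p' q' : A) :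
    m.comp (m.axial U p q) (m.axial U p' q')
      = m.axial U (p * q' - 3 * (p * p') + q * p') (q * q') := by
  funext a b c d
  have e : slice (m.axial U p' q') c d = (3 * p' * U c d) • U + q' • slice m.sdG c d := by
    ext a b
    simp only [axial, slice_apply, Matrix.add_apply, Matrix.smul_apply, smul_eq_mul]
    ring
  rw [comp, e, act_add, act_smul', act_smul', act_axial h hU.isDual, act_axial h
    (isDual_slice_sdG h c d), hU.pair_self, pair_slice_sdG h hU.isDual]
  simp only [Matrix.add_apply, Matrix.smul_apply, smul_eq_mul, slice_apply, axial]
  ring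

/-- Equal to -2 times the trace 2q + (q - 3p) on self-dual bivectors. -/
theorem contract_axial (h : m.IsMetric) {U : M4 A} (hU : m.IsUnitBivector U) (p q : A) :
    m.contract (m.axial U p q) = 6 * (p - q) := by
  have e1 : ∀ a d, ∑ b, ∑ c, m.gi b c * (U a b * U c d) = (1 / 2 : ℂ) • m.g a d := by
    intro a d
    rw [← Matrix.smul_apply, ← hU.sq h]
    simp only [Matrix.mul_apply, Finset.sum_mul]
    rw [Finset.sum_comm]
    exact Finset.sum_congr rfl fun _ _ => Finset.sum_congr rfl fun _ _ => by ring
  have e2 : ∀ a d, ∑ b, ∑ c, m.gi b c * m.axial U p q a b c d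
      = (3 / 2 : ℂ) • ((p - q) * m.g a d) := by
    intro a d
    have : ∀ b c, m.gi b c * m.axial U p q a b c d
        = 3 * p * (m.gi b c * (U a b * U c d)) + q * (m.gi b c * m.sdG a b c d) := by
      intro b c; simp only [axial]; ring
    simp only [this, Finset.sum_add_distrib, ← Finset.mul_sum, e1, trace_sdG h]
    simp only [Algebra.smul_def, map_neg]
    rw [show (3 / 2 : ℂ) = 3 * (1 / 2) by norm_num, map_mul, map_ofNat]
    ring
  have e3 : ∑ a, ∑ d, m.gi a d * m.g a d = 4 := by
    have k := congrArg Matrix.trace h.inv_mul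
    rw [Matrix.trace_one] at k
    simp only [Matrix.trace, Matrix.diag, Matrix.mul_apply] at k
    rw [Fintype.card_fin] at k
    refine Eq.trans ?_ (k.trans (by norm_num))
    exact Finset.sum_congr rfl fun _ _ => Finset.sum_congr rfl fun _ _ => by rw [h.symm_apply]
  simp only [contract, e2, mul_smul_comm, ← Finset.smul_sum, mul_left_comm _ (p - q),
    ← Finset.mul_sum, e3]
  rw [Algebra.smul_def, show (3 / 2 : ℂ) = 3 * (1 / 2) by norm_num, map_mul, map_ofNat]
  have : (algebraMap ℂ A) (1 / 2) * 2 = 1 := by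
    rw [← map_ofNat (algebraMap ℂ A) 2, ← map_mul]; norm_num
  linear_combination 6 * (p - q) * this

end MetricData

variable {g : Coord → Matrix (Fin 4) (Fin 4) ℝ} {Ω : Opens Coord}

/-- The sign of U is free; a locally chosen square root may produce either one. -/
theorem IsTypeDAt.neg {y : Coord} {w : ℂ} {U : Bitensor} (h : IsTypeDAt g y w U) :
    IsTypeDAt g y w (-U) where
  ne_zero := h.ne_zero
  selfDual := by
    refine ⟨fun a b => by simp [h.selfDual.1 a b], fun a b => ?_⟩
    have k := h.selfDual.2 a b
    simp only [hodge, act, raise, Pi.neg_apply, mul_neg, Finset.sum_neg_distrib] at k ⊢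
    rw [k]
  normalized := by
    have k := h.normalized
    simp only [pairing, raise, Pi.neg_apply, mul_neg, neg_mul, Finset.sum_neg_distrib, neg_neg] at k ⊢
    exact k
  simple a b := by
    have k := h.simple a b
    simp only [act, raise, Pi.neg_apply, mul_neg, Finset.sum_neg_distrib] at k ⊢
    rw [k]
  double X hX hUX := h.double X hX (by
    simpa only [pairing, Pi.neg_apply, mul_neg, neg_mul, Finset.sum_neg_distrib, neg_eq_zero]
      using hUX)

namespace IsLorentz

variable (hg : IsLorentz g Ω)

theorem mono {Ω' : Opens Coord} (hg : IsLorentz g Ω) (h : Ω' ≤ Ω) : IsLorentz g Ω' :=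
  ⟨fun a b => (hg.smooth a b).mono h, fun y hy => hg.symm y (h hy), fun y hy => hg.det_neg y (h hy)⟩

include hg

theorem eval_act (y : Ω) {V : Quad (Smooth Ω)} {V' : Quad ℂ} {F : M4 (Smooth Ω)} {F' : M4 ℂ}
    (hV : ∀ a b c d, Smooth.eval y (V a b c d) = V' a b c d)
    (hF : ∀ a b, Smooth.eval y (F a b) = F' a b) (a b : Fin 4) :
    Smooth.eval y (hg.geometry.met.act V F a b) = (metricAt g y).act V' F' a b := by
  simp only [MetricData.act, Matrix.of_apply, map_smul, map_sum, map_mul, hg.eval_up y hF, hV]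

theorem eval_comp (y : Ω) {V W : Quad (Smooth Ω)} {V' W' : Quad ℂ}
    (hV : ∀ a b c d, Smooth.eval y (V a b c d) = V' a b c d)
    (hW : ∀ a b c d, Smooth.eval y (W a b c d) = W' a b c d) (a b c d : Fin 4) :
    Smooth.eval y (hg.geometry.met.comp V W a b c d) = (metricAt g y).comp V' W' a b c d :=
  hg.eval_act y hV (F' := slice W' c d) (fun a b => hW a b c d) a b

theorem eval_contract (y : Ω) {V : Quad (Smooth Ω)} {V' : Quad ℂ}
    (hV : ∀ a b c d, Smooth.eval y (V a b c d) = V' a b c d) :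
    Smooth.eval y (hg.geometry.met.contract V) = (metricAt g y).contract V' := by
  simp only [MetricData.contract, map_sum, map_mul, hV]
  rfl

theorem sdWeyl_eq_axial (hR : ∀ y ∈ Ω, ∀ a b, ricci g y a b = 0) {y : Coord} (hy : y ∈ Ω) {w : ℂ}
    {U : Bitensor} (h : IsTypeDAt g y w U) :
    sdWeyl g y = (metricAt g y).axial (Matrix.of U) w w := by
  funext a b c d
  rw [hg.sdWeyl_eq_of_typeD hR hy h, MetricData.axial, sdG_eq, Matrix.of_apply, Matrix.of_apply]
  ring

/-- The Weyl eigenvalue of type D points depends smoothly on the point. -/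
theorem exists_eigenvalue (hR : ∀ y ∈ Ω, ∀ a b, ricci g y a b = 0)
    (hD : ∀ y ∈ Ω, ∃ w U, IsTypeDAt g y w U) :
    ∃ W : Smooth Ω, ∀ (y : Ω) w U, IsTypeDAt g y w U → Smooth.eval y W = w := by
  set V := hg.geometry.met.sdPart hg.geometry.riem with hV
  have eV : ∀ (y : Ω) a b c d, Smooth.eval y (V a b c d) = sdWeyl g y a b c d := fun y a b c d => by
    rw [hV, hg.eval_sdPart y (fun a b c d => hg.eval_riem y a b c d), sdWeyl_eq (hR y y.2)]
  set V₂ := hg.geometry.met.comp V V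
  set V₃ := hg.geometry.met.comp V V₂
  -- The invariants of 𝒲² and 𝒲³ are -12w² and 12w³. Minus their quotient is w, so no root is
  -- extracted and U does not enter.
  have e₂ : ∀ (y : Ω) w U, IsTypeDAt g y w U →
      Smooth.eval y (hg.geometry.met.contract V₂) = -12 * w ^ 2 := by
    intro y w U h
    have hm := hg.isMetric_metricAt y.2
    have hU : (metricAt g y).IsUnitBivector (Matrix.of U) :=
      ⟨(isSelfDual_iff _ _).1 h.selfDual, by rw [← pairing_eq, h.normalized]⟩
    rw [hg.eval_contract y (hg.eval_comp y (eV y) (eV y)), hg.sdWeyl_eq_axial hR y.2 h,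
      MetricData.comp_axial hm hU, MetricData.contract_axial hm hU]
    ring
  have e₃ : ∀ (y : Ω) w U, IsTypeDAt g y w U →
      Smooth.eval y (hg.geometry.met.contract V₃) = 12 * w ^ 3 := by
    intro y w U h
    have hm := hg.isMetric_metricAt y.2
    have hU : (metricAt g y).IsUnitBivector (Matrix.of U) :=
      ⟨(isSelfDual_iff _ _).1 h.selfDual, by rw [← pairing_eq, h.normalized]⟩
    rw [hg.eval_contract y (hg.eval_comp y (eV y) (hg.eval_comp y (eV y) (eV y))),
      hg.sdWeyl_eq_axial hR y.2 h, MetricData.comp_axial hm hU, MetricData.comp_axial hm hU,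
      MetricData.contract_axial hm hU]
    ring
  have unit : IsUnit (hg.geometry.met.contract V₂) := Smooth.isUnit _ fun y => by
    obtain ⟨w, U, h⟩ := hD y y.2
    rw [e₂ y w U h]
    exact mul_ne_zero (by norm_num) (pow_ne_zero 2 h.ne_zero)
  obtain ⟨T, hT⟩ := unit.exists_right_inv
  refine ⟨-hg.geometry.met.contract V₃ * T, fun y w U h => ?_⟩
  have k := congrArg (Smooth.eval y) hT
  rw [map_mul, map_one, e₂ y w U h] at k
  rw [map_mul, map_neg, e₃ y w U h]
  linear_combination w * k

end IsLorentz

/-! ### Local smooth choices -/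

/-- A smooth nonvanishing function has smooth roots locally. -/
theorem exists_smooth_root (f : Smooth Ω) {y : Coord} (hy : y ∈ Ω) {k : ℕ} (hk : k ≠ 0) {r : ℂ}
    (hr : r ^ k = Smooth.eval ⟨y, hy⟩ f) (h0 : r ≠ 0) :
    ∃ (Ω' : Opens Coord) (hle : Ω' ≤ Ω) (ρ : Coord → ℂ), y ∈ Ω' ∧ ContDiffOn ℝ ∞ ρ Ω' ∧ ρ y = r ∧
      (∀ z (hz : z ∈ Ω'), ρ z ^ k = Smooth.eval ⟨z, hle hz⟩ f) ∧ ∀ z, ρ z ≠ 0 := by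
  have hf0 : f.toFun y = r ^ k := (f.toFun_apply ⟨y, hy⟩).trans hr.symm
  have hr0 : r ^ k ≠ 0 := pow_ne_zero k h0
  have hq : ContDiffOn ℝ ∞ (fun z => f.toFun z / r ^ k) Ω := by
    simp only [div_eq_mul_inv]
    exact f.contDiffOn_toFun.mul contDiffOn_const
  -- Where the normalized function, equal to 1 at y, avoids the cut, r · exp(log(f / r^k) / k) is a
  -- smooth root with value r at y.
  let Ω' : Opens Coord := ⟨Ω ∩ (fun z => f.toFun z / r ^ k) ⁻¹' Complex.slitPlane,
    hq.continuousOn.isOpen_inter_preimage Ω.isOpen Complex.isOpen_slitPlane⟩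
  have hle : Ω' ≤ Ω := fun z hz => hz.1
  refine ⟨Ω', hle, fun z => r * Complex.exp (Complex.log (f.toFun z / r ^ k) / k), ⟨hy, ?_⟩, ?_, ?_,
    fun z hz => ?_, fun z => mul_ne_zero h0 (Complex.exp_ne_zero _)⟩
  · change f.toFun y / r ^ k ∈ Complex.slitPlane
    rw [hf0, div_self hr0]
    exact Complex.one_mem_slitPlane
  · have hlog : ContDiffOn ℝ ∞ (fun z => Complex.log (f.toFun z / r ^ k)) Ω' := by
      intro z hz
      have hl : ContDiffAt ℂ ∞ Complex.log (f.toFun z / r ^ k) := Complex.contDiffAt_log hz.2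
      exact ContDiffAt.comp_contDiffWithinAt (g := Complex.log) z
        (hl.restrict_scalars ℝ) ((hq z hz.1).mono hle)
    simp only [div_eq_mul_inv _ (k : ℂ)]
    exact contDiffOn_const.mul (Complex.contDiff_exp.comp_contDiffOn
      (hlog.mul contDiffOn_const))
  · simp [hf0, div_self hr0]
  · have hz0 : f.toFun z / r ^ k ≠ 0 := Complex.slitPlane_ne_zero hz.2
    rw [mul_pow, ← Complex.exp_nat_mul, mul_div_cancel₀ _ (Nat.cast_ne_zero.2 hk),
      Complex.exp_log hz0, mul_div_cancel₀ _ hr0]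
    exact f.toFun_apply ⟨z, hle hz⟩

/-- Near a type D point, there are smooth choices of the canonical bivector and of the cube root
with prescribed values at the point. -/
theorem IsLorentz.exists_isCanonical (hg : IsLorentz g Ω)
    (hR : ∀ y ∈ Ω, ∀ a b, ricci g y a b = 0) (hD : ∀ y ∈ Ω, ∃ w U, IsTypeDAt g y w U)
    {y : Coord} (hy : y ∈ Ω) {w₀ s₀ : ℂ} {U₀ : Bitensor} (h : IsTypeDAt g y w₀ U₀)
    (hs : s₀ ^ 3 = w₀) :
    ∃ (Ω' : Opens Coord) (w s : Coord → ℂ) (U : Coord → Bitensor), Ω' ≤ Ω ∧ y ∈ Ω' ∧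
      IsCanonical g Ω' w s U ∧ s y = s₀ ∧ U y = U₀ := by
  obtain ⟨W, hW⟩ := hg.exists_eigenvalue hR hD
  have hs0 : s₀ ≠ 0 := by
    rintro rfl
    exact h.ne_zero (by rw [← hs]; simp)
  have unit : IsUnit (3 * W) := Smooth.isUnit _ fun z => by
    obtain ⟨w, U, k⟩ := hD z z.2
    rw [map_mul, map_ofNat, hW z w U k]
    exact mul_ne_zero three_ne_zero k.ne_zero
  obtain ⟨T, hT⟩ := unit.exists_right_inv
  obtain ⟨c, d, hcd⟩ : ∃ c d, U₀ c d ≠ 0 := by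
    by_contra! h0
    have := h.normalized
    simp [pairing, h0] at this
  -- the tensor `U ⊗ U`
  set Q : Quad (Smooth Ω) := fun a b c d =>
    T * (hg.geometry.met.sdPart hg.geometry.riem a b c d - W * hg.geometry.met.sdG a b c d) with hQ
  have eQ : ∀ (z : Ω) w U, IsTypeDAt g z w U → ∀ a b c d,
      Smooth.eval z (Q a b c d) = U a b * U c d := by
    intro z w U k a b c d
    have t := congrArg (Smooth.eval z) hT
    rw [map_mul, map_mul, map_ofNat, map_one, hW z w U k] at t
    rw [hQ, map_mul, map_sub, map_mul, hW z w U k, hg.eval_sdG,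
      hg.eval_sdPart z (fun a b c d => hg.eval_riem z a b c d), ← sdWeyl_eq (hR z z.2),
      hg.sdWeyl_eq_of_typeD hR z.2 k]
    linear_combination U a b * U c d * t
  clear_value Q
  obtain ⟨Ω₁, le₁, s, m₁, sm₁, v₁, r₁, -⟩ := exists_smooth_root W hy three_ne_zero
    (hs.trans (hW ⟨y, hy⟩ w₀ U₀ h).symm) hs0
  -- A square root ρ of (U_cd)² with the prescribed value at y recovers U smoothly as (U_ab U_cd)/ρ.
  obtain ⟨Ω₂, le₂, ρ, m₂, sm₂, v₂, r₂, n₂⟩ := exists_smooth_root (Q c d c d) hy two_ne_zero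
    ((pow_two _).trans (eQ ⟨y, hy⟩ w₀ U₀ h c d c d).symm) hcd
  refine ⟨Ω₁ ⊓ Ω₂, W.toFun, s, fun z a b => (Q a b c d).toFun z * (ρ z)⁻¹, inf_le_left.trans le₁,
    ⟨m₁, m₂⟩, ⟨fun z hz => ?_, fun z hz => ?_, sm₁.mono inf_le_left, fun a b => ?_⟩, v₁, ?_⟩
  · obtain ⟨w, U, k⟩ := hD z (le₁ hz.1)
    have e := eQ ⟨z, le₁ hz.1⟩ w U k
    have hw : W.toFun z = w := (W.toFun_apply ⟨z, le₁ hz.1⟩).trans (hW _ w U k)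
    have hUn : ∀ a b, (Q a b c d).toFun z = U a b * U c d := fun a b =>
      ((Q a b c d).toFun_apply ⟨z, le₁ hz.1⟩).trans (e a b c d)
    have sq : ρ z ^ 2 = U c d ^ 2 := (r₂ z hz.2).trans ((e c d c d).trans (pow_two _).symm)
    have hn := n₂ z
    rw [hw]
    simp only [hUn]
    -- At each point ρ is one of ±U_cd, so the constructed bivector is ±U; both are canonical.
    rcases sq_eq_sq_iff_eq_or_eq_neg.1 sq with hp | hp
    · have : (fun a b => U a b * U c d * (ρ z)⁻¹) = U := by
        funext a b
        rw [← hp, mul_inv_cancel_right₀ hn]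
      rwa [this]
    · have : (fun a b => U a b * U c d * (ρ z)⁻¹) = -U := by
        funext a b
        rw [← neg_eq_iff_eq_neg.2 hp, mul_neg, neg_mul, mul_inv_cancel_right₀ hn]
        rfl
      rw [this]
      exact k.neg
  · exact (r₁ z hz.1).trans (W.toFun_apply ⟨z, le₁ hz.1⟩).symm
  · exact ((Q a b c d).contDiffOn_toFun.mono (inf_le_left.trans le₁)).mul
      ((sm₂.mono inf_le_right).inv fun z _ => n₂ z)
  · funext a b
    change (Q a b c d).toFun y * (ρ y)⁻¹ = _
    rw [v₂, (Q a b c d).toFun_apply ⟨y, hy⟩, eQ ⟨y, hy⟩ w₀ U₀ h, mul_inv_cancel_right₀ hcd]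

end

section

open TopologicalSpace (Opens)

/-! ### Comparison of two points -/

section

variable {g g' : Coord → Matrix (Fin 4) (Fin 4) ℝ} {Ω Ω' : Opens Coord} {y y' : Coord}

theorem IsTypeDAt.congr (hgg : g y = g' y') (hW : sdWeyl g y = sdWeyl g' y') {w : ℂ} {U : Bitensor}
    (h : IsTypeDAt g y w U) : IsTypeDAt g' y' w U := by
  have hi : ginv g y = ginv g' y' := by funext a b; simp only [ginv, hgg]
  have hr : raise g y = raise g' y' := by funext F a b; simp only [raise, hi]
  have hp : pairing g y = pairing g' y' := by funext F H; simp only [pairing, hr]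
  have ha : act g y = act g' y' := by funext V F a b; simp only [act, hr]
  have he : eta g y = eta g' y' := by funext a b c d; simp only [eta, hgg]
  have hh : hodge g y = hodge g' y' := by funext F; simp only [hodge, ha, he]
  have hS : IsSelfDual g y = IsSelfDual g' y' := by funext F; simp only [IsSelfDual, hh]
  refine ⟨h.ne_zero, by rw [← hS]; exact h.selfDual, by rw [← hp]; exact h.normalized, fun a b => ?_, fun X hX hUX a b => ?_⟩
  · rw [← ha, ← hW]
    exact h.simple a b
  · rw [← ha, ← hW]
    exact h.double X (by rw [hS]; exact hX) (by rw [hp]; exact hUX) a b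

/-- All covariant derivatives of the Riemann tensor are determined by those of order at most
two. -/
theorem IsLorentz.nablaIter_riemannField_eq (hg : IsLorentz g Ω) (hg' : IsLorentz g' Ω')
    (hR : ∀ y ∈ Ω, ∀ a b, ricci g y a b = 0) (hR' : ∀ y ∈ Ω', ∀ a b, ricci g' y a b = 0)
    (hD : ∀ y ∈ Ω, ∃ w U, IsTypeDAt g y w U) (hD' : ∀ y ∈ Ω', ∃ w U, IsTypeDAt g' y w U)
    (hy : y ∈ Ω) (hy' : y' ∈ Ω') (hgg : g y = g' y')
    (hk : ∀ k ≤ 2, nablaIter g (riemannField g) k y = nablaIter g' (riemannField g') k y') (n : ℕ) :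
    nablaIter g (riemannField g) n y = nablaIter g' (riemannField g') n y' := by
  obtain ⟨w₀, U₀, h₀⟩ := hD y hy
  have hm : metricAt g y = metricAt g' y' := by simp only [metricAt, ginv, hgg]
  have hrm : ∀ a b c d, (riemann g y a b c d : ℂ) = riemann g' y' a b c d := fun a b c d =>
    congrFun (hk 0 (by norm_num)) ![a, b, c, d]
  have hW : sdWeyl g y = sdWeyl g' y' := by
    rw [sdWeyl_eq (hR y hy), sdWeyl_eq (hR' y' hy'), hm]
    simp only [hrm]
  -- Equal metric and curvature make the same w, U and cube root admissible at both points; smooth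
  -- fields with these values are then chosen around each.
  have h₀' := h₀.congr hgg hW
  obtain ⟨s₀, hs₀⟩ := IsAlgClosed.exists_pow_nat_eq w₀ (show 0 < 3 by norm_num)
  obtain ⟨Ω₁, w, s, U, le, m, hc, es, eU⟩ := hg.exists_isCanonical hR hD hy h₀ hs₀
  obtain ⟨Ω₁', w', s', U', le', m', hc', es', eU'⟩ := hg'.exists_isCanonical hR' hD' hy' h₀' hs₀
  have k := hg.mono le
  have k' := hg'.mono le'
  have hR₁ : ∀ y ∈ Ω₁, ∀ a b, ricci g y a b = 0 := fun y h => hR y (le h)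
  have hR₁' : ∀ y ∈ Ω₁', ∀ a b, ricci g' y a b = 0 := fun y h => hR' y (le' h)
  have hi : ginv g y = ginv g' y' := by funext a b; simp only [ginv, hgg]
  obtain ⟨hZ, hN⟩ := Geometry.killing_determined (hc.isTypeD k hR₁) (hc'.isTypeD k' hR₁')
    (Smooth.eval ⟨y, m⟩) (Smooth.eval ⟨y', m'⟩)
    (fun a b => by rw [k.eval_g, k'.eval_g, hgg])
    (fun a b => by rw [k.eval_gi, k'.eval_gi, hi])
    (by rw [k.eval_vol, k'.eval_vol, hgg])
    (es.trans es'.symm)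
    (fun a b => (congrFun (congrFun (eU.trans eU'.symm) a) b))
    (fun e a b c d => by
      rw [← Geometry.nablaIter_riem_one, ← Geometry.nablaIter_riem_one, k.eval_nablaIter_riem,
        k'.eval_nablaIter_riem, hk 1 (by norm_num)])
    (fun i e a b c d => by
      rw [← Geometry.nablaIter_riem_two, ← Geometry.nablaIter_riem_two, k.eval_nablaIter_riem,
        k'.eval_nablaIter_riem, hk 2 le_rfl])
  have eZ : ∀ a, fieldZ g s U y ![a] = fieldZ g' s' U' y' ![a] := fun a => by
    rw [← hc.eval_killing k ⟨y, m⟩, ← hc'.eval_killing k' ⟨y', m'⟩]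
    exact hZ a
  have eN : ∀ a b, nabla g (fieldZ g s U) y ![a, b] = nabla g' (fieldZ g' s' U') y' ![a, b] :=
    fun a b => by
      rw [← hc.eval_nab1 k ⟨y, m⟩, ← hc'.eval_nab1 k' ⟨y', m'⟩]
      exact hN a b
  have ev : varValue g s U y = varValue g' s' U' y' := by
    funext v
    cases v <;> simp only [varValue, eta, hgg, hi, es, es', eU, eU', eZ, eN]
  funext i
  rw [hc.nablaIter_riemannField k hR₁ n i ⟨y, m⟩, hc'.nablaIter_riemannField k' hR₁' n i ⟨y', m'⟩, ev]

end

/-! ### Charts -/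

section

universe u
variable {M : Type u} [TopologicalSpace M] [ChartedSpace (EuclideanSpace ℝ (Fin 4)) M]

theorem gram_eq {V : Type*} [AddCommGroup V] [Module ℝ V] (B : V →ₗ[ℝ] V →ₗ[ℝ] ℝ)
    (b c : Module.Basis (Fin 4) ℝ V) (D : Fin 4 → ℝ)
    (hb : ∀ i j, B (b i) (b j) = if i = j then D i else 0) :
    Matrix.of (fun i j => B (c i) (c j)) = (b.toMatrix c)ᵀ * Matrix.diagonal D * b.toMatrix c := by
  ext i j
  rw [Matrix.of_apply, ← b.sum_toMatrix_smul_self c i, ← b.sum_toMatrix_smul_self c j]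
  simp only [map_sum, map_smul, LinearMap.sum_apply, LinearMap.smul_apply, hb, Matrix.mul_apply,
    Matrix.diagonal_apply, Matrix.transpose_apply, smul_eq_mul, mul_ite, mul_zero,
    Finset.sum_ite_eq', Finset.mem_univ, if_true]
  exact Finset.sum_congr rfl fun _ _ => by ring

/-- The target of a chart as an open set. -/
def chartTarget (e : OpenPartialHomeomorph M (EuclideanSpace ℝ (Fin 4))) : Opens Coord :=
  ⟨e.target, e.open_target⟩

/-- Coordinate vectors form a basis, since the derivative of the inverse chart is invertible. The
Gram matrix is therefore congruent to diag(-1,1,1,1), and its determinant is minus a nonzero square.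
-/
theorem LorentzMetric.det_comp_neg [IsManifold (𝓡 4) ∞ M] (γ : LorentzMetric M)
    {e : OpenPartialHomeomorph M (EuclideanSpace ℝ (Fin 4))}
    (he : e ∈ IsManifold.maximalAtlas (𝓡 4) ∞ M) {y : Coord} (hy : y ∈ e.target) :
    (γ.comp e y).det < 0 := by
  have hd : e.MDifferentiable (𝓡 4) (𝓡 4) :=
    ⟨(contMDiffOn_of_mem_maximalAtlas he).mdifferentiableOn (by simp),
      (contMDiffOn_symm_of_mem_maximalAtlas he).mdifferentiableOn (by simp)⟩
  let ψ : Coord ≃ₗ[ℝ] TangentSpace (𝓡 4) (e.symm y) := (hd.symm.mfderiv (x := y) hy).toLinearEquiv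
  let c : Module.Basis (Fin 4) ℝ (TangentSpace (𝓡 4) (e.symm y)) :=
    (EuclideanSpace.basisFun (Fin 4) ℝ).toBasis.map ψ
  have hc : ∀ a, c a = mfderiv (𝓡 4) (𝓡 4) e.symm y (coordVec a) := by
    intro a
    simp only [c, Module.Basis.map_apply, OrthonormalBasis.coe_toBasis,
      EuclideanSpace.basisFun_apply]
    rfl
  obtain ⟨b, hb⟩ := γ.signature (e.symm y)
  have key : γ.comp e y
      = (b.toMatrix c)ᵀ * Matrix.diagonal (fun i : Fin 4 => if i = 0 then (-1 : ℝ) else 1)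
        * b.toMatrix c := by
    ext i j
    change γ.val (e.symm y) _ _ = _
    rw [← hc, ← hc, ← gram_eq (γ.val (e.symm y)) b c _ hb, Matrix.of_apply]
  rw [key, Matrix.det_mul, Matrix.det_mul, Matrix.det_transpose, Matrix.det_diagonal,
    Fin.prod_univ_four]
  have h0 : (b.toMatrix c).det ≠ 0 := by
    rw [← Module.Basis.det_apply]
    exact (b.isUnit_det c).ne_zero
  have := pow_pos (abs_pos.2 h0) 2
  rw [sq_abs] at this
  simp
  nlinarith

theorem LorentzMetric.isLorentz_comp [IsManifold (𝓡 4) ∞ M] (γ : LorentzMetric M)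
    {e : OpenPartialHomeomorph M (EuclideanSpace ℝ (Fin 4))}
    (he : e ∈ IsManifold.maximalAtlas (𝓡 4) ∞ M) : IsLorentz (γ.comp e) (chartTarget e) where
  smooth := γ.smooth e he
  symm _ _ _ _ := γ.symm _ _ _
  det_neg _ hy := γ.det_comp_neg he hy

end
end

end TypeD

end

/-! ### The three assertions in charts -/

open TypeD in
theorem proposition2 :
    -- the second covariant derivative of the Killing vector `Z`
    (∀ (M : Type*) [TopologicalSpace M] [ChartedSpace (EuclideanSpace ℝ (Fin 4)) M]
        [IsManifold (𝓡 4) ∞ M] (γ : LorentzMetric M), γ.IsTypeDVacuum →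
      ∀ e ∈ IsManifold.maximalAtlas (𝓡 4) ∞ M,
      ∀ (w s : Coord → ℂ) (U : Coord → Bitensor), IsCanonical (γ.comp e) e.target w s U →
      ∀ y ∈ e.target, ∀ a b c : Fin 4,
        nablaIter (γ.comp e) (fieldZ (γ.comp e) s U) 2 y ![a, b, c] =
          interiorProd (γ.comp e) y (fieldZ (γ.comp e) s U y)
            (fun i j k l =>
              w y * (3 * U y i j * U y k l + sdG (γ.comp e) y i j k l)
              + star (w y * (3 * U y i j * U y k l + sdG (γ.comp e) y i j k l))) a b c) ∧
    -- every derivative of the Riemann tensor is a universal polynomial in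
    -- `w^{1/3}`, `U`, `Z`, `∇Z`, their conjugates, and the metric
    (∀ (n : ℕ) (i : Fin (4 + n) → Fin 4), ∃ P : MvPolynomial Var ℂ,
      ∀ (M : Type*) [TopologicalSpace M] [ChartedSpace (EuclideanSpace ℝ (Fin 4)) M]
        [IsManifold (𝓡 4) ∞ M] (γ : LorentzMetric M), γ.IsTypeDVacuum →
      ∀ e ∈ IsManifold.maximalAtlas (𝓡 4) ∞ M,
      ∀ (w s : Coord → ℂ) (U : Coord → Bitensor), IsCanonical (γ.comp e) e.target w s U →
      ∀ y ∈ e.target,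
        nablaIter (γ.comp e) (riemannField (γ.comp e)) n y i =
          MvPolynomial.eval (varValue (γ.comp e) s U y) P) ∧
    -- all derivatives of the Riemann tensor are determined by those of order at most two
    (∀ (M M' : Type*) [TopologicalSpace M] [ChartedSpace (EuclideanSpace ℝ (Fin 4)) M]
        [IsManifold (𝓡 4) ∞ M] [TopologicalSpace M']
        [ChartedSpace (EuclideanSpace ℝ (Fin 4)) M'] [IsManifold (𝓡 4) ∞ M']
        (γ : LorentzMetric M) (γ' : LorentzMetric M'), γ.IsTypeDVacuum → γ'.IsTypeDVacuum →
      ∀ e ∈ IsManifold.maximalAtlas (𝓡 4) ∞ M, ∀ e' ∈ IsManifold.maximalAtlas (𝓡 4) ∞ M',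
      ∀ y ∈ e.target, ∀ y' ∈ e'.target,
        γ.comp e y = γ'.comp e' y' →
        (∀ k ≤ 2, nablaIter (γ.comp e) (riemannField (γ.comp e)) k y =
          nablaIter (γ'.comp e') (riemannField (γ'.comp e')) k y') →
        ∀ n, nablaIter (γ.comp e) (riemannField (γ.comp e)) n y =
          nablaIter (γ'.comp e') (riemannField (γ'.comp e')) n y') := by
  refine ⟨?_, ?_, ?_⟩
  · intro M _ _ _ γ hγ e he w s U h y hy a b c
    exact h.nablaIter_fieldZ (Ω := chartTarget e) (γ.isLorentz_comp he) (hγ.vacuum e he) ⟨y, hy⟩ a b c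
  · intro n i
    -- Universality is visible in the witness, fixed before any space-time is given.
    refine ⟨Pol.nablaRiem n i, fun M _ _ _ γ hγ e he w s U h y hy => ?_⟩
    exact h.nablaIter_riemannField (Ω := chartTarget e) (γ.isLorentz_comp he) (hγ.vacuum e he) n i
      ⟨y, hy⟩
  · intro M M' _ _ _ _ _ _ γ γ' hγ hγ' e he e' he' y hy y' hy' hgg hk n
    exact (γ.isLorentz_comp he).nablaIter_riemannField_eq (γ'.isLorentz_comp he') (hγ.vacuum e he)
      (hγ'.vacuum e' he') (hγ.typeD e he) (hγ'.typeD e' he') hy hy' hgg hk n
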